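/- **Setup.** Let $\mathbf{k}\subset\mathbb{C}$ (via a fixed embedding) be an imaginary quadratic field of odd discriminant $-d$, with ring of integers $\mathcal{O}$, and put $\delta=i\sqrt{d}$. Let $n\ge 2$ and let $L$ be a self-dual Hermitian $\mathcal{O}$-lattice of signature $(n-1,1)$, with $V=L\otimes_{\mathcal O}\mathbf{k}$, and let $\mathfrak{a}\subset L$ be an isotropic direct summand of rank one. Fix a decomposition $L=\mathfrak{a}\oplus\Lambda\oplus\mathfrak{c}$ with $\mathfrak{c}$ isotropic, $\mathfrak{a}^\perp=\mathfrak{a}\oplus\Lambda$ and $\Lambda=(\mathfrak{a}\oplus\mathfrak{c})^\perp$ positive definite, and a $\mathbf{k}$-basis $e,e_1,\dots,e_{n-2},e'$ of $V$, adapted to it, in which $$\langle f,g\rangle={}^tf\begin{pmatrix}0&0&\delta\\0&A&0\\-\delta&0&0\end{pmatrix}\overline{g}$$ with $A$ a diagonal rational matrix with positive entries. Write $\mathfrak{a}=\mathfrak{a}_0e$, $\mathfrak{c}=\mathfrak{c}_0e'$ with fractional ideals $\mathfrak{a}_0,\mathfrak{c}_0$. Let $\mathcal{D}$ be the space of negative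 lines in $V_{\mathbb{C}}$. Every such line is spanned by a unique vector $(z,u,1)$ with $z\in\mathbb{C}$, $u\in\mathbb{C}^{n-2}$, and we put $$\xi(z,u)=-i\sqrt{d}\,(z-\overline z)-{}^tuA\overline u>0,\qquad \Psi_f(z,u)=\langle (z,u,1),f\rangle\quad(f\in V),$$ $\mathcal{D}(f)=\{\Psi_f=0\}$ and $\mathcal{D}^\epsilon=\{h\in\mathcal{D}:1/\xi(h)<\epsilon\}$. Let $r\in\mathbb{Q}^+$ be such that the maps $(z,u)\mapsto(z+X,u)$, $X\in r\mathbb{Z}$, are the elements of the group $C_\Gamma$ of automorphisms of $L$ of the form $f\mapsto f+Xc(f)e$, where $c(f)$ is the $e'$-coordinate. With $q=e^{2\pi iz/r}$ the quotient $C_\Gamma\backslash\mathcal{D}^\epsilon$ is the locus $q\ne0$ in $$\overline{C_\Gamma\backslash\mathcal{D}^\epsilon}=\Big\{(q,u)\in\mathbb{C}\times\mathbb{C}^{n-2}: |q|<\exp\Big(-\tfrac{\pi}{r\sqrt d}\big(\tfrac1\epsilon+{}^tuA\overline u\big)\Big)\Big\}.$$ Let $m\neq0$ be an integer, and put $L^{\mathrm{bnd}}(m)=\{f\in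 L:\langle f,f\rangle=m,\ \langle f,\mathfrak{a}\rangle=0\}$, $\mathrm{Ind}(m)=\#\{f\in\mathfrak{a}^\perp/\mathfrak{a}:\langle f,f\rangle=m\}$, and, for $v>0$, $$\mathrm{Gr}^{\mathrm{bnd}}(m,v,h)=\sum_{f\in L^{\mathrm{bnd}}(m)}\beta_1\Big(\frac{4\pi v|\Psi_f(h)|^2}{\xi(h)}\Big),\qquad \beta_1(x)=\int_1^\infty e^{-xt}\,\frac{dt}{t}.$$ Let $\mathtt{KR}^*(m)$ be the closure in $\overline{C_\Gamma\backslash\mathcal{D}^\epsilon}$ of the divisor on $C_\Gamma\backslash\mathcal{D}^\epsilon$ whose pullback to $\mathcal{D}^\epsilon$ is $\sum_{f\in L,\ \langle f,f\rangle=m}\mathcal{D}(f)$. **Log-log growth.** Let $U\subset\overline{C_\Gamma\backslash\mathcal{D}^\epsilon}$ be open. A differential form on $U\smallsetminus\{q=0\}$ has log-log growth along $q=0$ if every point of $U$ with $q=0$ has an open neighborhood $B\subset\{|q|<1/e\}$ such that on $U\cap B\smallsetminus\{q=0\}$ the form lies in the subalgebra, of the algebra of complex differential forms, generated by $\frac{dq}{q\log|q|}$,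 $\frac{d\overline q}{\overline q\log|q|}$, $du_i$, $d\overline u_i$ $(1\le i\le n-2)$ and the smooth functions that are $O(\log\log|q^{-1}|)$ there. **Proposition.** The number $\mathrm{Ind}(m)$ is finite, and there is $\epsilon_0>0$, depending on $m$ and the above data but not on $v$, such that the following holds for all $0<\epsilon\le\epsilon_0$ and all $v>0$. Let $U$ be an open subset of $\overline{C_\Gamma\backslash\mathcal{D}^\epsilon}$ and let $\psi_m=0$ be an equation on $U$ for the divisor $\mathtt{KR}^*(m)$. Then, away from this divisor and $q=0$, the sum $\mathrm{Gr}^{\mathrm{bnd}}(m,v,h)$ converges, and the function $$\mathcal{E}^{\mathrm{bnd}}(h)=\log|\psi_m(h)|^2-\frac{\mathrm{Ind}(m)\,\xi(h)}{4v\,\mathrm{Vol}(\mathbb{C}/\delta\overline{\mathfrak{a}}_0)}+\mathrm{Gr}^{\mathrm{bnd}}(m,v,h)$$ extends to a smooth function on $U\smallsetminus\{q=0\}$. This function is bounded near every point of $U$, including the points with $q=0$, and the differential forms $\partial\mathcal{E}^{\mathrm{bnd}}$, $\overline\partial\mathcal{E}^{\mathrm{bnd}}$ and $\partial\overline\partial\mathcal{E}^{\mathrm{bnd}}$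 have log-log growth along $q=0$. -/

import Mathlib

open scoped NumberField nonZeroDivisors Topology ContDiff

noncomputable section

namespace KudlaCusp

/-! ### Hermitian lattices in cusp coordinates

`N` is `n - 2`.  The vector `a e + b₁ e₁ + ⋯ + b_N e_N + c e'` is the triple `(a, b, c)`, over the
imaginary quadratic field `k` for the space `V`, over `ℂ` for its complexification. -/

/-- Coordinate vectors `(a, b, c)`. -/
abbrev Vec (R : Type*) (N : ℕ) : Type _ := R × (Fin N → R) × R

/-- The complexification map `V → V ⊗_{k, ι} ℂ`. -/
def toC {k : Type*} [Field k] (ι : k →+* ℂ) {N : ℕ} (f : Vec k N) : Vec ℂ N :=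
  (ι f.1, fun i => ι (f.2.1 i), ι f.2.2)

/-- `δ = i √d`, as a complex number. -/
def delta (d : ℕ) : ℂ := Complex.I * (Real.sqrt d : ℂ)

/-- The Hermitian form (linear in the first variable) with Gram matrix
`[[0, 0, δ], [0, A, 0], [-δ, 0, 0]]`, where `A` is diagonal. -/
def hermC (d : ℕ) {N : ℕ} (A : Fin N → ℚ) (x y : Vec ℂ N) : ℂ :=
  delta d * x.1 * star y.2.2 + ∑ i, x.2.1 i * (A i : ℂ) * star (y.2.1 i)
    - delta d * x.2.2 * star y.1

/-- The lattice `𝔞₀ e ⊕ Λ ⊕ 𝔠₀ e'`. -/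
def prodLattice {k : Type*} [Field k] [NumberField k] {N : ℕ}
    (𝔞₀ : FractionalIdeal (𝓞 k)⁰ k) (Λ : Submodule (𝓞 k) (Fin N → k))
    (𝔠₀ : FractionalIdeal (𝓞 k)⁰ k) : Submodule (𝓞 k) (Vec k N) :=
  (𝔞₀ : Submodule (𝓞 k) k).prod (Λ.prod (𝔠₀ : Submodule (𝓞 k) k))

/-- `L` is self dual for the Hermitian form: the form is `𝓞 k`-valued on `L`, and
`y ↦ ⟨·, y⟩` is a bijection from `L` to `Hom(L, 𝓞 k)`. -/
def IsSelfDual {k : Type*} [Field k] [NumberField k] (ι : k →+* ℂ) (d : ℕ) {N : ℕ}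
    (A : Fin N → ℚ) (L : Submodule (𝓞 k) (Vec k N)) : Prop :=
  (∀ x ∈ L, ∀ y ∈ L, ∃ a : 𝓞 k, hermC d A (toC ι x) (toC ι y) = ι (a : k)) ∧
  ∀ φ : L →ₗ[𝓞 k] 𝓞 k, ∃! y : L, ∀ x : L, hermC d A (toC ι x.1) (toC ι y.1) = ι (φ x : k)

/-- A self dual Hermitian lattice `L = 𝔞₀ e ⊕ Λ ⊕ 𝔠₀ e'` of signature `(N + 1, 1)`, with its
isotropic rank one direct summand `𝔞 = 𝔞₀ e` (the cusp), an isotropic complement `𝔠₀ e'` of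
`𝔞^⊥ = 𝔞 ⊕ Λ`, and a basis `e, e₁, …, e_N, e'` of `L_k` in which the form has the above Gram
matrix with `A` positive and rational. -/
structure CuspDatum (k : Type*) [Field k] [NumberField k] (ι : k →+* ℂ) (d N : ℕ) where
  A : Fin N → ℚ
  A_pos : ∀ i, 0 < A i
  𝔞₀ : FractionalIdeal (𝓞 k)⁰ k
  𝔞₀_ne_zero : 𝔞₀ ≠ 0
  𝔠₀ : FractionalIdeal (𝓞 k)⁰ k
  𝔠₀_ne_zero : 𝔠₀ ≠ 0
  Λ : Submodule (𝓞 k) (Fin N → k)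
  Λ_fg : Λ.FG
  Λ_span : Submodule.span k (Λ : Set (Fin N → k)) = ⊤
  selfDual : IsSelfDual ι d A (prodLattice 𝔞₀ Λ 𝔠₀)

/-- `β₁(x) = ∫_1^∞ e^{-xt} dt/t`. -/
def beta1 (x : ℝ) : ℝ := ∫ t in Set.Ioi (1 : ℝ), Real.exp (-x * t) / t

namespace CuspDatum

variable {k : Type*} [Field k] [NumberField k] {ι : k →+* ℂ} {d N : ℕ} (D : CuspDatum k ι d N)

/-- The lattice `L`. -/
def L : Submodule (𝓞 k) (Vec k N) := prodLattice D.𝔞₀ D.Λ D.𝔠₀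

/-- The isotropic line `𝔞 = 𝔞₀ e` in `L`. -/
def 𝔞 : Submodule (𝓞 k) (Vec k N) := prodLattice D.𝔞₀ ⊥ 0

/-- The Hermitian form `⟨f, g⟩` on `V`, with values in `k ⊂ ℂ`. -/
def herm (f g : Vec k N) : ℂ := hermC d D.A (toC ι f) (toC ι g)

/-- `{f ∈ L : ⟨f, f⟩ = m}`. -/
def Lnorm (m : ℤ) : Set (Vec k N) := {f | f ∈ D.L ∧ D.herm f f = m}

/-- `L^bnd(m) = {f ∈ L : ⟨f, f⟩ = m and ⟨f, 𝔞⟩ = 0}`. -/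
def Lbnd (m : ℤ) : Set (Vec k N) := {f | f ∈ D.Lnorm m ∧ ∀ g ∈ D.𝔞, D.herm f g = 0}

/-- `{f ∈ 𝔞^⊥/𝔞 : ⟨f, f⟩ = m}`, as a subset of `V/𝔞` (which contains `𝔞^⊥/𝔞`). -/
def indexSet (m : ℤ) : Set (Vec k N ⧸ D.𝔞) := D.𝔞.mkQ '' D.Lbnd m

/-- `Ind(m)`. -/
def Ind (m : ℤ) : ℕ := (D.indexSet m).ncard

/-- The lattice `δ · conj(𝔞₀)` in `ℂ`. -/
def dualLattice : Submodule ℤ ℂ :=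
  (((D.𝔞₀ : Submodule (𝓞 k) k).toAddSubgroup.map ι.toAddMonoidHom).map
    ((AddMonoidHom.mulLeft (delta d)).comp
      (starRingEnd ℂ).toAddMonoidHom)).toIntSubmodule

/-- `Vol(ℂ / δ conj(𝔞₀))` for Lebesgue measure on `ℂ`. -/
def vol : ℝ := ZLattice.covolume D.dualLattice

/-! ### The hermitian domain and its coordinates

A negative line in `V_ℂ` is spanned by a unique vector `(z, u, 1)`; the point `(z, u)` is
stored as `w : Fin (N + 1) → ℂ` with `w 0 = z` and `w i.succ = u i`. -/

/-- The vector `(z, u, 1)`. -/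
def lineVec {N : ℕ} (w : Fin (N + 1) → ℂ) : Vec ℂ N := (w 0, fun i => w i.succ, 1)

/-- The space of negative lines, in the coordinates `(z, u)`. -/
def domain : Set (Fin (N + 1) → ℂ) := {w | (hermC d D.A (lineVec w) (lineVec w)).re < 0}

/-- `ξ(h) = -d ⟨x, x⟩ / |⟨x, e⟩|²` for any nonzero `x` on the line `h`. -/
def xi (w : Fin (N + 1) → ℂ) : ℝ :=
  -d * (hermC d D.A (lineVec w) (lineVec w)).re
    / ‖hermC d D.A (lineVec w) ((1, 0, 0) : Vec ℂ N)‖ ^ 2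

/-- `𝒟^ε = {h : 1 / ξ(h) < ε}`. -/
def domainEps (ε : ℝ) : Set (Fin (N + 1) → ℂ) := {w | w ∈ D.domain ∧ 1 / D.xi w < ε}

/-- `Ψ_f(z, u) = ⟨(z, u, 1), f⟩`. -/
def Psi (f : Vec k N) (w : Fin (N + 1) → ℂ) : ℂ := hermC d D.A (lineVec w) (toC ι f)

/-- The general term `β₁(4πv |Ψ_f(h)|² / ξ(h))` of the Green function. -/
def grTerm (v : ℝ) (w : Fin (N + 1) → ℂ) (f : Vec k N) : ℝ :=
  beta1 (4 * Real.pi * v * ‖D.Psi f w‖ ^ 2 / D.xi w)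

/-- `Gr^bnd(m, v, h)`. -/
def GrBnd (m : ℤ) (v : ℝ) (w : Fin (N + 1) → ℂ) : ℝ := ∑' f : D.Lbnd m, D.grTerm v w f

/-! ### The partial compactification -/

/-- The unipotent map with matrix `[[1, 0, X], [0, 1, 0], [0, 0, 1]]`. -/
def centralMap {N : ℕ} (X : k) (f : Vec k N) : Vec k N := (f.1 + X * f.2.2, f.2.1, f.2.2)

/-- The group `C_Γ`, as the set of those `X` whose central unipotent map is an isometry of `V`
preserving `L`. -/
def CΓ : Set k :=
  {X | (∀ f g, D.herm (centralMap X f) (centralMap X g) = D.herm f g) ∧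
    ∀ f, centralMap X f ∈ D.L ↔ f ∈ D.L}

/-- `r` is the positive rational number with `C_Γ = rℤ`. -/
def IsWidth (r : ℚ) : Prop := 0 < r ∧ D.CΓ = {X | ∃ j : ℤ, X = (j : k) * (r : k)}

/-- The quotient map `(z, u) ↦ (q, u)`, `q = e^{2πiz/r}`, of the action of `C_Γ`. -/
def toChart {N : ℕ} (r : ℚ) (w : Fin (N + 1) → ℂ) : Fin (N + 1) → ℂ :=
  Fin.cons (Complex.exp (2 * Real.pi * Complex.I * w 0 / (r : ℂ))) (fun i => w i.succ)

/-- The partial compactification of `C_Γ \ 𝒟^ε`: the set of `(q, u)` with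
`|q| < exp(-(π / (r√d)) (1/ε + ᵗu A ū))`. The boundary is `q = 0`. -/
def chart (r : ℚ) (ε : ℝ) : Set (Fin (N + 1) → ℂ) :=
  {p | ‖p 0‖ < Real.exp (-(Real.pi / ((r : ℝ) * Real.sqrt d) *
    (1 / ε + ∑ i : Fin N, (D.A i : ℝ) * ‖p i.succ‖ ^ 2)))}

/-- `ψ` is an equation on the open set `U` of the partial compactification for the closure
of the image of the divisor `∑_{f ∈ L, ⟨f, f⟩ = m} 𝒟(f)`, `𝒟(f) = {Ψ_f = 0}`.  That is:
`ψ` is holomorphic; near every point of `𝒟` over `U` its pullback is a unit times the product of the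
finitely many `Ψ_f` which vanish there; and its divisor contains no piece of `q = 0`. -/
def IsEquationKR (r : ℚ) (m : ℤ) (U : Set (Fin (N + 1) → ℂ)) (ψ : (Fin (N + 1) → ℂ) → ℂ) :
    Prop :=
  AnalyticOnNhd ℂ ψ U ∧
  (∀ w ∈ D.domain, toChart r w ∈ U →
    ∃ F : Finset (Vec k N), (∀ f, f ∈ F ↔ f ∈ D.Lnorm m ∧ D.Psi f w = 0) ∧
      ∃ g : (Fin (N + 1) → ℂ) → ℂ, AnalyticAt ℂ g w ∧ g w ≠ 0 ∧
        ∀ᶠ x in 𝓝 w, ψ (toChart r x) = g x * ∏ f ∈ F, D.Psi f x) ∧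
  ∀ p ∈ U, p 0 = 0 → ∃ᶠ x in 𝓝[{x | x 0 = 0}] p, ψ x ≠ 0

end CuspDatum

/-! ### Differential forms on open subsets of `ℂ^{N+1}` and log-log growth along `q = 0`

The coordinates are `q = p 0` and `u i = p i.succ`. -/

/-- The complex exterior algebra of the cotangent space `Hom_ℝ(ℂ^{N+1}, ℂ)`. -/
abbrev Ext (N : ℕ) : Type := ExteriorAlgebra ℂ ((Fin (N + 1) → ℂ) →ₗ[ℝ] ℂ)

/-- `dp_i` -/
def dz {N : ℕ} (i : Fin (N + 1)) : Ext N :=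
  ExteriorAlgebra.ι ℂ ((LinearMap.proj i : (Fin (N + 1) → ℂ) →ₗ[ℂ] ℂ).restrictScalars ℝ)

/-- The conjugate form of `dp_i`. -/
def dzbar {N : ℕ} (i : Fin (N + 1)) : Ext N :=
  ExteriorAlgebra.ι ℂ (Complex.conjAe.toLinearMap ∘ₗ
    (LinearMap.proj i : (Fin (N + 1) → ℂ) →ₗ[ℂ] ℂ).restrictScalars ℝ)

/-- `∂F/∂p_i` -/
def wirt {N : ℕ} (i : Fin (N + 1)) (F : (Fin (N + 1) → ℂ) → ℂ) (p : Fin (N + 1) → ℂ) : ℂ :=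
  (fderiv ℝ F p (Pi.single i 1) - Complex.I * fderiv ℝ F p (Pi.single i Complex.I)) / 2

/-- The derivative of `F` with respect to the conjugate of `p_i`. -/
def wirtBar {N : ℕ} (i : Fin (N + 1)) (F : (Fin (N + 1) → ℂ) → ℂ) (p : Fin (N + 1) → ℂ) : ℂ :=
  (fderiv ℝ F p (Pi.single i 1) + Complex.I * fderiv ℝ F p (Pi.single i Complex.I)) / 2

/-- The form `∂F`. -/
def del {N : ℕ} (F : (Fin (N + 1) → ℂ) → ℂ) (p : Fin (N + 1) → ℂ) : Ext N :=
  ∑ i, wirt i F p • dz i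

/-- The form `∂̄F`. -/
def delBar {N : ℕ} (F : (Fin (N + 1) → ℂ) → ℂ) (p : Fin (N + 1) → ℂ) : Ext N :=
  ∑ i, wirtBar i F p • dzbar i

/-- The form `∂∂̄F`. -/
def delDelBar {N : ℕ} (F : (Fin (N + 1) → ℂ) → ℂ) (p : Fin (N + 1) → ℂ) : Ext N :=
  ∑ i, ∑ j, wirt i (wirtBar j F) p • (dz i * dzbar j)

/-- On a set `W` of points with `0 < |q| < 1/e`: the generators `dq/(q log|q|)`, its conjugate,
`du_i`, `dū_i`, and the smooth functions which are `O(log log |q⁻¹|)` on `W`. -/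
def logLogGenerators {N : ℕ} (W : Set (Fin (N + 1) → ℂ)) : Set (W → Ext N) :=
  {fun p => (p.1 0 * (Real.log ‖p.1 0‖ : ℂ))⁻¹ • dz 0,
    fun p => (star (p.1 0) * (Real.log ‖p.1 0‖ : ℂ))⁻¹ • dzbar 0} ∪
  Set.range (fun (i : Fin N) (_ : W) => dz i.succ) ∪
  Set.range (fun (i : Fin N) (_ : W) => dzbar i.succ) ∪
  {θ | ∃ f : (Fin (N + 1) → ℂ) → ℂ, ContDiffOn ℝ ∞ f W ∧
    (∃ C : ℝ, ∀ p ∈ W, ‖f p‖ ≤ C * Real.log (Real.log ‖p 0‖⁻¹)) ∧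
    θ = fun p => algebraMap ℂ (Ext N) (f p.1)}

/-- The form `θ` on `U ∖ {q = 0}` has log-log growth along `q = 0`: around every point of `U` with
`q = 0` there is an open set, on which `|q| < 1/e`, over which `θ` lies in the subalgebra
of all forms that is generated by `logLogGenerators`. -/
def LogLogGrowth {N : ℕ} (U : Set (Fin (N + 1) → ℂ)) (θ : (Fin (N + 1) → ℂ) → Ext N) : Prop :=
  ∀ p ∈ U, p 0 = 0 → ∃ B : Set (Fin (N + 1) → ℂ), IsOpen B ∧ p ∈ B ∧
    (∀ x ∈ B, ‖x 0‖ < Real.exp (-1)) ∧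
    (fun x : ↥(U ∩ B ∩ {x | x 0 ≠ 0}) => θ x) ∈
      Algebra.adjoin ℂ (logLogGenerators (U ∩ B ∩ {x | x 0 ≠ 0}))

end KudlaCusp

end

/-! Orthogonality to `𝔞` kills the e'-coordinate. So a vector of `Lbnd m` is a pair (a, b) with a in
𝔞₀ and b in the finite set `shell m` of vectors of norm m in Λ, and Ψ_f = s_b − δā, where s_b =
`slope b` is a linear form in u alone. The Green sum is therefore a finite sum over b of lattice
sums of β₁(|s_b − λ|²/τ), with λ running through δ·conj(𝔞₀) and τ = ξ/(4πv).

The core is an exact formula for such a lattice sum, `hasSum_beta1_div`. Writing β₁(x/τ) as β₁(x)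
plus the integral of e^{-xw}/w from 1/τ to 1 (`beta1_div`) confines τ to Gaussians over a compact
range of w. Poisson summation (`tsum_theta`) applies there, and every frequency integrates in closed
form. Frequency zero gives π(τ − 1)/Vol, whose growing part, summed over b, is exactly the
subtracted multiple of ξ. What remains is `betaSum` and `dualSum` at τ = 1, which depend on u only,
and −`dualSum` at τ, which decays exponentially in τ.

The part depending on u has only logarithmic singularities, at the lattice points
(`betaSum_regular`). They cancel against log|ψ|² provided that ψ is locally a unit times the forms
s_b − λ that vanish at the given point. Where q ≠ 0 this is the definition of an equation, once ε is
so small that no vector of norm m with c ≠ 0 can be orthogonal to the line (`xi_mul_le`). At q = 0,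
`exists_factorization` divides ψ by these forms, none of which involves q; the quotient has no zero
off q = 0 and does not vanish identically on q = 0, so it is a unit by a minimum principle.
`exists_regularization` then gives a function smooth on all of U.

In the decaying part, τ grows like a multiple of −log|q|. Measured by a Poincaré type weight,
derivatives of log|q| lose only powers of |log|q||, which the exponential decay absorbs
(`LatticeBasis.controlled_dualSum`). Weighted bounds on the first two derivatives suffice for
log-log growth (`logLogGrowth_of_controlled`). -/

noncomputable section

namespace KudlaCusp
open Set Filter MeasureTheory

set_option linter.unusedSectionVars false

/-! ### Integrals over [0, 1] depending on parameters, and holomorphic functions near a hyperplane.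
-/

section ParametricIntegral

universe u
variable {𝕜 : Type*} [RCLike 𝕜] {E : Type u} [NormedAddCommGroup E]

/-- Tube lemma for the compact segment [0, 1]. It supplies the constant majorant for differentiation
under the integral sign. -/
theorem eventually_forall_norm_le_of_continuousOn {F : Type*} [NormedAddCommGroup F]
    {g : E × 𝕜 → F} {Ω : Set (E × 𝕜)} (hΩ : IsOpen Ω) (hg : ContinuousOn g Ω) {x₀ : E}
    (hx : ∀ t ∈ Icc (0 : ℝ) 1, (x₀, (t : 𝕜)) ∈ Ω) :
    ∃ C : ℝ, ∀ᶠ x in 𝓝 x₀, ∀ t ∈ Icc (0 : ℝ) 1, (x, (t : 𝕜)) ∈ Ω ∧ ‖g (x, (t : 𝕜))‖ ≤ C := by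
  have hcont : ContinuousOn (fun t : ℝ => g (x₀, (t : 𝕜))) (Icc (0 : ℝ) 1) :=
    hg.comp (by fun_prop) hx
  obtain ⟨C, hC⟩ := isCompact_Icc.exists_bound_of_continuousOn hcont
  refine ⟨C + 1, isCompact_Icc.eventually_forall_of_forall_eventually fun t ht => ?_⟩
  have hmem : Ω ∈ 𝓝 (x₀, (t : 𝕜)) := hΩ.mem_nhds (hx t ht)
  have h1 : ∀ᶠ z in 𝓝 (x₀, (t : 𝕜)), z ∈ Ω ∧ ‖g z‖ ≤ C + 1 := by
    have h2 := (hg.continuousAt hmem).norm.eventually_lt (continuousAt_const (y := C + 1))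
      (by linarith [hC t ht])
    filter_upwards [hmem, h2] with z hz hz' using ⟨hz, hz'.le⟩
  have h3 : Tendsto (fun z : E × ℝ => (z.1, (z.2 : 𝕜))) (𝓝 (x₀, t)) (𝓝 (x₀, (t : 𝕜))) :=
    (by fun_prop : Continuous fun z : E × ℝ => (z.1, (z.2 : 𝕜))).tendsto _
  exact h3.eventually h1

theorem intervalIntegrable_param {F : Type*} [NormedAddCommGroup F] {g : E × 𝕜 → F} {Ω : Set (E × 𝕜)}
    (hg : ContinuousOn g Ω) {x₀ : E} (hx : ∀ t ∈ Icc (0 : ℝ) 1, (x₀, (t : 𝕜)) ∈ Ω) :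
    IntervalIntegrable (fun t : ℝ => g (x₀, (t : 𝕜))) volume 0 1 := by
  refine ContinuousOn.intervalIntegrable ?_
  rw [uIcc_of_le zero_le_one]
  exact hg.comp (by fun_prop) hx

variable [NormedSpace 𝕜 E] {F : Type u} [NormedAddCommGroup F] [NormedSpace 𝕜 F]
  [NormedSpace ℝ F]

theorem hasFDerivAt_integral_param [CompleteSpace F] {g : E × 𝕜 → F} {Ω : Set (E × 𝕜)}
    (hΩ : IsOpen Ω) (hg : ContDiffOn 𝕜 1 g Ω) {x₀ : E}
    (hx : ∀ t ∈ Icc (0 : ℝ) 1, (x₀, (t : 𝕜)) ∈ Ω) :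
    HasFDerivAt (fun x => ∫ t in (0 : ℝ)..1, g (x, (t : 𝕜)))
      (∫ t in (0 : ℝ)..1, (fderiv 𝕜 g (x₀, (t : 𝕜))).comp (ContinuousLinearMap.inl 𝕜 E 𝕜)) x₀ := by
  have hg' : ContinuousOn (fun z => (fderiv 𝕜 g z).comp (ContinuousLinearMap.inl 𝕜 E 𝕜)) Ω :=
    (hg.continuousOn_fderiv_of_isOpen hΩ le_rfl).clm_comp continuousOn_const
  obtain ⟨C, hC⟩ := eventually_forall_norm_le_of_continuousOn hΩ hg' hx
  refine intervalIntegral.hasFDerivAt_integral_of_dominated_of_fderiv_le (μ := volume)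
    (F := fun x t => g (x, (t : 𝕜)))
    (F' := fun x t => (fderiv 𝕜 g (x, (t : 𝕜))).comp (ContinuousLinearMap.inl 𝕜 E 𝕜))
    (bound := fun _ => C) hC ?_ ?_ ?_ ?_ ?_ ?_
  · filter_upwards [hC] with x hx'
    exact (intervalIntegrable_param hg.continuousOn fun t ht => (hx' t ht).1).def'.1
  · exact intervalIntegrable_param hg.continuousOn hx
  · exact (intervalIntegrable_param (F := E →L[𝕜] F) hg' hx).def'.1
  · refine Eventually.of_forall fun t ht x hx' => ?_
    rw [uIoc_of_le zero_le_one] at ht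
    exact (hx' t ⟨ht.1.le, ht.2⟩).2
  · exact intervalIntegrable_const
  · refine Eventually.of_forall fun t ht x hx' => ?_
    rw [uIoc_of_le zero_le_one] at ht
    have hz := (hx' t ⟨ht.1.le, ht.2⟩).1
    have h1 : HasFDerivAt g (fderiv 𝕜 g (x, (t : 𝕜))) (x, (t : 𝕜)) :=
      ((hg.differentiableOn one_ne_zero).differentiableAt (hΩ.mem_nhds hz)).hasFDerivAt
    have h2 : HasFDerivAt (fun y : E => (y, (t : 𝕜))) (ContinuousLinearMap.inl 𝕜 E 𝕜) x :=
      hasFDerivAt_prodMk_left x _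
    exact h1.comp x h2

/-- The derivative of a parameter integral is a parameter integral with values in a space of linear
maps. The induction therefore runs over all target spaces F at once, which is why F is quantified
after `n`. -/
theorem contDiffOn_integral_param (n : ℕ) {O : Set E} (hO : IsOpen O) {Ω : Set (E × 𝕜)}
    (hΩ : IsOpen Ω) (hx : ∀ x ∈ O, ∀ t ∈ Icc (0 : ℝ) 1, (x, (t : 𝕜)) ∈ Ω) :
    ∀ {F : Type u} [NormedAddCommGroup F] [NormedSpace 𝕜 F] [NormedSpace ℝ F]
      [CompleteSpace F] {g : E × 𝕜 → F} (_ : ContDiffOn 𝕜 ∞ g Ω),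
      ContDiffOn 𝕜 n (fun x => ∫ t in (0 : ℝ)..1, g (x, (t : 𝕜))) O := by
  induction n with
  | zero =>
    intro F _ _ _ _ g hg
    refine contDiffOn_zero.2 fun x hxO => ?_
    exact (hasFDerivAt_integral_param hΩ (hg.of_le (by exact_mod_cast le_top))
      (hx x hxO)).continuousAt.continuousWithinAt
  | succ n ih =>
    intro F _ _ _ _ g hg
    have hD := fun x hxO => hasFDerivAt_integral_param hΩ (hg.of_le (by exact_mod_cast le_top))
      (hx x hxO)
    have : ((n + 1 : ℕ) : WithTop ℕ∞) = n + 1 := by norm_cast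
    rw [this, contDiffOn_succ_iff_fderiv_of_isOpen hO]
    refine ⟨fun x hxO => (hD x hxO).differentiableAt.differentiableWithinAt, by simp, ?_⟩
    refine ContDiffOn.congr (ih (F := E →L[𝕜] F)
      (g := fun z => (fderiv 𝕜 g z).comp (ContinuousLinearMap.inl 𝕜 E 𝕜)) ?_)
      fun x hxO => (hD x hxO).fderiv
    exact (hg.fderiv_of_isOpen hΩ (by norm_num)).clm_comp contDiffOn_const

theorem contDiffOn_infty_integral_param [CompleteSpace F] {O : Set E} (hO : IsOpen O)
    {Ω : Set (E × 𝕜)} (hΩ : IsOpen Ω) (hx : ∀ x ∈ O, ∀ t ∈ Icc (0 : ℝ) 1, (x, (t : 𝕜)) ∈ Ω)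
    {g : E × 𝕜 → F} (hg : ContDiffOn 𝕜 ∞ g Ω) :
    ContDiffOn 𝕜 ∞ (fun x => ∫ t in (0 : ℝ)..1, g (x, (t : 𝕜))) O :=
  contDiffOn_infty.2 fun n => contDiffOn_integral_param n hO hΩ hx hg

end ParametricIntegral

/-- Division of a holomorphic function by an affine function whose zeros it contains. -/
theorem exists_eq_linear_mul {E : Type} [NormedAddCommGroup E] [NormedSpace ℂ E]
    {h : E → ℂ} {p₀ : E} (hh : ∀ᶠ x in 𝓝 p₀, ContDiffAt ℂ ∞ h x) {L : E →L[ℂ] ℂ} (hL : L ≠ 0)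
    (h0 : ∀ᶠ x in 𝓝 p₀, L (x - p₀) = 0 → h x = 0) :
    ∃ h' : E → ℂ, (∀ᶠ x in 𝓝 p₀, ContDiffAt ℂ ∞ h' x) ∧
      ∀ᶠ x in 𝓝 p₀, h x = L (x - p₀) * h' x := by
  obtain ⟨v, hv⟩ : ∃ v, L v = 1 := by
    obtain ⟨w, hw⟩ : ∃ w, L w ≠ 0 := by
      by_contra! H
      exact hL (ContinuousLinearMap.ext H)
    exact ⟨(L w)⁻¹ • w, by simp [hw]⟩
  obtain ⟨ρ, hρ, hball⟩ := Metric.eventually_nhds_iff_ball.1 (hh.and h0)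
  let K : ℝ := 1 + ‖L‖ * ‖v‖
  have hK : 0 < K := by positivity
  -- Since L v = 1, L(γ(x, t) − p₀) = t L(x − p₀): the path runs from the projection of x to the
  -- hyperplane along v, where h vanishes, to x itself. Integrating the derivative of h along it
  -- exhibits the factor L(x − p₀). The constant K keeps the path inside the ball of radius ρ.
  let γ : E × ℂ → E := fun z => z.1 + ((z.2 - 1) * L (z.1 - p₀)) • v
  have hγc : ContDiff ℂ ∞ γ := by fun_prop
  have hγ : ∀ x ∈ Metric.ball p₀ (ρ / K), ∀ t ∈ Icc (0 : ℝ) 1, γ (x, (t : ℂ)) ∈ Metric.ball p₀ ρ := by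
    intro x hx t ht
    rw [mem_ball_iff_norm] at hx ⊢
    have e1 : ‖((t : ℂ) - 1)‖ ≤ 1 := by
      rw [← Complex.ofReal_one, ← Complex.ofReal_sub, Complex.norm_real, Real.norm_eq_abs, abs_le]
      constructor <;> linarith [ht.1, ht.2]
    have e2 : ‖((t : ℂ) - 1) * L (x - p₀)‖ ≤ ‖L‖ * ‖x - p₀‖ := by
      rw [norm_mul]
      calc _ ≤ 1 * ‖L (x - p₀)‖ := by gcongr
        _ ≤ _ := by rw [one_mul]; exact L.le_opNorm _
    calc ‖γ (x, (t : ℂ)) - p₀‖ = ‖(x - p₀) + (((t : ℂ) - 1) * L (x - p₀)) • v‖ := by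
          simp only [γ]; congr 1; abel
      _ ≤ ‖x - p₀‖ + ‖L‖ * ‖x - p₀‖ * ‖v‖ := by
          refine (norm_add_le _ _).trans ?_
          rw [norm_smul]
          gcongr
      _ = ‖x - p₀‖ * K := by simp only [K]; ring
      _ < ρ := by rwa [lt_div_iff₀ hK] at hx
  have hρK : ρ / K ≤ ρ := div_le_self hρ.le (by simp only [K]; nlinarith [norm_nonneg L, norm_nonneg v])
  have hD : ContDiffOn ℂ ∞ h (Metric.ball p₀ ρ) := fun x hx => (hball x hx).1.contDiffWithinAt
  let g : E × ℂ → ℂ := fun z => fderiv ℂ h (γ z) v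
  have hg : ContDiffOn ℂ ∞ g (γ ⁻¹' Metric.ball p₀ ρ) := by
    have := (hD.fderiv_of_isOpen (m := ∞) Metric.isOpen_ball (by norm_num)).comp hγc.contDiffOn
      (mapsTo_preimage γ _)
    exact this.clm_apply contDiffOn_const
  refine ⟨fun x => ∫ t in (0 : ℝ)..1, g (x, (t : ℂ)), ?_, ?_⟩
  · have := contDiffOn_infty_integral_param (𝕜 := ℂ) (F := ℂ) (Metric.isOpen_ball (x := p₀) (ε := ρ / K))
      (Metric.isOpen_ball.preimage hγc.continuous) hγ hg
    filter_upwards [Metric.ball_mem_nhds p₀ (div_pos hρ hK)] with x hx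
    exact this.contDiffAt (Metric.isOpen_ball.mem_nhds hx)
  · filter_upwards [Metric.ball_mem_nhds p₀ (div_pos hρ hK)] with x hx
    have hder : ∀ t ∈ uIcc (0 : ℝ) 1, HasDerivAt (fun t : ℝ => h (γ (x, (t : ℂ))))
        (L (x - p₀) * g (x, (t : ℂ))) t := by
      intro t ht
      rw [uIcc_of_le zero_le_one] at ht
      have h1 : HasFDerivAt h (fderiv ℂ h (γ (x, (t : ℂ)))) (γ (x, (t : ℂ))) :=
        ((hball _ (hγ x hx t ht)).1.differentiableAt (by simp)).hasFDerivAt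
      have h2 : HasDerivAt (fun t : ℝ => γ (x, (t : ℂ))) (L (x - p₀) • v) t := by
        have h3 : HasDerivAt (fun t : ℝ => ((t : ℂ) - 1) * L (x - p₀)) (1 * L (x - p₀)) t :=
          ((Complex.ofRealCLM.hasDerivAt (x := t)).sub_const 1).mul_const _
        have := (h3.smul_const v).const_add x
        rw [one_mul] at this
        exact this
      have := (h1.restrictScalars ℝ).comp_hasDerivAt t h2
      rw [ContinuousLinearMap.coe_restrictScalars', map_smul, smul_eq_mul] at this
      exact this
    have hint : IntervalIntegrable (fun t : ℝ => L (x - p₀) * g (x, (t : ℂ))) volume 0 1 :=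
      (intervalIntegrable_param hg.continuousOn (hγ x hx)).const_mul _
    have := intervalIntegral.integral_eq_sub_of_hasDerivAt hder hint
    rw [intervalIntegral.integral_const_mul] at this
    rw [this]
    have h4 : h (γ (x, ((0 : ℝ) : ℂ))) = 0 := by
      refine (hball _ (hγ x hx 0 (by simp))).2 ?_
      simp [γ, hv]
    rw [h4]
    simp [γ]

/-- A holomorphic function near a point of `{x 0 = 0}` which vanishes at most on `{x 0 = 0}`, but
not identically there, is nonzero at that point. -/
theorem ne_zero_of_frequently_ne_zero {N : ℕ} {φ : (Fin (N + 1) → ℂ) → ℂ} {p : Fin (N + 1) → ℂ}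
    (hp : p 0 = 0) (hφ : ∀ᶠ x in 𝓝 p, ContDiffAt ℂ ∞ φ x)
    (hne : ∀ᶠ x in 𝓝 p, x 0 ≠ 0 → φ x ≠ 0) (hfr : ∃ᶠ x in 𝓝[{x | x 0 = 0}] p, φ x ≠ 0) :
    φ p ≠ 0 := by
  obtain ⟨ρ', hρ', hball⟩ := Metric.eventually_nhds_iff_ball.1 (hφ.and hne)
  obtain ⟨ρ, hρ, hρρ'⟩ := exists_between hρ'
  have hcb : ∀ x ∈ Metric.closedBall p ρ, x ∈ Metric.ball p ρ' := fun x hx =>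
    Metric.closedBall_subset_ball hρρ' hx
  have hK : IsCompact (Metric.closedBall p ρ ∩ {x | ‖x 0‖ = ρ}) :=
    (isCompact_closedBall p ρ).inter_right (isClosed_eq (by fun_prop) continuous_const)
  -- On |x 0| = ρ the coordinate `x 0` is nonzero, hence so is φ, and compactness gives a positive
  -- minimum.
  obtain ⟨c, hc, hcK⟩ : ∃ c : ℝ, 0 < c ∧
      ∀ x ∈ Metric.closedBall p ρ ∩ {x | ‖x 0‖ = ρ}, c ≤ ‖φ x‖ := by
    have hcont : ContinuousOn (fun x => ‖φ x‖) (Metric.closedBall p ρ ∩ {x | ‖x 0‖ = ρ}) :=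
      fun x hx => (hball x (hcb x hx.1)).1.continuousAt.norm.continuousWithinAt
    refine hK.exists_forall_le' hcont (a := 0) fun x hx => norm_pos_iff.2 ?_
    refine (hball x (hcb x hx.1)).2 fun h => ?_
    have h2 : ‖x 0‖ = ρ := hx.2
    rw [h, norm_zero] at h2
    exact hρ.ne h2
  -- Minimum principle on the disc through x in direction 0: there φ has no zeros, so 1/φ is bounded
  -- by its values on the circle. A zero of φ at p would then contradict continuity, as points of
  -- the hyperplane with φ ≠ 0 accumulate at p. In the sup norm the ball is a polydisc, so the disc
  -- stays inside.
  have key : ∀ x ∈ Metric.closedBall p ρ, x 0 = 0 → φ x ≠ 0 → c ≤ ‖φ x‖ := by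
    intro x hx hx0 hφx
    let γ : ℂ → (Fin (N + 1) → ℂ) := fun q => Function.update x 0 q
    have hγ0 : γ 0 = x := by simp [γ, ← hx0]
    have hγb : ∀ q ∈ Metric.closedBall (0 : ℂ) ρ, γ q ∈ Metric.closedBall p ρ := by
      intro q hq
      rw [mem_closedBall_iff_norm, pi_norm_le_iff_of_nonneg hρ.le] at hx ⊢
      intro i
      rcases eq_or_ne i 0 with rfl | hi
      · simpa [γ, hp] using hq
      · simpa [γ, hi] using hx i
    have hγd : Differentiable ℂ γ := by
      rw [differentiable_pi]
      intro i
      rcases eq_or_ne i 0 with rfl | hi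
      · simp [γ]
      · simp [γ, hi]
    have hne' : ∀ q ∈ Metric.closedBall (0 : ℂ) ρ, φ (γ q) ≠ 0 := by
      intro q hq
      rcases eq_or_ne q 0 with rfl | hq0
      · rwa [hγ0]
      · exact (hball _ (hcb _ (hγb q hq))).2 (by simpa [γ] using hq0)
    have hdiff : DifferentiableOn ℂ (fun q => (φ (γ q))⁻¹) (Metric.closedBall 0 ρ) := by
      intro q hq
      have h1 : DifferentiableAt ℂ φ (γ q) :=
        (hball _ (hcb _ (hγb q hq))).1.differentiableAt (by simp)
      exact ((h1.comp q (hγd q)).inv (hne' q hq)).differentiableWithinAt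
    have hd2 : DiffContOnCl ℂ (fun q => (φ (γ q))⁻¹) (Metric.ball 0 ρ) := by
      refine DifferentiableOn.diffContOnCl ?_
      rwa [closure_ball _ hρ.ne']
    have := Complex.norm_le_of_forall_mem_frontier_norm_le Metric.isBounded_ball hd2 (C := c⁻¹) ?_
      (z := 0) (by rw [closure_ball _ hρ.ne']; simp [hρ.le])
    · rw [hγ0, norm_inv] at this
      exact (inv_le_inv₀ (norm_pos_iff.2 hφx) hc).1 this
    · intro q hq
      rw [frontier_ball _ hρ.ne'] at hq
      rw [norm_inv]
      refine inv_anti₀ hc (hcK _ ⟨hγb q (Metric.sphere_subset_closedBall hq), ?_⟩)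
      simpa [γ] using hq
  intro h0
  have hsmall : ∀ᶠ x in 𝓝 p, ‖φ x‖ < c := by
    have := (hball p (hcb p (Metric.mem_closedBall_self hρ.le))).1.continuousAt.norm
    refine this.eventually_lt continuousAt_const ?_
    simpa [h0] using hc
  refine hfr ?_
  filter_upwards [mem_nhdsWithin_of_mem_nhds hsmall,
    mem_nhdsWithin_of_mem_nhds (Metric.closedBall_mem_nhds p hρ), self_mem_nhdsWithin]
    with x h1 h2 h3
  intro h4
  exact absurd (key x h2 h3 h4) (not_le.2 h1)

/-! ### Smoothness of exponentially convergent series of functions of affine forms. -/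

section Series

/-- The setting for series `∑ φ (M j x + c j)`, with a size function `q` on the index set. -/
structure SeriesDatum (J : Type*) (E : Type*) [NormedAddCommGroup E] [NormedSpace ℝ E]
    (𝕂 : Type*) [RCLike 𝕂] where
  q : J → ℝ
  one_le_q : ∀ j, 1 ≤ q j
  summable_exp : ∀ c : ℝ, 0 < c → Summable fun j => Real.exp (-c * q j)
  M : J → E →L[ℝ] 𝕂
  c : J → 𝕂
  norm_M_le : ∃ K, ∀ j, ‖M j‖ ≤ K * q j
  O : Set E
  isOpen_O : IsOpen O
  convex_O : Convex ℝ O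
  φ : ℕ → 𝕂 → 𝕂
  hasDerivAt_φ : ∀ n j, ∀ x ∈ O, HasDerivAt (φ n) (φ (n + 1) (M j x + c j)) (M j x + c j)
  norm_φ_le : ∀ n, ∃ K, ∃ b : ℝ, 0 < b ∧ ∀ j, ∀ x ∈ O, ‖φ n (M j x + c j)‖ ≤ K * Real.exp (-b * q j)

namespace SeriesDatum

universe u
variable {J : Type*} {E : Type u} [NormedAddCommGroup E] [NormedSpace ℝ E] {𝕂 : Type*} [RCLike 𝕂]
  (S : SeriesDatum J E 𝕂)

/-- Half of the exponential absorbs the power, by one term of the exponential series; the other half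
is summable. -/
theorem summable_pow_mul_exp (k : ℕ) {b : ℝ} (hb : 0 < b) :
    Summable fun j => S.q j ^ k * Real.exp (-b * S.q j) := by
  have hb2 : 0 < b / 2 := by positivity
  refine Summable.of_nonneg_of_le (f := fun j => ((k.factorial : ℝ) / (b / 2) ^ k) * Real.exp (-(b / 2) * S.q j))
    (fun j => mul_nonneg (pow_nonneg (by linarith [S.one_le_q j]) _) (Real.exp_pos _).le)
    (fun j => ?_) ((S.summable_exp (b / 2) hb2).mul_left _)
  have h1 : (b / 2 * S.q j) ^ k / k.factorial ≤ Real.exp (b / 2 * S.q j) :=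
    Real.pow_div_factorial_le_exp _ (by have := S.one_le_q j; positivity) k
  have h2 : S.q j ^ k ≤ (k.factorial : ℝ) / (b / 2) ^ k * Real.exp (b / 2 * S.q j) := by
    rw [div_le_iff₀ (by positivity), mul_pow] at h1
    rw [div_mul_eq_mul_div, le_div_iff₀ (by positivity)]
    linarith
  calc _ ≤ ((k.factorial : ℝ) / (b / 2) ^ k * Real.exp (b / 2 * S.q j)) * Real.exp (-b * S.q j) := by
        gcongr
    _ = _ := by rw [mul_assoc, ← Real.exp_add]; ring_nf

variable {F : Type u} [NormedAddCommGroup F] [NormedSpace ℝ F] [NormedSpace 𝕂 F]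
  [IsScalarTower ℝ 𝕂 F]

/-- The sum of the series with coefficients `C`. -/
def sum (n : ℕ) (C : J → F) (x : E) : F := ∑' j, S.φ n (S.M j x + S.c j) • C j

/-- Coefficients of polynomial growth. -/
def Tempered (C : J → F) : Prop := ∃ K, ∃ k : ℕ, ∀ j, ‖C j‖ ≤ K * S.q j ^ k

/-- The coefficients of the derived series. -/
def derivCoeff (C : J → F) (j : J) : E →L[ℝ] F := (S.M j).smulRight (C j)

variable {S}

/-- Differentiation multiplies coefficients by `M j`, which costs one power of `q j`. Polynomial
growth is thus stable, and all derivatives of the series are series of the same kind. -/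
theorem Tempered.derivCoeff {C : J → F} (hC : S.Tempered C) : S.Tempered (S.derivCoeff C) := by
  obtain ⟨K, k, hK⟩ := hC
  obtain ⟨K', hK'⟩ := S.norm_M_le
  refine ⟨K' * K, k + 1, fun j => ?_⟩
  have h1 : ‖S.derivCoeff C j‖ ≤ ‖S.M j‖ * ‖C j‖ := by
    refine ContinuousLinearMap.opNorm_le_bound _ (by positivity) fun x => ?_
    rw [SeriesDatum.derivCoeff, ContinuousLinearMap.smulRight_apply, norm_smul]
    calc _ ≤ (‖S.M j‖ * ‖x‖) * ‖C j‖ := by gcongr; exact (S.M j).le_opNorm x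
      _ = _ := by ring
  calc _ ≤ ‖S.M j‖ * ‖C j‖ := h1
    _ ≤ (K' * S.q j) * (K * S.q j ^ k) :=
        mul_le_mul (hK' j) (hK j) (norm_nonneg _) ((norm_nonneg _).trans (hK' j))
    _ = _ := by ring

theorem Tempered.exists_bound {C : J → F} (hC : S.Tempered C) (n : ℕ) :
    ∃ u : J → ℝ, Summable u ∧ ∀ j, ∀ x ∈ S.O, ‖S.φ n (S.M j x + S.c j) • C j‖ ≤ u j := by
  obtain ⟨K, k, hK⟩ := hC
  obtain ⟨K', b, hb, hK'⟩ := S.norm_φ_le n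
  refine ⟨_, (S.summable_pow_mul_exp k hb).mul_left (K' * K), fun j x hx => ?_⟩
  rw [norm_smul]
  calc _ ≤ (K' * Real.exp (-b * S.q j)) * (K * S.q j ^ k) :=
        mul_le_mul (hK' j x hx) (hK j) (norm_nonneg _) ((norm_nonneg _).trans (hK' j x hx))
    _ = _ := by ring

theorem Tempered.summable [CompleteSpace F] {C : J → F} (hC : S.Tempered C) (n : ℕ) {x : E}
    (hx : x ∈ S.O) : Summable fun j => S.φ n (S.M j x + S.c j) • C j := by
  obtain ⟨u, hu, hle⟩ := hC.exists_bound n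
  exact Summable.of_norm_bounded hu fun j => hle j x hx

theorem Tempered.hasFDerivAt_sum [CompleteSpace F] {C : J → F} (hC : S.Tempered C) (n : ℕ) {x : E}
    (hx : x ∈ S.O) : HasFDerivAt (S.sum n C) (S.sum (n + 1) (S.derivCoeff C) x) x := by
  obtain ⟨u, hu, hle⟩ := hC.derivCoeff.exists_bound (n + 1)
  refine hasFDerivAt_tsum_of_isPreconnected hu S.isOpen_O S.convex_O.isPreconnected
    (fun j y hy => ?_) hle hx (hC.summable n hx) hx
  have h1 : HasFDerivAt (S.φ n) _ (S.M j y + S.c j) := (S.hasDerivAt_φ n j y hy).hasFDerivAt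
  have h2 : HasFDerivAt (fun y => S.M j y + S.c j) (S.M j) y := (S.M j).hasFDerivAt.add_const _
  have h3 := ((h1.restrictScalars ℝ).comp y h2).smul_const (C j)
  have h4 : S.φ (n + 1) (S.M j y + S.c j) • S.derivCoeff C j = ((ContinuousLinearMap.restrictScalars ℝ
      (ContinuousLinearMap.toSpanSingleton 𝕂 (S.φ (n + 1) ((S.M j) y + S.c j)))).comp
        (S.M j)).smulRight (C j) := by
    refine ContinuousLinearMap.ext fun z => ?_
    simp [SeriesDatum.derivCoeff, smul_smul, mul_comm]
  rw [h4]
  exact h3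

theorem Tempered.contDiffOn_sum_nat (k : ℕ) :
    ∀ {F : Type u} [NormedAddCommGroup F] [NormedSpace ℝ F] [NormedSpace 𝕂 F]
      [IsScalarTower ℝ 𝕂 F] [CompleteSpace F] {C : J → F} (_ : S.Tempered C) (n : ℕ),
      ContDiffOn ℝ k (S.sum n C) S.O := by
  induction k with
  | zero =>
    intro F _ _ _ _ _ C hC n
    exact contDiffOn_zero.2 fun x hx => (hC.hasFDerivAt_sum n hx).continuousAt.continuousWithinAt
  | succ k ih =>
    intro F _ _ _ _ _ C hC n
    have : ((k + 1 : ℕ) : WithTop ℕ∞) = k + 1 := by norm_cast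
    rw [this, contDiffOn_succ_iff_fderiv_of_isOpen S.isOpen_O]
    exact ⟨fun x hx => (hC.hasFDerivAt_sum n hx).differentiableAt.differentiableWithinAt, by simp,
      (ih hC.derivCoeff (n + 1)).congr fun x hx => (hC.hasFDerivAt_sum n hx).fderiv⟩

theorem Tempered.contDiffOn_sum [CompleteSpace F] {C : J → F} (hC : S.Tempered C) (n : ℕ) :
    ContDiffOn ℝ ∞ (S.sum n C) S.O :=
  contDiffOn_infty.2 fun k => hC.contDiffOn_sum_nat k n

end SeriesDatum

end Series

end KudlaCusp

/-! ### The function β₁: derivatives, decay and logarithmic singularity. -/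

namespace KudlaCusp
open Set Filter MeasureTheory

theorem integrableOn_pow_mul_exp (n : ℕ) {x : ℝ} (hx : 0 < x) :
    IntegrableOn (fun t : ℝ => t ^ n * Real.exp (-x * t)) (Ioi 0) := by
  have := integrableOn_rpow_mul_exp_neg_mul_rpow (p := 1) (s := n) (b := x)
    (by have : (0 : ℝ) ≤ n := n.cast_nonneg; linarith) one_pos hx
  refine this.congr_fun (fun t _ => ?_) measurableSet_Ioi
  simp

/-- The derivatives of `beta1` on the positive half line. -/
def betaDeriv (n : ℕ) (x : ℝ) : ℝ := ∫ t in Ioi (1 : ℝ), (-t) ^ n * (Real.exp (-x * t) / t)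

theorem betaDeriv_zero : betaDeriv 0 = beta1 := by
  ext x
  simp [betaDeriv, beta1]

theorem norm_betaDeriv_integrand_le (n : ℕ) (x : ℝ) {t : ℝ} (ht : t ∈ Ioi (1 : ℝ)) :
    ‖(-t) ^ n * (Real.exp (-x * t) / t)‖ ≤ t ^ n * Real.exp (-x * t) := by
  have ht : 1 < t := ht
  have ht0 : 0 < t := by linarith
  rw [norm_mul, norm_pow, norm_neg, norm_div, Real.norm_of_nonneg ht0.le,
    Real.norm_of_nonneg (Real.exp_pos _).le]
  gcongr
  exact div_le_self (Real.exp_pos _).le ht.le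

theorem measurable_betaDeriv_integrand (n : ℕ) (x : ℝ) :
    Measurable fun t : ℝ => (-t) ^ n * (Real.exp (-x * t) / t) := by
  fun_prop

theorem integrableOn_betaDeriv (n : ℕ) {x : ℝ} (hx : 0 < x) :
    IntegrableOn (fun t : ℝ => (-t) ^ n * (Real.exp (-x * t) / t)) (Ioi 1) := by
  refine Integrable.mono' ((integrableOn_pow_mul_exp n hx).mono_set (Ioi_subset_Ioi zero_le_one))
    (measurable_betaDeriv_integrand n x).aestronglyMeasurable ?_
  exact (ae_restrict_iff' measurableSet_Ioi).2 (Eventually.of_forall fun t ht =>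
    norm_betaDeriv_integrand_le n x ht)

theorem hasDerivAt_betaDeriv (n : ℕ) {x : ℝ} (hx : 0 < x) :
    HasDerivAt (betaDeriv n) (betaDeriv (n + 1) x) x := by
  have hx2 : 0 < x / 2 := by positivity
  refine (hasDerivAt_integral_of_dominated_loc_of_deriv_le (μ := volume.restrict (Ioi 1))
    (F := fun y t => (-t) ^ n * (Real.exp (-y * t) / t))
    (F' := fun y t => (-t) ^ (n + 1) * (Real.exp (-y * t) / t))
    (bound := fun t => t ^ (n + 1) * Real.exp (-(x / 2) * t)) (Ioi_mem_nhds (half_lt_self hx))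
    ?_ (integrableOn_betaDeriv n hx) (measurable_betaDeriv_integrand _ x).aestronglyMeasurable ?_
    ((integrableOn_pow_mul_exp _ hx2).mono_set (Ioi_subset_Ioi zero_le_one)) ?_).2
  · exact Eventually.of_forall fun y => (measurable_betaDeriv_integrand _ y).aestronglyMeasurable
  · refine (ae_restrict_iff' measurableSet_Ioi).2 (Eventually.of_forall fun t ht y hy => ?_)
    refine (norm_betaDeriv_integrand_le _ y ht).trans ?_
    have ht : 1 < t := ht
    have hy : x / 2 < y := hy
    gcongr
  · refine (ae_restrict_iff' measurableSet_Ioi).2 (Eventually.of_forall fun t ht y hy => ?_)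
    have h1 : HasDerivAt (fun y => Real.exp (-y * t)) (Real.exp (-y * t) * (-1 * t)) y :=
      ((hasDerivAt_id y).neg.mul_const t).exp
    have h2 := (h1.div_const t).const_mul ((-t) ^ n)
    rwa [show (-t) ^ n * (Real.exp (-y * t) * (-1 * t) / t) =
      (-t) ^ (n + 1) * (Real.exp (-y * t) / t) by ring] at h2

/-- For t ≥ 1 and x ≥ η one has (x − η)(t − 1) ≥ 0, that is e^{-xt} ≤ e^{-ηt} e^{η} e^{-x}, and the
factor e^{-x} leaves the integral. -/
theorem exists_norm_betaDeriv_le (n : ℕ) {η : ℝ} (hη : 0 < η) :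
    ∃ K, ∀ x, η ≤ x → ‖betaDeriv n x‖ ≤ K * Real.exp (-x) := by
  refine ⟨∫ t in Ioi (1 : ℝ), t ^ n * Real.exp (-η * t) * Real.exp η, fun x hx => ?_⟩
  have hint : IntegrableOn (fun t : ℝ => t ^ n * Real.exp (-η * t) * Real.exp η) (Ioi 1) :=
    ((integrableOn_pow_mul_exp n hη).mono_set (Ioi_subset_Ioi zero_le_one)).mul_const _
  rw [← integral_mul_const]
  refine norm_integral_le_of_norm_le (hint.mul_const _)
    ((ae_restrict_iff' measurableSet_Ioi).2 (Eventually.of_forall fun t ht => ?_))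
  refine (norm_betaDeriv_integrand_le _ x ht).trans ?_
  have ht : 1 < t := ht
  rw [mul_assoc, mul_assoc, ← Real.exp_add, ← Real.exp_add]
  gcongr
  nlinarith

theorem beta1_nonneg (x : ℝ) : 0 ≤ beta1 x :=
  setIntegral_nonneg measurableSet_Ioi fun _ ht =>
    div_nonneg (Real.exp_pos _).le (zero_le_one.trans (le_of_lt ht))

theorem integrableOn_exp_div {x a : ℝ} (hx : 0 < x) (ha : 0 < a) :
    IntegrableOn (fun w : ℝ => Real.exp (-x * w) / w) (Ioi a) := by
  refine Integrable.mono' (((integrableOn_pow_mul_exp 0 hx).mono_set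
    (Ioi_subset_Ioi ha.le)).mul_const a⁻¹)
    (by fun_prop : Measurable fun w : ℝ => Real.exp (-x * w) / w).aestronglyMeasurable ?_
  refine (ae_restrict_iff' measurableSet_Ioi).2 (Eventually.of_forall fun t ht => ?_)
  have ht : a < t := ht
  rw [pow_zero, one_mul, norm_div, Real.norm_of_nonneg (Real.exp_pos _).le,
    Real.norm_of_nonneg (ha.trans ht).le, div_eq_mul_inv]
  gcongr

/-- The substitution w = t/τ moves the dependence on τ to the lower limit. The correction to the
value at τ = 1 then only involves w in a compact subset of (0, ∞), where sums over a lattice can be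
exchanged with the integral. -/
theorem beta1_div {x τ : ℝ} (hx : 0 < x) (hτ : 0 < τ) :
    beta1 (x / τ) = beta1 x + ∫ w in τ⁻¹..1, Real.exp (-x * w) / w := by
  have h1 : beta1 (x / τ) = ∫ w in Ioi τ⁻¹, Real.exp (-x * w) / w := by
    have := integral_comp_mul_left_Ioi (fun w => Real.exp (-x * w) / w) 1 (inv_pos.2 hτ)
    rw [mul_one, inv_inv, smul_eq_mul] at this
    have h2 : ∫ w in Ioi τ⁻¹, Real.exp (-x * w) / w =
        τ⁻¹ * ∫ t in Ioi (1 : ℝ), Real.exp (-x * (τ⁻¹ * t)) / (τ⁻¹ * t) := by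
      rw [this, inv_mul_cancel_left₀ hτ.ne']
    rw [h2, ← integral_const_mul, beta1]
    refine setIntegral_congr_fun measurableSet_Ioi fun t ht => ?_
    have ht : 1 < t := ht
    have : t ≠ 0 := by positivity
    rw [show -(x / τ) * t = -x * (τ⁻¹ * t) by ring]
    field_simp
  rw [h1, ← intervalIntegral.integral_Ioi_sub_Ioi' (integrableOn_exp_div hx (inv_pos.2 hτ))
    (integrableOn_exp_div hx one_pos)]
  simp [beta1]

/-- `(e^{-w} - 1) / w` -/
def expSlope (w : ℝ) : ℝ := ∫ t in (0 : ℝ)..1, -Real.exp (-w * t)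

theorem contDiff_expSlope : ContDiff ℝ ∞ expSlope := by
  have := contDiffOn_infty_integral_param (𝕜 := ℝ) (E := ℝ) (F := ℝ) isOpen_univ isOpen_univ
    (fun _ _ _ _ => mem_univ _) (g := fun z => -Real.exp (-z.1 * z.2))
    (ContDiff.contDiffOn (by fun_prop))
  rw [contDiffOn_univ] at this
  exact this

theorem expSlope_eq {w : ℝ} (hw : w ≠ 0) : expSlope w = (Real.exp (-w) - 1) / w := by
  have : ∀ t ∈ uIcc (0 : ℝ) 1, HasDerivAt (fun t => Real.exp (-w * t) / w) (-Real.exp (-w * t)) t := by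
    intro t _
    have h1 : HasDerivAt (fun t => Real.exp (-w * t)) (Real.exp (-w * t) * (-w * 1)) t :=
      ((hasDerivAt_id t).const_mul (-w)).exp
    have h2 := h1.div_const w
    rwa [show Real.exp (-w * t) * (-w * 1) / w = -Real.exp (-w * t) by field_simp] at h2
  rw [expSlope, intervalIntegral.integral_eq_sub_of_hasDerivAt this
    (Continuous.intervalIntegrable (by fun_prop) _ _)]
  simp
  ring

/-- The smooth extension of `beta1 x + log x`. -/
def betaReg (x : ℝ) : ℝ := beta1 1 - ∫ w in (1 : ℝ)..x, expSlope w

theorem contDiff_betaReg : ContDiff ℝ ∞ betaReg := by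
  have hd : ∀ x, HasDerivAt betaReg (-expSlope x) x := fun x => by
    have := (contDiff_expSlope.continuous.integral_hasStrictDerivAt 1 x).hasDerivAt
    exact this.const_sub _
  rw [contDiff_infty_iff_deriv]
  refine ⟨fun x => (hd x).differentiableAt, ?_⟩
  rw [show deriv betaReg = fun x => -expSlope x from funext fun x => (hd x).deriv]
  exact contDiff_expSlope.neg

/-- By `beta1_div`, β₁(x) − β₁(1) is minus the integral of e^{-w}/w from 1 to x. Splitting off 1/w,
whose integral is log x, leaves the entire function (e^{-w} − 1)/w. -/
theorem beta1_add_log {x : ℝ} (hx : 0 < x) : beta1 x + Real.log x = betaReg x := by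
  have h1 := beta1_div one_pos (inv_pos.2 hx)
  rw [one_div, inv_inv] at h1
  have hpos : ∀ w ∈ uIcc 1 x, 0 < w := fun w hw => lt_of_lt_of_le (lt_min one_pos hx) hw.1
  have h2 : ∫ w in (1 : ℝ)..x, expSlope w =
      (∫ w in (1 : ℝ)..x, Real.exp (-1 * w) / w) - ∫ w in (1 : ℝ)..x, w⁻¹ := by
    rw [← intervalIntegral.integral_sub]
    · refine intervalIntegral.integral_congr fun w hw => ?_
      rw [expSlope_eq (hpos w hw).ne', neg_one_mul]
      ring
    · refine ContinuousOn.intervalIntegrable (ContinuousOn.div (by fun_prop) (by fun_prop) ?_)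
      exact fun w hw => (hpos w hw).ne'
    · exact ContinuousOn.intervalIntegrable (ContinuousOn.inv₀ (by fun_prop)
        fun w hw => (hpos w hw).ne')
  rw [betaReg, h2, h1, intervalIntegral.integral_symm 1 x, integral_inv_of_pos one_pos hx, div_one]
  ring

end KudlaCusp

/-! ### Theta series of lattices in ℂ and their functional equation. -/

namespace KudlaCusp
open Set Filter MeasureTheory

theorem summable_exp_neg_mul_int_sq {c : ℝ} (hc : 0 < c) :
    Summable fun n : ℤ => Real.exp (-c * (n : ℝ) ^ 2) := by
  have h : Summable fun n : ℕ => Real.exp (-c * (n : ℝ) ^ 2) := by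
    refine Summable.of_nonneg_of_le (fun n => (Real.exp_pos _).le) (fun n => ?_)
      (Real.summable_exp_nat_mul_iff.2 (neg_lt_zero.2 hc))
    have : (n : ℝ) ≤ (n : ℝ) ^ 2 := by exact_mod_cast Nat.le_self_pow two_ne_zero n
    rw [Real.exp_le_exp]
    nlinarith
  refine Summable.of_nat_of_neg (by simpa using h) (by simpa using h)

theorem summable_exp_neg_mul_shift_sq {c D : ℝ} (hc : 0 < c) (hD : D ≠ 0) (t : ℝ) :
    Summable fun n : ℤ => Real.exp (-c * (t - n * D) ^ 2) := by
  have hD2 : 0 < D ^ 2 := by positivity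
  refine Summable.of_nonneg_of_le (fun n => (Real.exp_pos _).le) (fun n => ?_)
    ((summable_exp_neg_mul_int_sq (c := c * D ^ 2 / 2) (by positivity)).mul_left
      (Real.exp (c * t ^ 2)))
  rw [← Real.exp_add]
  gcongr
  nlinarith [mul_nonneg hc.le (sq_nonneg (2 * t - n * D))]

/-- An oriented or anti-oriented `ℝ`-basis of `ℂ`. -/
structure LatticeBasis where
  ω₁ : ℂ
  ω₂ : ℂ
  indep : ω₁.re * ω₂.im - ω₁.im * ω₂.re ≠ 0

namespace LatticeBasis

variable (B : LatticeBasis)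

/-- The determinant of the basis. -/
def det : ℝ := B.ω₁.re * B.ω₂.im - B.ω₁.im * B.ω₂.re

/-- The elements of the lattice. -/
def pt (j : ℤ × ℤ) : ℂ := j.1 * B.ω₁ + j.2 * B.ω₂

/-- The elements of the dual lattice: `pairing (dualPt j) ω₁ = j.1` and
`pairing (dualPt j) ω₂ = j.2`. -/
def dualPt (j : ℤ × ℤ) : ℂ :=
  ⟨(j.1 * B.ω₂.im - j.2 * B.ω₁.im) / B.det, (j.2 * B.ω₁.re - j.1 * B.ω₂.re) / B.det⟩

/-- The real pairing `Re (conj x · y)`. -/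
def pairing (x y : ℂ) : ℝ := x.re * y.re + x.im * y.im

/-- The size of an index. -/
def size (j : ℤ × ℤ) : ℝ := 1 + (j.1 : ℝ) ^ 2 + (j.2 : ℝ) ^ 2

theorem one_le_size (j : ℤ × ℤ) : 1 ≤ size j := by
  unfold size; nlinarith [sq_nonneg (j.1 : ℝ), sq_nonneg (j.2 : ℝ)]

theorem summable_exp_size {c : ℝ} (hc : 0 < c) :
    Summable fun j : ℤ × ℤ => Real.exp (-c * size j) := by
  have h := (summable_exp_neg_mul_int_sq hc).mul_of_nonneg (summable_exp_neg_mul_int_sq hc)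
    (fun _ => (Real.exp_pos _).le) (fun _ => (Real.exp_pos _).le)
  refine (h.mul_left (Real.exp (-c))).congr fun j => ?_
  rw [← Real.exp_add, ← Real.exp_add, size]
  ring_nf

theorem det_ne_zero : B.det ≠ 0 := B.indep

theorem norm_sq_eq (z : ℂ) : ‖z‖ ^ 2 = z.re ^ 2 + z.im ^ 2 := by
  rw [← Complex.normSq_eq_norm_sq, Complex.normSq_apply]; ring

theorem normSq_ω₁_pos : 0 < ‖B.ω₁‖ ^ 2 := by
  have : B.ω₁ ≠ 0 := fun h => B.indep (by simp [h])
  positivity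

/-- For z = xω₁ + yω₂, Cramer's rule gives x·det and y·det as cross products of z with ω₂ and ω₁. By
Lagrange's identity the difference of the two sides is the sum of the squared inner products, which
are the squares passed to `nlinarith`. -/
theorem norm_sq_add_le (x y : ℝ) : B.det ^ 2 * (x ^ 2 + y ^ 2) ≤
    (‖B.ω₁‖ ^ 2 + ‖B.ω₂‖ ^ 2) * ‖(x : ℂ) * B.ω₁ + y * B.ω₂‖ ^ 2 := by
  simp only [norm_sq_eq, det, Complex.add_re, Complex.add_im, Complex.re_ofReal_mul,
    Complex.im_ofReal_mul]
  nlinarith [sq_nonneg ((x * B.ω₁.re + y * B.ω₂.re) * B.ω₂.re + (x * B.ω₁.im + y * B.ω₂.im) * B.ω₂.im),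
    sq_nonneg ((x * B.ω₁.re + y * B.ω₂.re) * B.ω₁.re + (x * B.ω₁.im + y * B.ω₂.im) * B.ω₁.im)]

/-- The dual point is −i/det times j₁ω₂ − j₂ω₁, so estimates for the lattice carry over to the dual
lattice. -/
theorem norm_sq_dualPt (j : ℤ × ℤ) :
    ‖B.dualPt j‖ ^ 2 = ‖((-j.2 : ℝ) : ℂ) * B.ω₁ + ((j.1 : ℝ) : ℂ) * B.ω₂‖ ^ 2 / B.det ^ 2 := by
  simp only [norm_sq_eq, dualPt, Complex.add_re, Complex.add_im, Complex.re_ofReal_mul,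
    Complex.im_ofReal_mul]
  have := B.det_ne_zero
  field_simp
  ring

theorem exists_size_le_pt : ∃ c : ℝ, 0 < c ∧ ∀ j : ℤ × ℤ, c * (size j - 1) ≤ ‖B.pt j‖ ^ 2 := by
  have h1 := B.normSq_ω₁_pos
  have h2 : 0 < B.det ^ 2 := by have := B.det_ne_zero; positivity
  have h3 : 0 < ‖B.ω₁‖ ^ 2 + ‖B.ω₂‖ ^ 2 := by positivity
  refine ⟨B.det ^ 2 / (‖B.ω₁‖ ^ 2 + ‖B.ω₂‖ ^ 2), by positivity, fun j => ?_⟩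
  have := B.norm_sq_add_le j.1 j.2
  rw [div_mul_eq_mul_div, div_le_iff₀ h3, pt, mul_comm (_ ^ 2)]
  rw [mul_comm (_ + _)] at this
  simp only [Complex.ofReal_intCast] at this
  unfold size
  linarith

theorem exists_size_le_dualPt :
    ∃ c : ℝ, 0 < c ∧ ∀ j : ℤ × ℤ, c * (size j - 1) ≤ ‖B.dualPt j‖ ^ 2 := by
  have h1 := B.normSq_ω₁_pos
  have h2 : 0 < B.det ^ 2 := by have := B.det_ne_zero; positivity
  have h3 : 0 < ‖B.ω₁‖ ^ 2 + ‖B.ω₂‖ ^ 2 := by positivity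
  refine ⟨1 / (‖B.ω₁‖ ^ 2 + ‖B.ω₂‖ ^ 2), by positivity, fun j => ?_⟩
  have := B.norm_sq_add_le (-j.2) j.1
  rw [norm_sq_dualPt, div_mul_eq_mul_div, div_le_div_iff₀ h3 h2]
  unfold size
  linarith

theorem norm_sq_pt_le_sub (s : ℂ) (j : ℤ × ℤ) : ‖B.pt j‖ ^ 2 / 2 - ‖s‖ ^ 2 ≤ ‖s - B.pt j‖ ^ 2 := by
  simp only [norm_sq_eq, Complex.sub_re, Complex.sub_im]
  nlinarith [sq_nonneg (2 * s.re - (B.pt j).re), sq_nonneg (2 * s.im - (B.pt j).im)]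

theorem summable_theta (s : ℂ) {w : ℝ} (hw : 0 < w) :
    Summable fun j => Real.exp (-w * ‖s - B.pt j‖ ^ 2) := by
  obtain ⟨c, hc, hle⟩ := B.exists_size_le_pt
  refine Summable.of_nonneg_of_le (fun _ => (Real.exp_pos _).le) (fun j => ?_)
    ((summable_exp_size (c := w * c / 2) (by positivity)).mul_left
      (Real.exp (w * c / 2 + w * ‖s‖ ^ 2)))
  rw [← Real.exp_add]
  gcongr
  have h1 := mul_le_mul_of_nonneg_left (B.norm_sq_pt_le_sub s j) hw.le
  have h2 := mul_le_mul_of_nonneg_left (hle j) hw.le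
  nlinarith

/-- The general term of the dual theta series. -/
def dualTerm (w : ℝ) (s : ℂ) (j : ℤ × ℤ) : ℂ :=
  Complex.exp ((-(Real.pi ^ 2 / w) * ‖B.dualPt j‖ ^ 2 : ℝ) -
    2 * Real.pi * Complex.I * (pairing (B.dualPt j) s : ℝ))

theorem norm_dualTerm (w : ℝ) (s : ℂ) (j : ℤ × ℤ) :
    ‖B.dualTerm w s j‖ = Real.exp (-(Real.pi ^ 2 / w) * ‖B.dualPt j‖ ^ 2) := by
  rw [dualTerm, Complex.norm_exp]
  congr 1
  rw [Complex.sub_re, Complex.ofReal_re]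
  have : (2 * Real.pi * Complex.I * (pairing (B.dualPt j) s : ℝ) : ℂ) =
    ((2 * Real.pi * pairing (B.dualPt j) s : ℝ) : ℂ) * Complex.I := by push_cast; ring
  rw [this, Complex.re_ofReal_mul]
  simp

theorem summable_dualTerm (s : ℂ) {w : ℝ} (hw : 0 < w) : Summable (B.dualTerm w s) := by
  obtain ⟨c, hc, hle⟩ := B.exists_size_le_dualPt
  have hpi := Real.pi_pos
  refine Summable.of_norm_bounded ((summable_exp_size (c := Real.pi ^ 2 / w * c) (by positivity)).mul_left
      (Real.exp (Real.pi ^ 2 / w * c))) fun j => ?_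
  rw [norm_dualTerm, ← Real.exp_add]
  gcongr
  have h2 := mul_le_mul_of_nonneg_left (hle j) (by positivity : 0 ≤ Real.pi ^ 2 / w)
  nlinarith

/-- The partially transformed theta series. -/
def mixedTerm (w : ℝ) (s : ℂ) (k n : ℤ) : ℂ :=
  Complex.exp ((-(w / ‖B.ω₁‖ ^ 2) * (B.ω₁.re * s.im - B.ω₁.im * s.re - n * B.det) ^ 2
      - Real.pi ^ 2 / (w * ‖B.ω₁‖ ^ 2) * k ^ 2 : ℝ)
    - (2 * Real.pi * k * ((pairing B.ω₁ s - n * pairing B.ω₁ B.ω₂) / ‖B.ω₁‖ ^ 2) : ℝ) * Complex.I)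

theorem inv_cpow_half {a : ℝ} (ha : 0 < a) : 1 / (a : ℂ) ^ (1 / 2 : ℂ) = ((√a)⁻¹ : ℝ) := by
  rw [Real.sqrt_eq_rpow, one_div, Complex.ofReal_inv, Complex.ofReal_cpow ha.le]
  norm_num

/-- One-dimensional Poisson summation in the coefficient of ω₁. With t = s − nω₂, the exponent is
−w|t|² plus a quadratic polynomial in m with leading coefficient −w|ω₁|². -/
theorem tsum_theta_inner (s : ℂ) {w : ℝ} (hw : 0 < w) (n : ℤ) :
    ∑' m : ℤ, Complex.exp ((-w * ‖s - B.pt (m, n)‖ ^ 2 : ℝ)) =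
      ((√(w * ‖B.ω₁‖ ^ 2 / Real.pi))⁻¹ : ℝ) * ∑' k : ℤ, B.mixedTerm w s k n := by
  have hg := B.normSq_ω₁_pos
  have hpi := Real.pi_pos
  have ha : 0 < w * ‖B.ω₁‖ ^ 2 / Real.pi := by positivity
  set g := ‖B.ω₁‖ ^ 2 with hgdef
  have hg' : g = B.ω₁.re ^ 2 + B.ω₁.im ^ 2 := norm_sq_eq _
  set a := w * g / Real.pi with hadef
  let t : ℂ := s - n * B.ω₂
  let b : ℝ := w * pairing B.ω₁ t / Real.pi
  have key := Complex.tsum_exp_neg_quadratic (a := a) (by simpa using ha) b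
  rw [inv_cpow_half ha] at key
  have h1 : ∀ m : ℤ, Complex.exp ((-w * ‖s - B.pt (m, n)‖ ^ 2 : ℝ)) =
      Complex.exp ((-w * ‖t‖ ^ 2 : ℝ)) * Complex.exp (-Real.pi * a * m ^ 2 + 2 * Real.pi * b * m) := by
    intro m
    rw [← Complex.exp_add]
    congr 1
    have : -w * ‖s - B.pt (m, n)‖ ^ 2 = -w * ‖t‖ ^ 2 + (-Real.pi * a * m ^ 2 + 2 * Real.pi * b * m) := by
      simp only [hadef, b, hg', norm_sq_eq, pt, t, pairing, Complex.sub_re, Complex.sub_im, Complex.add_re,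
        Complex.add_im, ← Complex.ofReal_intCast, Complex.re_ofReal_mul, Complex.im_ofReal_mul]
      field_simp
      ring
    rw [this]
    push_cast
    ring
  have h2 : ∀ k : ℤ, B.mixedTerm w s k n =
      Complex.exp ((-w * ‖t‖ ^ 2 : ℝ)) * Complex.exp (-Real.pi / a * (k + Complex.I * b) ^ 2) := by
    intro k
    rw [mixedTerm, ← Complex.exp_add]
    congr 1
    have e1 : (-Real.pi / a * (k + Complex.I * b) ^ 2 : ℂ) =
        ((-Real.pi / a * (k ^ 2 - b ^ 2) : ℝ) : ℂ) + ((-Real.pi / a * (2 * k * b) : ℝ) : ℂ) * Complex.I := by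
      push_cast
      linear_combination (-Real.pi / a * b ^ 2 : ℂ) * Complex.I_sq
    rw [e1, ← add_assoc, ← Complex.ofReal_add, sub_eq_add_neg, ← neg_mul, ← Complex.ofReal_neg]
    congr 2
    · rw [← hgdef]
      simp only [hadef, b, norm_sq_eq, t, pairing, det, Complex.sub_re, Complex.sub_im,
        ← Complex.ofReal_intCast, Complex.re_ofReal_mul, Complex.im_ofReal_mul]
      field_simp
      rw [hg']
      ring
    · rw [← hgdef, Complex.ofReal_inj]
      simp only [hadef, b, t, pairing, Complex.sub_re, Complex.sub_im,
        ← Complex.ofReal_intCast, Complex.re_ofReal_mul, Complex.im_ofReal_mul]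
      field_simp
      ring
  simp_rw [h1, h2, tsum_mul_left]
  rw [key]
  ring

/-- Poisson summation in the coefficient of ω₂. The first transformation left a phase linear in n,
so the linear coefficient b + ib' is complex here, and b' shifts the dual variable. -/
theorem tsum_theta_outer (s : ℂ) {w : ℝ} (hw : 0 < w) (k : ℤ) :
    ∑' n : ℤ, B.mixedTerm w s k n =
      ((√(w * B.det ^ 2 / (Real.pi * ‖B.ω₁‖ ^ 2)))⁻¹ : ℝ) * ∑' l : ℤ, B.dualTerm w s (k, l) := by
  have hg := B.normSq_ω₁_pos
  have hD := B.det_ne_zero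
  have hpi := Real.pi_pos
  have ha : 0 < w * B.det ^ 2 / (Real.pi * ‖B.ω₁‖ ^ 2) := by positivity
  have hg' : ‖B.ω₁‖ ^ 2 = B.ω₁.re ^ 2 + B.ω₁.im ^ 2 := norm_sq_eq _
  set g := ‖B.ω₁‖ ^ 2 with hgdef
  set a := w * B.det ^ 2 / (Real.pi * g) with hadef
  let t : ℝ := B.ω₁.re * s.im - B.ω₁.im * s.re
  let b : ℝ := w * B.det * t / (Real.pi * g)
  let b' : ℝ := k * pairing B.ω₁ B.ω₂ / g
  have key := Complex.tsum_exp_neg_quadratic (a := a) (by simpa using ha) (b + b' * Complex.I)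
  rw [inv_cpow_half ha] at key
  let e : ℂ := ((-(w / g) * t ^ 2 - Real.pi ^ 2 / (w * g) * k ^ 2 : ℝ) : ℂ)
    + ((-(2 * Real.pi * k * (pairing B.ω₁ s / g)) : ℝ) : ℂ) * Complex.I
  have h1 : ∀ n : ℤ, B.mixedTerm w s k n =
      Complex.exp e * Complex.exp (-Real.pi * a * n ^ 2 + 2 * Real.pi * (b + b' * Complex.I) * n) := by
    intro n
    rw [mixedTerm, ← Complex.exp_add]
    congr 1
    have e1 : (-Real.pi * a * n ^ 2 + 2 * Real.pi * (b + b' * Complex.I) * n : ℂ) =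
        ((-Real.pi * a * n ^ 2 + 2 * Real.pi * b * n : ℝ) : ℂ) + ((2 * Real.pi * b' * n : ℝ) : ℂ) * Complex.I := by
      push_cast
      ring
    rw [e1, sub_eq_add_neg, ← neg_mul, ← Complex.ofReal_neg]
    simp only [e]
    rw [add_add_add_comm, ← Complex.ofReal_add, ← add_mul, ← Complex.ofReal_add]
    congr 2
    · rw [← hgdef]
      simp only [hadef, b, t]
      field_simp
      ring
    · rw [← hgdef]
      simp only [b']
      push_cast
      field_simp
      ring
  have h2 : ∀ l : ℤ, B.dualTerm w s (k, l) =
      Complex.exp e * Complex.exp (-Real.pi / a * (l + Complex.I * (b + b' * Complex.I)) ^ 2) := by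
    intro l
    rw [dualTerm, ← Complex.exp_add]
    congr 1
    have e1 : (-Real.pi / a * (l + Complex.I * (b + b' * Complex.I)) ^ 2 : ℂ) =
        ((-Real.pi / a * ((l - b') ^ 2 - b ^ 2) : ℝ) : ℂ) +
          ((-Real.pi / a * (2 * (l - b') * b) : ℝ) : ℂ) * Complex.I := by
      have : (l + Complex.I * (b + b' * Complex.I)) ^ 2 =
        ((l - b') ^ 2 - b ^ 2 + 2 * (l - b') * b * Complex.I : ℂ) := by
        have h : Complex.I * (b + b' * Complex.I) = b * Complex.I - b' := by
          linear_combination (b' : ℂ) * Complex.I_sq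
        rw [h]
        linear_combination (b ^ 2 : ℂ) * Complex.I_sq
      rw [this]
      push_cast
      ring
    have e2 : (2 * Real.pi * Complex.I * (pairing (B.dualPt (k, l)) s : ℝ) : ℂ) =
      -(((-(2 * Real.pi * pairing (B.dualPt (k, l)) s) : ℝ) : ℂ) * Complex.I) := by push_cast; ring
    rw [e1, e2, sub_neg_eq_add]
    simp only [e]
    rw [add_add_add_comm, ← Complex.ofReal_add, ← add_mul, ← Complex.ofReal_add]
    congr 2
    · rw [norm_sq_dualPt]
      simp only [hadef, b, b', t, norm_sq_eq, pairing, Complex.add_re, Complex.add_im,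
        Complex.re_ofReal_mul, Complex.im_ofReal_mul]
      field_simp
      rw [hg', det]
      ring
    · rw [Complex.ofReal_inj]
      simp only [hadef, b, b', t, pairing, dualPt]
      field_simp
      rw [hg', det]
      ring
  simp_rw [h1, h2, tsum_mul_left]
  rw [key]
  ring

/-- Needed to exchange the order of summation between the two transformations. The absolute value is
exactly a Gaussian in k times a shifted Gaussian in n. -/
theorem summable_mixedTerm (s : ℂ) {w : ℝ} (hw : 0 < w) :
    Summable fun x : ℤ × ℤ => B.mixedTerm w s x.1 x.2 := by
  have hg := B.normSq_ω₁_pos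
  have hpi := Real.pi_pos
  have h1 := summable_exp_neg_mul_int_sq (c := Real.pi ^ 2 / (w * ‖B.ω₁‖ ^ 2)) (by positivity)
  have h2 := summable_exp_neg_mul_shift_sq (c := w / ‖B.ω₁‖ ^ 2) (by positivity) B.det_ne_zero
    (B.ω₁.re * s.im - B.ω₁.im * s.re)
  refine Summable.of_norm_bounded (h1.mul_of_nonneg h2 (fun _ => (Real.exp_pos _).le)
    (fun _ => (Real.exp_pos _).le)) fun x => le_of_eq ?_
  rw [mixedTerm, Complex.norm_exp, ← Real.exp_add]
  congr 1
  rw [Complex.sub_re, Complex.ofReal_re, Complex.re_ofReal_mul, Complex.I_re]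
  ring

/-- The functional equation of the theta series of a lattice in `ℂ`. -/
theorem tsum_theta (s : ℂ) {w : ℝ} (hw : 0 < w) :
    ∑' j, Complex.exp ((-w * ‖s - B.pt j‖ ^ 2 : ℝ)) =
      ((Real.pi / (w * |B.det|) : ℝ) : ℂ) * ∑' j, B.dualTerm w s j := by
  have hg := B.normSq_ω₁_pos
  have hpi := Real.pi_pos
  have hn : ‖B.ω₁‖ ≠ 0 := fun h => by simp [h] at hg
  have h0 : Summable fun j : ℤ × ℤ => Complex.exp ((-w * ‖s - B.pt j‖ ^ 2 : ℝ)) := by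
    simp_rw [← Complex.ofReal_exp]
    exact_mod_cast B.summable_theta s hw
  rw [h0.tsum_prod, ← Summable.tsum_comm (f := fun m n => Complex.exp ((-w * ‖s - B.pt (m, n)‖ ^ 2 : ℝ))) h0]
  simp_rw [B.tsum_theta_inner s hw, tsum_mul_left]
  rw [Summable.tsum_comm (f := fun k n => B.mixedTerm w s k n) (B.summable_mixedTerm s hw)]
  simp_rw [B.tsum_theta_outer s hw, tsum_mul_left]
  rw [← (B.summable_dualTerm s hw).tsum_prod, ← mul_assoc, ← Complex.ofReal_mul, ← mul_inv,
    ← Real.sqrt_mul (by positivity)]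
  congr 2
  -- The length of ω₁ cancels between the two normalizing square roots, leaving w|det|/π.
  rw [show w * ‖B.ω₁‖ ^ 2 / Real.pi * (w * B.det ^ 2 / (Real.pi * ‖B.ω₁‖ ^ 2)) =
    (w * |B.det| / Real.pi) ^ 2 by rw [div_pow, mul_pow, sq_abs]; field_simp,
    Real.sqrt_sq (by positivity), inv_div]

end LatticeBasis
end KudlaCusp

/-! ### Lattice sums of β₁ and their Fourier expansion. -/

namespace KudlaCusp
open Set Filter MeasureTheory

namespace LatticeBasis

variable (B : LatticeBasis)

/-- For large indices |s − λ|² grows quadratically; the finitely many others, with λ = s left out,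
have a positive minimum. -/
theorem exists_size_le_sub (s : ℂ) :
    ∃ c : ℝ, 0 < c ∧ ∀ j, B.pt j ≠ s → c * size j ≤ ‖s - B.pt j‖ ^ 2 := by
  obtain ⟨c, hc, hle⟩ := B.exists_size_le_pt
  -- From this size on, c(size − 1)/2 − |s|² ≥ c·size/4.
  let S : ℝ := 2 + 4 * ‖s‖ ^ 2 / c
  have hfin : {j : ℤ × ℤ | size j < S}.Finite := by
    have h := (summable_exp_size one_pos).tendsto_cofinite_zero
    have h2 := h.eventually (gt_mem_nhds (Real.exp_pos (-S)))
    refine Set.Finite.subset h2 fun j hj => ?_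
    have hj : size j < S := hj
    simp only [mem_compl_iff, mem_ofPred_eq, not_lt]
    gcongr
    linarith
  obtain ⟨c', hc', hle'⟩ : ∃ c' : ℝ, 0 < c' ∧ ∀ j, size j < S → B.pt j ≠ s →
      c' * size j ≤ ‖s - B.pt j‖ ^ 2 := by
    have hfin' := hfin.subset (sep_subset {j : ℤ × ℤ | size j < S} fun j => B.pt j ≠ s)
    rcases Set.eq_empty_or_nonempty {j | j ∈ {j : ℤ × ℤ | size j < S} ∧ B.pt j ≠ s} with he | hne
    · refine ⟨1, one_pos, fun j h1 h2 => ?_⟩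
      exact absurd (show j ∈ {j | j ∈ {j : ℤ × ℤ | size j < S} ∧ B.pt j ≠ s} from ⟨h1, h2⟩)
        (by rw [he]; exact notMem_empty j)
    · obtain ⟨j₀, hj₀, hmin⟩ := Set.exists_min_image _ (fun j => ‖s - B.pt j‖ ^ 2 / size j) hfin' hne
      have hpos : ∀ j, 0 < size j := fun j => by linarith [one_le_size j]
      refine ⟨‖s - B.pt j₀‖ ^ 2 / size j₀, ?_, fun j h1 h2 => ?_⟩
      · have : 0 < ‖s - B.pt j₀‖ := norm_pos_iff.2 (sub_ne_zero.2 hj₀.2.symm)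
        have := hpos j₀
        positivity
      · rw [← le_div_iff₀ (hpos j)]
        exact hmin j ⟨h1, h2⟩
  refine ⟨min c' (c / 4), by positivity, fun j hj => ?_⟩
  have hsz := one_le_size j
  by_cases h : size j < S
  · exact (mul_le_mul_of_nonneg_right (min_le_left _ _) (by linarith)).trans (hle' j h hj)
  · refine (mul_le_mul_of_nonneg_right (min_le_right _ _) (by linarith)).trans ?_
    refine le_trans ?_ (B.norm_sq_pt_le_sub s j)
    have h1 := hle j
    have h2 : c * S = 2 * c + 4 * ‖s‖ ^ 2 := by simp only [S]; field_simp
    have h3 := mul_le_mul_of_nonneg_left (not_lt.1 h) hc.le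
    linarith

/-- The sum of `beta1 |s - λ|²` over the lattice. -/
def betaSum (s : ℂ) : ℝ := ∑' j, beta1 (‖s - B.pt j‖ ^ 2)

theorem summable_beta1 {s : ℂ} (hs : ∀ j, B.pt j ≠ s) :
    Summable fun j => beta1 (‖s - B.pt j‖ ^ 2) := by
  obtain ⟨c, hc, hle⟩ := B.exists_size_le_sub s
  obtain ⟨K, hK⟩ := exists_norm_betaDeriv_le 0 hc
  refine Summable.of_norm_bounded ((summable_exp_size hc).mul_left |K|) fun j => ?_
  have h1 := hle j (hs j)
  have h2 : c ≤ ‖s - B.pt j‖ ^ 2 := by nlinarith [one_le_size j]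
  have h3 := hK _ h2
  rw [betaDeriv_zero] at h3
  refine h3.trans ?_
  gcongr
  · exact le_abs_self K
  · linarith

/-- Coefficients of the Fourier expansion of `betaSum`. -/
def dualCoeff (j : ℤ × ℤ) : ℝ := (Real.pi * |B.det| * ‖B.dualPt j‖ ^ 2)⁻¹

theorem pos_of_ne_zero {j : ℤ × ℤ} (hj : j ≠ 0) : 1 ≤ size j - 1 := by
  obtain ⟨a, b⟩ := j
  have h : 1 ≤ a ^ 2 + b ^ 2 := by
    by_contra! h
    have h1 : a = 0 := pow_eq_zero_iff two_ne_zero |>.1 (by nlinarith [sq_nonneg a, sq_nonneg b])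
    have h2 : b = 0 := pow_eq_zero_iff two_ne_zero |>.1 (by nlinarith [sq_nonneg a, sq_nonneg b])
    exact hj (by rw [h1, h2]; rfl)
  have h' : (1 : ℝ) ≤ (a : ℝ) ^ 2 + (b : ℝ) ^ 2 := by exact_mod_cast h
  unfold size
  simp only
  linarith

theorem dualPt_zero : B.dualPt 0 = 0 := by
  simp [dualPt, Complex.ext_iff]

/-- The convention 0⁻¹ = 0 drops frequency zero from `dualSum`. Its contribution is the leading term
in τ and is kept apart, so that only decaying terms remain. -/
theorem dualCoeff_zero : B.dualCoeff 0 = 0 := by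
  simp [dualCoeff, dualPt_zero]

theorem dualCoeff_bound : ∃ K : ℝ, ∀ j, ‖B.dualCoeff j‖ ≤ K := by
  obtain ⟨c, hc, hle⟩ := B.exists_size_le_dualPt
  have hpi := Real.pi_pos
  have hD : 0 < |B.det| := abs_pos.2 B.det_ne_zero
  refine ⟨(Real.pi * |B.det| * c)⁻¹, fun j => ?_⟩
  rcases eq_or_ne j 0 with rfl | hj
  · rw [dualCoeff_zero, norm_zero]; positivity
  · have h1 := hle j
    have h2 : c ≤ ‖B.dualPt j‖ ^ 2 := by nlinarith [pos_of_ne_zero hj]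
    have h3 : 0 < ‖B.dualPt j‖ ^ 2 := by linarith
    rw [dualCoeff, Real.norm_of_nonneg (by positivity)]
    gcongr

/-- The tail of the Fourier expansion of the lattice sum of `beta1`. -/
def dualSum (x : ℂ × ℝ) : ℂ := ∑' j, B.dualTerm x.2⁻¹ x.1 j • (B.dualCoeff j : ℂ)

theorem summable_dualSum (s : ℂ) {w : ℝ} (hw : 0 < w) :
    Summable fun j => B.dualTerm w s j • (B.dualCoeff j : ℂ) := by
  obtain ⟨K, hK⟩ := B.dualCoeff_bound
  refine Summable.of_norm_bounded ((B.summable_dualTerm s hw).norm.mul_right K) fun j => ?_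
  rw [norm_smul, Complex.norm_real]
  gcongr
  exact hK j

theorem hasDerivAt_dualTerm (s : ℂ) (j : ℤ × ℤ) {w : ℝ} (hw : w ≠ 0) :
    HasDerivAt (fun w : ℝ => B.dualTerm w s j)
      (B.dualTerm w s j * (Real.pi ^ 2 * ‖B.dualPt j‖ ^ 2 / w ^ 2 : ℝ)) w := by
  have h1 : HasDerivAt (fun w : ℝ => -(Real.pi ^ 2 / w) * ‖B.dualPt j‖ ^ 2)
      (Real.pi ^ 2 * ‖B.dualPt j‖ ^ 2 / w ^ 2) w := by
    have := (((hasDerivAt_inv hw).const_mul (Real.pi ^ 2)).neg).mul_const (‖B.dualPt j‖ ^ 2)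
    rw [show -(Real.pi ^ 2 * -(w ^ 2)⁻¹) * ‖B.dualPt j‖ ^ 2 =
      Real.pi ^ 2 * ‖B.dualPt j‖ ^ 2 / w ^ 2 by ring] at this
    exact this
  exact ((h1.ofReal_comp).sub_const _).cexp

/-- For j ≠ 0, with μ = `dualPt j`, the w-derivative of exp(−π²|μ|²/w) carries the factor π²|μ|²/w²,
so the integrand has the primitive `dualTerm` times `dualCoeff`. For j = 0 the exponential is 1, and
π/(w²|det|) integrates to π(τ − 1)/|det|. -/
theorem integral_dualTerm (s : ℂ) (j : ℤ × ℤ) {τ : ℝ} (hτ : 0 < τ) :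
    ∫ w in τ⁻¹..1, ((Real.pi / (w ^ 2 * |B.det|) : ℝ) : ℂ) * B.dualTerm w s j =
      (if j = 0 then ((Real.pi * (τ - 1) / |B.det| : ℝ) : ℂ) else 0) +
      (B.dualTerm 1 s j • (B.dualCoeff j : ℂ) - B.dualTerm τ⁻¹ s j • (B.dualCoeff j : ℂ)) := by
  have hD : 0 < |B.det| := abs_pos.2 B.det_ne_zero
  have hpi := Real.pi_pos
  have hτ' := inv_pos.2 hτ
  have hpos : ∀ w ∈ uIcc τ⁻¹ 1, 0 < w := fun w hw => lt_of_lt_of_le (lt_min hτ' one_pos) hw.1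
  have hcont : IntervalIntegrable (fun w : ℝ => ((Real.pi / (w ^ 2 * |B.det|) : ℝ) : ℂ) * B.dualTerm w s j)
      volume τ⁻¹ 1 := by
    refine ContinuousOn.intervalIntegrable fun w hw => ContinuousAt.continuousWithinAt ?_
    have hw0 := (hpos w hw).ne'
    refine ContinuousAt.mul ?_ (B.hasDerivAt_dualTerm s j hw0).continuousAt
    refine Complex.continuous_ofReal.continuousAt.comp (ContinuousAt.div (by fun_prop) (by fun_prop) ?_)
    positivity
  rcases eq_or_ne j 0 with rfl | hj
  · rw [if_pos rfl, dualCoeff_zero]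
    have : ∀ w ∈ uIcc τ⁻¹ 1, HasDerivAt (fun w : ℝ => ((-(Real.pi / |B.det|) * w⁻¹ : ℝ) : ℂ))
        (((Real.pi / (w ^ 2 * |B.det|) : ℝ) : ℂ) * B.dualTerm w s 0) w := by
      intro w hw
      have h1 := ((hasDerivAt_inv (hpos w hw).ne').const_mul (-(Real.pi / |B.det|))).ofReal_comp
      convert h1 using 1
      have : B.dualTerm w s 0 = 1 := by simp [dualTerm, dualPt_zero, pairing]
      rw [this, mul_one]
      congr 1
      field_simp
    rw [intervalIntegral.integral_eq_sub_of_hasDerivAt this hcont]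
    simp only [Complex.ofReal_zero, smul_zero, sub_zero, add_zero]
    rw [← Complex.ofReal_sub]
    congr 1
    rw [inv_inv]
    field_simp
    ring
  · rw [if_neg hj, zero_add]
    obtain ⟨c, hc, hle⟩ := B.exists_size_le_dualPt
    have h3 : 0 < ‖B.dualPt j‖ ^ 2 := by nlinarith [hle j, pos_of_ne_zero hj]
    have hn : ‖B.dualPt j‖ ≠ 0 := fun h => by simp [h] at h3
    have : ∀ w ∈ uIcc τ⁻¹ 1, HasDerivAt (fun w : ℝ => B.dualTerm w s j • (B.dualCoeff j : ℂ))
        (((Real.pi / (w ^ 2 * |B.det|) : ℝ) : ℂ) * B.dualTerm w s j) w := by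
      intro w hw
      have hw0 := hpos w hw
      have h1 := (B.hasDerivAt_dualTerm s j hw0.ne').mul_const (B.dualCoeff j : ℂ)
      have h2 : B.dualTerm w s j * (Real.pi ^ 2 * ‖B.dualPt j‖ ^ 2 / w ^ 2 : ℝ) * (B.dualCoeff j : ℂ) =
          ((Real.pi / (w ^ 2 * |B.det|) : ℝ) : ℂ) * B.dualTerm w s j := by
        rw [mul_assoc, ← Complex.ofReal_mul, mul_comm]
        congr 2
        rw [dualCoeff]
        field_simp
      rw [h2] at h1
      exact h1
    rw [intervalIntegral.integral_eq_sub_of_hasDerivAt this hcont]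

/-- Dominated convergence: each Gaussian is largest at the smaller endpoint of the interval. Both
orders of 1/τ and 1 occur, hence the `min`. -/
theorem hasSum_integral_exp (s : ℂ) {τ : ℝ} (hτ : 0 < τ) :
    HasSum (fun j => ∫ w in τ⁻¹..1, ((Real.exp (-‖s - B.pt j‖ ^ 2 * w) / w : ℝ) : ℂ))
      (∫ w in τ⁻¹..1, ((w⁻¹ : ℝ) : ℂ) * ∑' j, Complex.exp ((-w * ‖s - B.pt j‖ ^ 2 : ℝ))) := by
  have hτ' := inv_pos.2 hτ
  have ha : 0 < min τ⁻¹ 1 := lt_min hτ' one_pos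
  refine intervalIntegral.hasSum_integral_of_dominated_convergence
    (fun j _ => Real.exp (-min τ⁻¹ 1 * ‖s - B.pt j‖ ^ 2) * (min τ⁻¹ 1)⁻¹) (fun j => ?_) (fun j => ?_) ?_ ?_ ?_
  · exact (by fun_prop : Measurable fun w : ℝ =>
      ((Real.exp (-‖s - B.pt j‖ ^ 2 * w) / w : ℝ) : ℂ)).aestronglyMeasurable
  · refine Eventually.of_forall fun w hw => ?_
    have hw' : min τ⁻¹ 1 < w := hw.1
    have hw0 := ha.trans hw'
    rw [Complex.norm_real, norm_div, Real.norm_of_nonneg (Real.exp_pos _).le,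
      Real.norm_of_nonneg hw0.le, div_eq_mul_inv]
    have : 0 ≤ ‖s - B.pt j‖ ^ 2 := by positivity
    exact mul_le_mul (Real.exp_le_exp.2 (by nlinarith)) (inv_anti₀ ha hw'.le)
      (inv_nonneg.2 hw0.le) (Real.exp_pos _).le
  · exact Eventually.of_forall fun w _ => (B.summable_theta s ha).mul_right _
  · exact intervalIntegrable_const
  · refine Eventually.of_forall fun w hw => ?_
    have hw' : min τ⁻¹ 1 < w := hw.1
    have hw0 := ha.trans hw'
    have h0 : Summable fun j : ℤ × ℤ => Complex.exp ((-w * ‖s - B.pt j‖ ^ 2 : ℝ)) := by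
      simp_rw [← Complex.ofReal_exp]
      exact_mod_cast B.summable_theta s hw0
    have e : ∀ j, ((Real.exp (-‖s - B.pt j‖ ^ 2 * w) / w : ℝ) : ℂ) =
        ((w⁻¹ : ℝ) : ℂ) * Complex.exp ((-w * ‖s - B.pt j‖ ^ 2 : ℝ)) := fun j => by
      rw [← Complex.ofReal_exp, ← Complex.ofReal_mul,
        show -‖s - B.pt j‖ ^ 2 * w = -w * ‖s - B.pt j‖ ^ 2 by ring, div_eq_inv_mul]
    simp_rw [e]
    exact h0.hasSum.mul_left _

/-- The same integral, expanded after the functional equation. The dual terms increase in absolute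
value with w, so the majorant is taken at the larger endpoint. -/
theorem hasSum_integral_dual (s : ℂ) {τ : ℝ} (hτ : 0 < τ) :
    HasSum (fun j => ∫ w in τ⁻¹..1, ((Real.pi / (w ^ 2 * |B.det|) : ℝ) : ℂ) * B.dualTerm w s j)
      (∫ w in τ⁻¹..1, ((w⁻¹ : ℝ) : ℂ) * ∑' j, Complex.exp ((-w * ‖s - B.pt j‖ ^ 2 : ℝ))) := by
  have hτ' := inv_pos.2 hτ
  have hpi := Real.pi_pos
  have hD : 0 < |B.det| := abs_pos.2 B.det_ne_zero
  have ha : 0 < min τ⁻¹ 1 := lt_min hτ' one_pos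
  have hb : 0 < max τ⁻¹ 1 := lt_max_of_lt_right one_pos
  refine intervalIntegral.hasSum_integral_of_dominated_convergence
    (fun j _ => Real.pi / (min τ⁻¹ 1 ^ 2 * |B.det|) * ‖B.dualTerm (max τ⁻¹ 1) s j‖)
    (fun j => ?_) (fun j => ?_) ?_ ?_ ?_
  · refine Measurable.aestronglyMeasurable ?_
    unfold dualTerm
    fun_prop
  · refine Eventually.of_forall fun w hw => ?_
    have hw' : min τ⁻¹ 1 < w := hw.1
    have hw0 := ha.trans hw'
    rw [norm_mul, norm_dualTerm, norm_dualTerm, Complex.norm_real, Real.norm_of_nonneg (by positivity)]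
    have : w ≤ max τ⁻¹ 1 := hw.2
    gcongr
  · exact Eventually.of_forall fun w _ => (B.summable_dualTerm s hb).norm.mul_left _
  · exact intervalIntegrable_const
  · refine Eventually.of_forall fun w hw => ?_
    have hw' : min τ⁻¹ 1 < w := hw.1
    have hw0 := ha.trans hw'
    rw [B.tsum_theta s hw0, ← mul_assoc, ← Complex.ofReal_mul]
    rw [show w⁻¹ * (Real.pi / (w * |B.det|)) = Real.pi / (w ^ 2 * |B.det|) by field_simp]
    exact (B.summable_dualTerm s hw0).hasSum.mul_left _

/-- The lattice sum of `beta1 (|s - λ|² / τ)` in terms of its leading term in `τ`, its value at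
`τ = 1` and rapidly decreasing terms. -/
theorem hasSum_beta1_div {s : ℂ} (hs : ∀ j, B.pt j ≠ s) {τ : ℝ} (hτ : 0 < τ) :
    HasSum (fun j => beta1 (‖s - B.pt j‖ ^ 2 / τ))
      (Real.pi * (τ - 1) / |B.det| + B.betaSum s + ((B.dualSum (s, 1)).re - (B.dualSum (s, τ)).re)) := by
  have h1 := B.hasSum_integral_exp s hτ
  have h2 := B.hasSum_integral_dual s hτ
  simp_rw [B.integral_dualTerm s _ hτ] at h2
  have h3 := (hasSum_ite_eq (0 : ℤ × ℤ) ((Real.pi * (τ - 1) / |B.det| : ℝ) : ℂ)).add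
    ((B.summable_dualSum s one_pos).hasSum.sub (B.summable_dualSum s (inv_pos.2 hτ)).hasSum)
  -- The direct and the dual expansion have the same sum; equating them evaluates the τ-dependent
  -- correction in closed form.
  rw [h2.unique h3] at h1
  have h4 : ∑' j, B.dualTerm 1 s j • (B.dualCoeff j : ℂ) = B.dualSum (s, 1) := by
    simp [dualSum]
  have h4' : ∑' j, B.dualTerm τ⁻¹ s j • (B.dualCoeff j : ℂ) = B.dualSum (s, τ) := rfl
  rw [h4, h4'] at h1
  have h5 := (Complex.hasSum_re h1).add (B.summable_beta1 hs).hasSum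
  convert h5 using 1
  · ext j
    have hpos : 0 < ‖s - B.pt j‖ ^ 2 := by
      have := norm_pos_iff.2 (sub_ne_zero.2 (hs j).symm)
      positivity
    rw [beta1_div hpos hτ, intervalIntegral.integral_ofReal, Complex.ofReal_re, add_comm]
  · rw [Complex.add_re, Complex.sub_re, Complex.ofReal_re, betaSum]
    ring

end LatticeBasis
end KudlaCusp

/-! ### Smoothness and decay of the dual sum, and singularities of the β₁ sum. -/

namespace KudlaCusp
open Set Filter MeasureTheory

namespace LatticeBasis

variable (B : LatticeBasis)

theorem norm_sq_le_size (a b : ℂ) (x y : ℝ) : ‖(x : ℂ) * a + y * b‖ ^ 2 ≤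
    2 * (‖a‖ ^ 2 + ‖b‖ ^ 2) * (1 + x ^ 2 + y ^ 2) := by
  simp only [norm_sq_eq, Complex.add_re, Complex.add_im, Complex.re_ofReal_mul,
    Complex.im_ofReal_mul]
  nlinarith [sq_nonneg (x * a.re - y * b.re), sq_nonneg (x * a.im - y * b.im), sq_nonneg (x * b.re),
    sq_nonneg (x * b.im), sq_nonneg (y * a.re), sq_nonneg (y * a.im), sq_nonneg a.re, sq_nonneg a.im,
    sq_nonneg b.re, sq_nonneg b.im]

theorem exists_pt_le_size : ∃ K : ℝ, ∀ j, ‖B.pt j‖ ^ 2 ≤ K * size j := by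
  refine ⟨2 * (‖B.ω₁‖ ^ 2 + ‖B.ω₂‖ ^ 2), fun j => ?_⟩
  have := norm_sq_le_size B.ω₁ B.ω₂ j.1 j.2
  simp only [Complex.ofReal_intCast] at this
  exact this

theorem exists_dualPt_le_size : ∃ K : ℝ, ∀ j, ‖B.dualPt j‖ ^ 2 ≤ K * size j := by
  refine ⟨2 * (‖B.ω₁‖ ^ 2 + ‖B.ω₂‖ ^ 2) / B.det ^ 2, fun j => ?_⟩
  have := norm_sq_le_size B.ω₁ B.ω₂ (-j.2) j.1
  rw [norm_sq_dualPt, div_mul_eq_mul_div]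
  gcongr
  rw [show size j = 1 + (-(j.2 : ℝ)) ^ 2 + (j.1 : ℝ) ^ 2 by unfold size; ring]
  exact this

/-- The linear form `s ↦ pairing μ s`. -/
def pairingCLM (μ : ℂ) : ℂ →L[ℝ] ℝ := μ.re • Complex.reCLM + μ.im • Complex.imCLM

theorem pairingCLM_apply (μ s : ℂ) : pairingCLM μ s = pairing μ s := by
  simp [pairingCLM, pairing]

theorem abs_pairing_le (μ s : ℂ) : |pairing μ s| ≤ ‖μ‖ * ‖s‖ := by
  refine abs_le_of_sq_le_sq ?_ (by positivity)
  rw [mul_pow, norm_sq_eq, norm_sq_eq, pairing]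
  nlinarith [sq_nonneg (μ.re * s.im - μ.im * s.re)]

/-- The exponent of the general term of `dualSum`. -/
def dualExponent (j : ℤ × ℤ) : ℂ × ℝ →L[ℝ] ℂ :=
  (-(Real.pi ^ 2 * ‖B.dualPt j‖ ^ 2) : ℝ) • (Complex.ofRealCLM.comp (ContinuousLinearMap.snd ℝ ℂ ℝ))
    - (2 * Real.pi * Complex.I : ℂ) • (Complex.ofRealCLM.comp
      ((pairingCLM (B.dualPt j)).comp (ContinuousLinearMap.fst ℝ ℂ ℝ)))

theorem dualExponent_apply (j : ℤ × ℤ) (x : ℂ × ℝ) : B.dualExponent j x =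
    (-(Real.pi ^ 2 * ‖B.dualPt j‖ ^ 2) * x.2 : ℝ) -
      2 * Real.pi * Complex.I * (pairing (B.dualPt j) x.1 : ℝ) := by
  simp [dualExponent, pairingCLM_apply]

/-- In τ = 1/w the exponent −π²|μ|²τ − 2πi⟨μ, s⟩ is linear in (s, τ), as the formalism of
`SeriesDatum` requires. -/
theorem dualTerm_eq (j : ℤ × ℤ) (x : ℂ × ℝ) :
    B.dualTerm x.2⁻¹ x.1 j = Complex.exp (B.dualExponent j x + 0) := by
  rw [dualTerm, dualExponent_apply, add_zero, div_inv_eq_mul]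
  ring_nf

theorem norm_exp_dualExponent (j : ℤ × ℤ) (x : ℂ × ℝ) :
    ‖Complex.exp (B.dualExponent j x + 0)‖ = Real.exp (-(Real.pi ^ 2 * ‖B.dualPt j‖ ^ 2) * x.2) := by
  rw [← dualTerm_eq, norm_dualTerm, div_inv_eq_mul]
  ring_nf

theorem exists_norm_dualExponent_le : ∃ K, ∀ j, ‖B.dualExponent j‖ ≤ K * size j := by
  obtain ⟨K, hK⟩ := B.exists_dualPt_le_size
  refine ⟨Real.pi ^ 2 * K + 2 * Real.pi * (1 + K), fun j => ?_⟩
  have hpi := Real.pi_pos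
  have h1 := hK j
  have h2 : ‖B.dualPt j‖ ≤ (1 + K) * size j := by
    nlinarith [sq_nonneg (‖B.dualPt j‖ - 1), one_le_size j]
  refine (B.dualExponent j).opNorm_le_bound ?_ fun x => ?_
  · nlinarith [sq_nonneg ‖B.dualPt j‖, norm_nonneg (B.dualPt j), sq_nonneg Real.pi,
      mul_nonneg (sq_nonneg Real.pi) ((sq_nonneg ‖B.dualPt j‖).trans h1)]
  · rw [dualExponent_apply]
    have e1 : |x.2| ≤ ‖x‖ := norm_snd_le x
    have e2 : ‖x.1‖ ≤ ‖x‖ := norm_fst_le x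
    have e3 := abs_pairing_le (B.dualPt j) x.1
    refine (norm_sub_le _ _).trans ?_
    rw [Complex.norm_real, norm_mul, Real.norm_eq_abs, Real.norm_eq_abs, abs_neg,
      abs_of_nonneg (by positivity), norm_mul, Complex.norm_real, Real.norm_eq_abs]
    have e4 : ‖(2 * Real.pi * Complex.I : ℂ)‖ = 2 * Real.pi := by
      simp [abs_of_pos hpi]
    rw [e4]
    have hKs : 0 ≤ K * size j := (sq_nonneg _).trans h1
    have hKs' : 0 ≤ (1 + K) * size j := (norm_nonneg _).trans h2
    calc _ ≤ Real.pi ^ 2 * (K * size j) * ‖x‖ + 2 * Real.pi * (((1 + K) * size j) * ‖x‖) := by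
          gcongr
          exact e3.trans (by gcongr)
      _ = _ := by ring

/-- The Fourier expansion of `dualSum`, on the half space `τ₀ < τ`. -/
def dualSeries (τ₀ : ℝ) (h : 0 < τ₀) : SeriesDatum (ℤ × ℤ) (ℂ × ℝ) ℂ where
  q := size
  one_le_q := one_le_size
  summable_exp _ := summable_exp_size
  M := B.dualExponent
  c _ := 0
  norm_M_le := B.exists_norm_dualExponent_le
  O := {x | τ₀ < x.2}
  isOpen_O := isOpen_lt continuous_const continuous_snd
  convex_O := by
    intro x hx y hy a b ha hb hab
    have hx : τ₀ < x.2 := hx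
    have hy : τ₀ < y.2 := hy
    change τ₀ < a * x.2 + b * y.2
    rcases ha.eq_or_lt with rfl | ha
    · obtain rfl : b = 1 := by linarith
      linarith
    · nlinarith
  φ _ := Complex.exp
  hasDerivAt_φ _ _ _ _ := Complex.hasDerivAt_exp _
  norm_φ_le _ := by
    obtain ⟨c, hc, hle⟩ := B.exists_size_le_dualPt
    have hpi := Real.pi_pos
    refine ⟨Real.exp (Real.pi ^ 2 * c * τ₀), Real.pi ^ 2 * c * τ₀, by positivity, fun j x hx => ?_⟩
    have hx : τ₀ < x.2 := hx
    rw [norm_exp_dualExponent, ← Real.exp_add, Real.exp_le_exp]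
    have h1 := mul_le_mul_of_nonneg_left (hle j) (sq_nonneg Real.pi)
    have h2 : 0 ≤ Real.pi ^ 2 * ‖B.dualPt j‖ ^ 2 := by positivity
    have h3 := mul_le_mul_of_nonneg_left hx.le h2
    have h4 := mul_le_mul_of_nonneg_right h1 h.le
    linarith

theorem tempered_dualCoeff (τ₀ : ℝ) (h : 0 < τ₀) :
    (B.dualSeries τ₀ h).Tempered fun j => (B.dualCoeff j : ℂ) := by
  obtain ⟨K, hK⟩ := B.dualCoeff_bound
  exact ⟨K, 0, fun j => by rw [pow_zero, mul_one, Complex.norm_real]; exact hK j⟩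

theorem dualSum_eq (τ₀ : ℝ) (h : 0 < τ₀) :
    B.dualSum = (B.dualSeries τ₀ h).sum 0 fun j => (B.dualCoeff j : ℂ) := by
  ext x
  simp_rw [dualSum, dualTerm_eq]
  rfl

theorem contDiffOn_dualSum : ContDiffOn ℝ ∞ B.dualSum {x | 0 < x.2} := by
  intro x hx
  have hx : 0 < x.2 := hx
  have h2 : 0 < x.2 / 2 := by positivity
  have := (B.tempered_dualCoeff _ h2).contDiffOn_sum 0
  rw [← dualSum_eq] at this
  refine (this.contDiffAt ((B.dualSeries _ h2).isOpen_O.mem_nhds ?_)).contDiffWithinAt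
  exact half_lt_self hx

/-- Only j ≠ 0 contributes. There size ≥ 2, and τ ≥ 1 gives (size − 1)τ ≥ size/4 + τ/2, which splits
the exponential into a summable factor and a uniform decay in τ. -/
theorem exists_norm_dualSeries_sum_le {F : Type} [NormedAddCommGroup F] [NormedSpace ℝ F]
    [NormedSpace ℂ F] [IsScalarTower ℝ ℂ F] (τ₀ : ℝ) (h : 0 < τ₀)
    {C : ℤ × ℤ → F} (hC : (B.dualSeries τ₀ h).Tempered C) (hC0 : C 0 = 0) (n : ℕ) :
    ∃ K b : ℝ, 0 < b ∧ ∀ x : ℂ × ℝ, 1 ≤ x.2 →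
      ‖(B.dualSeries τ₀ h).sum n C x‖ ≤ K * Real.exp (-b * x.2) := by
  obtain ⟨c, hc, hle⟩ := B.exists_size_le_dualPt
  obtain ⟨K, k, hK⟩ := hC
  have hpi := Real.pi_pos
  have hb : 0 < Real.pi ^ 2 * c / 4 := by positivity
  have hsum := ((B.dualSeries τ₀ h).summable_pow_mul_exp k hb).mul_left K
  refine ⟨∑' j, K * ((B.dualSeries τ₀ h).q j ^ k *
    Real.exp (-(Real.pi ^ 2 * c / 4) * (B.dualSeries τ₀ h).q j)), Real.pi ^ 2 * c / 2,
    by positivity, fun x hx => ?_⟩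
  refine tsum_of_norm_bounded (hsum.hasSum.mul_right _) fun j => ?_
  change ‖Complex.exp (B.dualExponent j x + 0) • C j‖ ≤
    K * (size j ^ k * Real.exp (-(Real.pi ^ 2 * c / 4) * size j)) * _
  rcases eq_or_ne j 0 with rfl | hj
  · have : 0 ≤ K * size 0 ^ k := (norm_nonneg _).trans (hK 0)
    rw [hC0, smul_zero, norm_zero, ← mul_assoc]
    positivity
  · rw [norm_smul, norm_exp_dualExponent]
    have h1 := hK j
    have h2 : Real.exp (-(Real.pi ^ 2 * ‖B.dualPt j‖ ^ 2) * x.2) ≤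
        Real.exp (-(Real.pi ^ 2 * c / 4) * size j) * Real.exp (-(Real.pi ^ 2 * c / 2) * x.2) := by
      rw [← Real.exp_add, Real.exp_le_exp]
      have h3 := pos_of_ne_zero hj
      have h4 : size j / 4 + x.2 / 2 ≤ (size j - 1) * x.2 := by nlinarith
      have h5 := mul_le_mul_of_nonneg_right (hle j) (zero_le_one.trans hx)
      have h6 := mul_le_mul_of_nonneg_left h4 hc.le
      nlinarith [mul_le_mul_of_nonneg_left (h6.trans (by linarith : _ ≤ ‖B.dualPt j‖ ^ 2 * x.2)) (sq_nonneg Real.pi)]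
    calc _ ≤ (Real.exp (-(Real.pi ^ 2 * c / 4) * size j) * Real.exp (-(Real.pi ^ 2 * c / 2) * x.2)) *
          (K * size j ^ k) := mul_le_mul h2 h1 (norm_nonneg _) (by positivity)
      _ = _ := by ring

/-- The first two derivatives are series of the same type, with coefficients that still vanish at j
= 0, so the previous estimate applies to all three. -/
theorem exists_dualSum_decay : ∃ K b : ℝ, 0 < b ∧ ∀ x : ℂ × ℝ, 1 ≤ x.2 →
    ‖B.dualSum x‖ ≤ K * Real.exp (-b * x.2) ∧ ‖fderiv ℝ B.dualSum x‖ ≤ K * Real.exp (-b * x.2) ∧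
    ‖fderiv ℝ (fderiv ℝ B.dualSum) x‖ ≤ K * Real.exp (-b * x.2) := by
  have h : (0 : ℝ) < 1 / 2 := by norm_num
  have hC := B.tempered_dualCoeff _ h
  set S := B.dualSeries _ h with hS
  let C : ℤ × ℤ → ℂ := fun j => (B.dualCoeff j : ℂ)
  have h0 : C 0 = 0 := by simp [C, dualCoeff_zero]
  have h0' : S.derivCoeff C 0 = 0 := by simp [SeriesDatum.derivCoeff, h0]
  have h0'' : S.derivCoeff (S.derivCoeff C) 0 = 0 := by simp [SeriesDatum.derivCoeff, h0]
  have hf : ∀ x ∈ S.O, fderiv ℝ B.dualSum x = S.sum 1 (S.derivCoeff C) x := fun x hx => by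
    rw [B.dualSum_eq _ h]
    exact (hC.hasFDerivAt_sum 0 hx).fderiv
  have hff : ∀ x ∈ S.O, fderiv ℝ (fderiv ℝ B.dualSum) x = S.sum 2 (S.derivCoeff (S.derivCoeff C)) x := by
    intro x hx
    have : fderiv ℝ B.dualSum =ᶠ[𝓝 x] S.sum 1 (S.derivCoeff C) := by
      filter_upwards [S.isOpen_O.mem_nhds hx] with y hy using hf y hy
    rw [this.fderiv_eq]
    exact (hC.derivCoeff.hasFDerivAt_sum 1 hx).fderiv
  obtain ⟨K₀, b₀, hb₀, H₀⟩ := B.exists_norm_dualSeries_sum_le _ h hC h0 0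
  obtain ⟨K₁, b₁, hb₁, H₁⟩ := B.exists_norm_dualSeries_sum_le _ h hC.derivCoeff h0' 1
  obtain ⟨K₂, b₂, hb₂, H₂⟩ := B.exists_norm_dualSeries_sum_le _ h hC.derivCoeff.derivCoeff h0'' 2
  have hb : 0 < min b₀ (min b₁ b₂) := lt_min hb₀ (lt_min hb₁ hb₂)
  have aux : ∀ {K' b' y : ℝ} (x : ℂ × ℝ), 1 ≤ x.2 → y ≤ K' * Real.exp (-b' * x.2) →
      K' ≤ |K₀| + |K₁| + |K₂| → min b₀ (min b₁ b₂) ≤ b' →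
      y ≤ (|K₀| + |K₁| + |K₂|) * Real.exp (-min b₀ (min b₁ b₂) * x.2) := by
    intro K' b' y x hx hy hK hb'
    refine hy.trans (mul_le_mul hK (Real.exp_le_exp.2 ?_) (Real.exp_pos _).le (by positivity))
    nlinarith
  refine ⟨|K₀| + |K₁| + |K₂|, _, hb, fun x hx => ?_⟩
  have hxO : x ∈ S.O := by change 1 / 2 < x.2; linarith
  have k0 := abs_nonneg K₀
  have k1 := abs_nonneg K₁
  have k2 := abs_nonneg K₂
  refine ⟨aux (K' := K₀) x hx ?_ (by linarith [le_abs_self K₀]) (min_le_left _ _),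
    aux (K' := K₁) x hx ?_ (by linarith [le_abs_self K₁]) ((min_le_right _ _).trans (min_le_left _ _)),
    aux (K' := K₂) x hx ?_ (by linarith [le_abs_self K₂]) ((min_le_right _ _).trans (min_le_right _ _))⟩
  · rw [B.dualSum_eq _ h]; exact H₀ x hx
  · rw [hf x hxO]; exact H₁ x hx
  · rw [hff x hxO]; exact H₂ x hx

theorem pt_injective : Function.Injective B.pt := by
  intro i j hij
  by_contra hne
  obtain ⟨c, hc, hle⟩ := B.exists_size_le_pt
  have h1 := pos_of_ne_zero (sub_ne_zero.2 hne)
  have h2 := hle (i - j)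
  have h3 : B.pt (i - j) = 0 := by
    have : B.pt (i - j) = B.pt i - B.pt j := by simp [pt]; ring
    rw [this, hij, sub_self]
  rw [h3, norm_zero] at h2
  nlinarith

/-- The affine form on `ℝ × ℂ` which is `|s - λ|²` at `(|s|², s)`. -/
def distForm (j : ℤ × ℤ) : ℝ × ℂ →L[ℝ] ℝ :=
  ContinuousLinearMap.fst ℝ ℝ ℂ - (2 : ℝ) • (pairingCLM (B.pt j)).comp (ContinuousLinearMap.snd ℝ ℝ ℂ)

theorem distForm_apply (j : ℤ × ℤ) (x : ℝ × ℂ) :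
    B.distForm j x = x.1 - 2 * pairing (B.pt j) x.2 := by
  simp [distForm, pairingCLM_apply]

/-- Treating |s|² as a variable independent of s makes |s − λ|² affine, so that `betaSum` without
its singular term also becomes a series of affine forms. -/
theorem distForm_sq (j : ℤ × ℤ) (s : ℂ) :
    B.distForm j (‖s‖ ^ 2, s) + ‖B.pt j‖ ^ 2 = ‖s - B.pt j‖ ^ 2 := by
  rw [distForm_apply, pairing, norm_sq_eq, norm_sq_eq, norm_sq_eq, Complex.sub_re, Complex.sub_im]
  ring

theorem exists_norm_distForm_le : ∃ K, 0 ≤ K ∧ ∀ j, ‖B.distForm j‖ ≤ K * size j := by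
  obtain ⟨K, hK⟩ := B.exists_pt_le_size
  have hK0 : 0 ≤ K := by
    have := (sq_nonneg _).trans (hK 0)
    nlinarith [one_le_size 0]
  refine ⟨1 + 2 * (1 + K), by positivity, fun j => ?_⟩
  have h1 := hK j
  have h3 := one_le_size j
  have h2 : ‖B.pt j‖ ≤ (1 + K) * size j := by nlinarith [sq_nonneg (‖B.pt j‖ - 1)]
  refine (B.distForm j).opNorm_le_bound (by positivity) fun x => ?_
  rw [distForm_apply]
  have e1 : |x.1| ≤ ‖x‖ := norm_fst_le x
  have e2 : ‖x.2‖ ≤ ‖x‖ := norm_snd_le x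
  have e3 := abs_pairing_le (B.pt j) x.2
  have e4 : ‖B.pt j‖ * ‖x.2‖ ≤ (1 + K) * size j * ‖x‖ := by gcongr
  have e5 : ‖x‖ ≤ size j * ‖x‖ := le_mul_of_one_le_left (norm_nonneg _) h3
  rw [Real.norm_eq_abs]
  calc |x.1 - 2 * pairing (B.pt j) x.2| ≤ |x.1| + |2 * pairing (B.pt j) x.2| := abs_sub _ _
    _ = |x.1| + 2 * |pairing (B.pt j) x.2| := by rw [abs_mul, abs_two]
    _ ≤ _ := by linarith

/-- The series `betaSum` without the term which is singular at `s`, near `s`. -/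
theorem exists_betaSeries (s : ℂ) :
    ∃ S : SeriesDatum {j // B.pt j ≠ s} (ℝ × ℂ) ℝ, (‖s‖ ^ 2, s) ∈ S.O ∧
      S.M = (fun j : {j // B.pt j ≠ s} => B.distForm j) ∧ S.c = (fun j : {j // B.pt j ≠ s} => ‖B.pt j‖ ^ 2) ∧ S.φ = betaDeriv := by
  obtain ⟨c, hc, hle⟩ := B.exists_size_le_sub s
  obtain ⟨K, hK0, hK⟩ := B.exists_norm_distForm_le
  have hr : 0 < c / 2 / (K + 1) := by positivity
  -- The linear forms have norm at most K·size, so on a ball of radius c/(2(K + 1)) they change by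
  -- at most half of the lower bound c·size valid at the center.
  have key : ∀ j : {j // B.pt j ≠ s}, ∀ x ∈ Metric.ball ((‖s‖ ^ 2, s) : ℝ × ℂ) (c / 2 / (K + 1)),
      c / 2 * size j ≤ B.distForm j x + ‖B.pt j‖ ^ 2 := by
    intro j x hx
    have h1 := hle j j.2
    rw [← distForm_sq] at h1
    have hsz := one_le_size j
    have h2 : |B.distForm j (x - (‖s‖ ^ 2, s))| ≤ c / 2 * size j := by
      refine ((B.distForm j).le_opNorm _).trans ?_
      rw [mem_ball_iff_norm] at hx
      calc _ ≤ (K * size j) * (c / 2 / (K + 1)) := mul_le_mul (hK j) hx.le (norm_nonneg _) (by positivity)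
        _ = (c / 2 * size j) * (K / (K + 1)) := by field_simp
        _ ≤ (c / 2 * size j) * 1 := by gcongr; rw [div_le_one (by positivity)]; linarith
        _ = _ := mul_one _
    rw [map_sub] at h2
    linarith [(abs_le.1 h2).1]
  refine ⟨{ q := fun j => size j, one_le_q := fun j => one_le_size j, summable_exp := fun a ha => (summable_exp_size ha).subtype _
            M := fun j => B.distForm j
            c := fun j => ‖B.pt j‖ ^ 2
            norm_M_le := ⟨K, fun j => hK j⟩
            O := Metric.ball (‖s‖ ^ 2, s) (c / 2 / (K + 1))
            isOpen_O := Metric.isOpen_ball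
            convex_O := convex_ball _ _
            φ := betaDeriv
            hasDerivAt_φ := fun n j x hx => hasDerivAt_betaDeriv n ?_
            norm_φ_le := fun n => ?_ }, Metric.mem_ball_self hr, rfl, rfl, rfl⟩
  · have := key j x hx
    nlinarith [one_le_size j]
  · obtain ⟨K', hK'⟩ := exists_norm_betaDeriv_le n (η := c / 2) (by positivity)
    refine ⟨|K'|, c / 2, by positivity, fun j x hx => ?_⟩
    have h1 := key j x hx
    refine (hK' _ (by nlinarith [one_le_size j])).trans ?_
    gcongr
    · exact le_abs_self _
    · linarith

/-- `betaSum` has logarithmic singularities at the lattice points, and is smooth elsewhere. -/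
theorem betaSum_regular (s₀ : ℂ) : ∃ ρ : ℂ → ℝ, ContDiffAt ℝ ∞ ρ s₀ ∧
    (∀ᶠ s in 𝓝 s₀, (∀ j, B.pt j ≠ s) →
      B.betaSum s + (open Classical in if ∃ j, B.pt j = s₀ then Real.log (‖s - s₀‖ ^ 2) else 0) = ρ s) := by
  classical
  obtain ⟨S, hmem, hM, hc, hφ⟩ := B.exists_betaSeries s₀
  have hT : S.Tempered fun _ => (1 : ℝ) := ⟨1, 0, fun _ => by simp⟩
  have hsq : ContDiff ℝ ∞ fun s : ℂ => (‖s‖ ^ 2, s) := by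
    refine ContDiff.prodMk ?_ contDiff_id
    exact contDiff_norm_sq ℝ
  let R : ℂ → ℝ := fun s => S.sum 0 (fun _ => (1 : ℝ)) (‖s‖ ^ 2, s)
  have hR : ContDiffAt ℝ ∞ R s₀ :=
    ContDiffAt.comp (f := fun s : ℂ => (‖s‖ ^ 2, s)) s₀ ((hT.contDiffOn_sum 0).contDiffAt (S.isOpen_O.mem_nhds hmem)) hsq.contDiffAt
  have hRs : ∀ s, R s = ∑' j : {j // B.pt j ≠ s₀}, beta1 (‖s - B.pt j‖ ^ 2) := by
    intro s
    simp only [R, SeriesDatum.sum, hM, hc, hφ, betaDeriv_zero, smul_eq_mul, mul_one, distForm_sq]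
  by_cases hj : ∃ j, B.pt j = s₀
  · obtain ⟨j₀, hj₀⟩ := hj
    -- Injectivity of `pt` leaves a single singular term, and adding the logarithm turns it into the
    -- smooth function `betaReg` of |s − s₀|².
    refine ⟨fun s => R s + betaReg (‖s - s₀‖ ^ 2), hR.add ?_, Eventually.of_forall fun s hs => ?_⟩
    · have h1 : ContDiff ℝ ∞ fun s : ℂ => ‖s - s₀‖ ^ 2 :=
        (contDiff_norm_sq ℝ).comp (contDiff_id.sub contDiff_const)
      exact (contDiff_betaReg.comp h1).contDiffAt
    · change _ = R s + _
      rw [if_pos ⟨j₀, hj₀⟩, hRs]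
      have hpos : 0 < ‖s - s₀‖ ^ 2 := by
        have := norm_pos_iff.2 (sub_ne_zero.2 (hj₀ ▸ (hs j₀).symm))
        positivity
      rw [← beta1_add_log hpos, ← add_assoc]
      congr 1
      have h2 : {j | B.pt j ≠ s₀}ᶜ = {j₀} := by
        ext j
        simp only [mem_compl_iff, mem_ofPred_eq, not_not, mem_singleton_iff]
        exact ⟨fun h => B.pt_injective (h.trans hj₀.symm), fun h => h ▸ hj₀⟩
      have hS := B.summable_beta1 hs
      have h3 := hS.tsum_subtype_add_tsum_subtype_compl {j | B.pt j ≠ s₀}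
      rw [h2, tsum_singleton j₀ (fun j => beta1 (‖s - B.pt j‖ ^ 2)), hj₀] at h3
      exact h3.symm
  · refine ⟨R, hR, Eventually.of_forall fun s hs => ?_⟩
    rw [if_neg hj, hRs, add_zero]
    push Not at hj
    have h3 := tsum_subtype_eq_of_support_subset (f := fun j => beta1 (‖s - B.pt j‖ ^ 2))
      (s := {j | B.pt j ≠ s₀}) fun j _ => hj j
    exact h3.symm

end LatticeBasis
end KudlaCusp

/-! ### Extending the factorization of a local equation across the boundary divisor. -/

namespace KudlaCusp
open Set Filter

section Factorization

variable {N : ℕ}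

/-- A nonconstant affine function on `ℂ^{N+1}` which does not depend on the coordinate `0`. -/
def IsHorizontal (Ψ : (Fin (N + 1) → ℂ) → ℂ) : Prop :=
  ∃ L : (Fin (N + 1) → ℂ) →L[ℂ] ℂ, L ≠ 0 ∧ L (Pi.single 0 1) = 0 ∧ ∀ x y, Ψ x = Ψ y + L (x - y)

theorem IsHorizontal.contDiff {Ψ : (Fin (N + 1) → ℂ) → ℂ} (h : IsHorizontal Ψ) : ContDiff ℂ ∞ Ψ := by
  obtain ⟨L, -, -, hL⟩ := h
  rw [show Ψ = fun x => Ψ 0 + L (x - 0) from funext fun x => hL x 0]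
  fun_prop

theorem IsHorizontal.dense_ne_zero {Ψ : (Fin (N + 1) → ℂ) → ℂ} (h : IsHorizontal Ψ) :
    Dense {x | Ψ x ≠ 0} := by
  intro x
  obtain ⟨L, hL0, -, hL⟩ := h
  by_cases hx : Ψ x = 0
  · obtain ⟨v, hv⟩ : ∃ v, L v ≠ 0 := by
      by_contra! H
      exact hL0 (ContinuousLinearMap.ext H)
    have ht : Tendsto (fun t : ℂ => x + t • v) (𝓝[≠] 0) (𝓝 x) := by
      have : Tendsto (fun t : ℂ => x + t • v) (𝓝 0) (𝓝 (x + (0 : ℂ) • v)) :=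
        (by fun_prop : Continuous fun t : ℂ => x + t • v).tendsto 0
      rw [zero_smul, add_zero] at this
      exact this.mono_left nhdsWithin_le_nhds
    refine mem_closure_of_tendsto ht ?_
    filter_upwards [self_mem_nhdsWithin] with t ht
    have ht : t ≠ 0 := ht
    simp [hL (x + t • v) x, hx, hv, ht]
  · exact subset_closure hx

theorem dense_prod_ne_zero {I : Type*} (G : Finset I) {Ψ : I → (Fin (N + 1) → ℂ) → ℂ}
    (h : ∀ f ∈ G, IsHorizontal (Ψ f)) : Dense {x | ∏ f ∈ G, Ψ f x ≠ 0} := by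
  classical
  induction G using Finset.induction_on with
  | empty => simp
  | insert f G hf ih =>
    have h1 := (h f (Finset.mem_insert_self f G))
    have h2 := h1.dense_ne_zero.inter_of_isOpen_left
      (ih fun g hg => h g (Finset.mem_insert_of_mem hg))
      (isOpen_ne_fun h1.contDiff.continuous continuous_const)
    convert h2 using 1
    ext x
    simp [Finset.prod_insert hf]

/-- Cancellation of a product of nonconstant affine functions. -/
theorem eq_of_mul_prod_eq {I : Type*} {G : Finset I} {Ψ : I → (Fin (N + 1) → ℂ) → ℂ}
    (h : ∀ f ∈ G, IsHorizontal (Ψ f)) {α β : (Fin (N + 1) → ℂ) → ℂ} {x : Fin (N + 1) → ℂ}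
    (hα : ContinuousAt α x) (hβ : ContinuousAt β x)
    (heq : ∀ᶠ y in 𝓝 x, α y * ∏ f ∈ G, Ψ f y = β y * ∏ f ∈ G, Ψ f y) : α x = β x := by
  by_contra hne
  have h1 : ∀ᶠ y in 𝓝 x, α y - β y ≠ 0 :=
    (hα.sub hβ).eventually_ne (sub_ne_zero.2 hne)
  have h2 : ∃ᶠ y in 𝓝 x, ∏ f ∈ G, Ψ f y ≠ 0 := mem_closure_iff_frequently.1 (dense_prod_ne_zero G h x)
  obtain ⟨y, hy, h3, h4⟩ := (h2.and_eventually (h1.and heq)).exists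
  exact h3 (sub_eq_zero.2 (mul_right_cancel₀ hy h4))

/-- Near a point of `{x 0 = 0}` on which it does not vanish identically, a holomorphic function
which factors off this divisor into a unit and horizontal affine functions has such a
factorization. -/
theorem exists_factorization {I : Type*} [DecidableEq I] {Ψ : I → (Fin (N + 1) → ℂ) → ℂ}
    {ψ : (Fin (N + 1) → ℂ) → ℂ} {p : Fin (N + 1) → ℂ} (hp : p 0 = 0) {F : Finset I}
    (hF : ∀ f ∈ F, IsHorizontal (Ψ f)) (hFp : ∀ f ∈ F, Ψ f p = 0)
    (hψ : ∀ᶠ x in 𝓝 p, ContDiffAt ℂ ∞ ψ x)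
    (hloc : ∀ᶠ x in 𝓝 p, x 0 ≠ 0 → ∃ φ : (Fin (N + 1) → ℂ) → ℂ, ContinuousAt φ x ∧ φ x ≠ 0 ∧
      ∀ᶠ y in 𝓝 x, ψ y = φ y * ∏ f ∈ F with Ψ f x = 0, Ψ f y)
    (hfr : ∃ᶠ x in 𝓝[{x | x 0 = 0}] p, ψ x ≠ 0) :
    ∃ φ : (Fin (N + 1) → ℂ) → ℂ, ContDiffAt ℂ ∞ φ p ∧ φ p ≠ 0 ∧
      ∀ᶠ y in 𝓝 p, ψ y = φ y * ∏ f ∈ F, Ψ f y := by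
  -- The factors are divided out one at a time.
  have key : ∀ G ⊆ F, ∃ φ : (Fin (N + 1) → ℂ) → ℂ, (∀ᶠ x in 𝓝 p, ContDiffAt ℂ ∞ φ x) ∧
      ∀ᶠ y in 𝓝 p, ψ y = φ y * ∏ f ∈ G, Ψ f y := by
    intro G
    induction G using Finset.induction_on with
    | empty => exact fun _ => ⟨ψ, hψ, by simp⟩
    | insert f G hfG ih =>
      intro hsub
      have hfF : f ∈ F := hsub (Finset.mem_insert_self f G)
      have hGF : G ⊆ F := (Finset.subset_insert f G).trans hsub
      obtain ⟨φ, hφ, hφψ⟩ := ih hGF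
      obtain ⟨L, hL0, hLs, hL⟩ := hF f hfF
      have hΨL : ∀ x, Ψ f x = L (x - p) := fun x => by rw [hL x p, hFp f hfF, zero_add]
      -- Off the boundary, the partial quotient φ is compared with the given local factorization.
      -- After cancelling the factors common to G and Fx, the factor with index f survives on the
      -- right, while the uncancelled ones on the left do not vanish at x.
      have hoff : ∀ᶠ x in 𝓝 p, x 0 ≠ 0 → Ψ f x = 0 → φ x = 0 := by
        filter_upwards [hφ, hloc, eventually_eventually_nhds.2 hφψ] with x h1 h2 h3 hx0 hfx
        obtain ⟨φ', hφ'c, -, hφ'⟩ := h2 hx0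
        set Fx := F.filter fun f => Ψ f x = 0 with hFx
        have hcont : ∀ (H : Finset I), H ⊆ F → ContinuousAt (fun y => ∏ f ∈ H, Ψ f y) x := by
          intro H hH
          exact tendsto_finsetProd _ fun g hg => (hF g (hH hg)).contDiff.continuous.continuousAt
        have hFxF : Fx ⊆ F := Finset.filter_subset _ _
        have := eq_of_mul_prod_eq (G := G ∩ Fx) (Ψ := Ψ) (x := x)
          (α := fun y => φ y * ∏ f ∈ G \ Fx, Ψ f y) (β := fun y => φ' y * ∏ f ∈ Fx \ G, Ψ f y)
          (fun g hg => hF g (hGF (Finset.inter_subset_left hg)))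
          (h1.continuousAt.mul (hcont _ (Finset.sdiff_subset.trans hGF)))
          (hφ'c.mul (hcont _ (Finset.sdiff_subset.trans hFxF))) ?_
        · have hz : ∏ f ∈ Fx \ G, Ψ f x = 0 := Finset.prod_eq_zero (i := f)
            (by simp [hFx, hfF, hfx, hfG]) hfx
          rw [hz, mul_zero, mul_eq_zero] at this
          refine this.resolve_right (Finset.prod_ne_zero_iff.2 fun g hg => ?_)
          simp only [hFx, Finset.mem_sdiff, Finset.mem_filter, not_and] at hg
          exact hg.2 (hGF hg.1)
        · filter_upwards [hφ', h3] with y e1 e2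
          have e3 : (∏ f ∈ G \ Fx, Ψ f y) * ∏ f ∈ G ∩ Fx, Ψ f y = ∏ f ∈ G, Ψ f y := by
            rw [mul_comm]; exact Finset.prod_inter_mul_prod_sdiff G Fx _
          have e4 : (∏ f ∈ Fx \ G, Ψ f y) * ∏ f ∈ G ∩ Fx, Ψ f y = ∏ f ∈ Fx, Ψ f y := by
            rw [mul_comm, Finset.inter_comm]; exact Finset.prod_inter_mul_prod_sdiff Fx G _
          rw [mul_assoc, mul_assoc, e3, e4, ← e1, ← e2]
      -- The vanishing passes to boundary points by continuity: as L does not involve coordinate 0,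
      -- moving x in that direction leaves the boundary but stays in the zero set of L.
      have hzero : ∀ᶠ x in 𝓝 p, L (x - p) = 0 → φ x = 0 := by
        filter_upwards [hoff, eventually_eventually_nhds.2 hoff, hφ] with x h1 h2 h3 hx
        rw [← hΨL] at hx
        by_cases hx0 : x 0 = 0
        · have ht : Tendsto (fun t : ℂ => x + t • (Pi.single 0 1 : Fin (N + 1) → ℂ)) (𝓝[≠] 0) (𝓝 x) := by
            have : Tendsto (fun t : ℂ => x + t • (Pi.single 0 1 : Fin (N + 1) → ℂ)) (𝓝 0)
                (𝓝 (x + (0 : ℂ) • (Pi.single 0 1 : Fin (N + 1) → ℂ))) :=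
              (by fun_prop : Continuous fun t : ℂ => x + t • (Pi.single 0 1 : Fin (N + 1) → ℂ)).tendsto 0
            rw [zero_smul, add_zero] at this
            exact this.mono_left nhdsWithin_le_nhds
          refine tendsto_nhds_unique (h3.continuousAt.tendsto.comp ht) ?_
          refine tendsto_const_nhds.congr' ?_
          filter_upwards [ht.eventually h2, self_mem_nhdsWithin] with t h4 ht0
          have ht0 : t ≠ 0 := ht0
          refine (h4 (by simpa [hx0] using ht0) ?_).symm
          rw [hL _ x, hx]
          simp [hLs]
        · exact h1 hx0 hx
      obtain ⟨φ', hφ', hmul⟩ := exists_eq_linear_mul hφ hL0 hzero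
      refine ⟨φ', hφ', ?_⟩
      filter_upwards [hmul, hφψ] with y h1 h2
      rw [h2, h1, Finset.prod_insert hfG, ← hΨL]
      ring
  obtain ⟨φ, hφ, hφψ⟩ := key F subset_rfl
  refine ⟨φ, hφ.self_of_nhds, ?_, hφψ⟩
  -- The quotient has no zero off the boundary by comparison with the local units, and is not
  -- identically zero on it because ψ is not.
  refine ne_zero_of_frequently_ne_zero hp hφ ?_ ?_
  · filter_upwards [hφ, hloc, eventually_eventually_nhds.2 hφψ] with x h1 h2 h3 hx0
    obtain ⟨φ', hφ'c, hφ'0, hφ'⟩ := h2 hx0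
    set Fx := F.filter fun f => Ψ f x = 0 with hFx
    have hFxF : Fx ⊆ F := Finset.filter_subset _ _
    have := eq_of_mul_prod_eq (G := Fx) (Ψ := Ψ) (x := x)
      (α := fun y => φ y * ∏ f ∈ F \ Fx, Ψ f y) (β := φ')
      (fun g hg => hF g (hFxF hg))
      (h1.continuousAt.mul (tendsto_finsetProd _ fun g hg =>
        (hF g (Finset.sdiff_subset hg)).contDiff.continuous.continuousAt)) hφ'c ?_
    · intro h0
      simp only [h0, zero_mul] at this
      exact hφ'0 this.symm
    · filter_upwards [hφ', h3] with y e1 e2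
      rw [mul_assoc, Finset.prod_sdiff hFxF, ← e1, ← e2]
  · refine (hfr.and_eventually (mem_nhdsWithin_of_mem_nhds hφψ)).mono fun x hx h0 => hx.1 ?_
    rw [hx.2, h0, zero_mul]

end Factorization

end KudlaCusp

/-! ### Weighted bounds for first and second derivatives. -/

namespace KudlaCusp
open Set Filter

section Controlled

variable {E F G : Type*} [NormedAddCommGroup E] [NormedSpace ℝ E] [NormedAddCommGroup F]
  [NormedSpace ℝ F] [NormedAddCommGroup G] [NormedSpace ℝ G]

theorem fderiv_fderiv_comp_apply {g : E → F} {T : F → G} {x : E} (hg : ContDiffAt ℝ 2 g x)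
    (hT : ContDiffAt ℝ 2 T (g x)) (h h' : E) :
    fderiv ℝ (fderiv ℝ (T ∘ g)) x h h' =
      fderiv ℝ (fderiv ℝ T) (g x) (fderiv ℝ g x h) (fderiv ℝ g x h') +
        fderiv ℝ T (g x) (fderiv ℝ (fderiv ℝ g) x h h') := by
  have h1 : fderiv ℝ (T ∘ g) =ᶠ[𝓝 x] fun y => (fderiv ℝ T (g y)).comp (fderiv ℝ g y) := by
    filter_upwards [hg.eventually (by simp), hg.continuousAt.eventually (hT.eventually (by simp))] with y hy hTy
    exact fderiv_comp y (hTy.differentiableAt (by norm_num)) (hy.differentiableAt (by norm_num))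
  have d1 : HasFDerivAt (fderiv ℝ T) (fderiv ℝ (fderiv ℝ T) (g x)) (g x) :=
    ((hT.fderiv_right (m := 1) (by norm_num)).differentiableAt (by norm_num)).hasFDerivAt
  have d2 : HasFDerivAt (fderiv ℝ g) (fderiv ℝ (fderiv ℝ g) x) x :=
    ((hg.fderiv_right (m := 1) (by norm_num)).differentiableAt (by norm_num)).hasFDerivAt
  have d3 : HasFDerivAt g (fderiv ℝ g x) x := (hg.differentiableAt (by norm_num)).hasFDerivAt
  have d4 := (d1.comp x d3).clm_comp d2
  have d5 : HasFDerivAt (fun y => (fderiv ℝ T (g y)).comp (fderiv ℝ g y)) _ x := d4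
  rw [h1.fderiv_eq, d5.fderiv]
  simp [add_comm]

/-- Bounds for the first two derivatives of `g` at `x`, in terms of a weight for tangent vectors. -/
structure Controlled (g : E → F) (x : E) (w : E → ℝ) (C : ℝ) : Prop where
  contDiffAt : ContDiffAt ℝ ∞ g x
  nonneg : 0 ≤ C
  fderiv_le : ∀ h, ‖fderiv ℝ g x h‖ ≤ C * w h
  fderiv_fderiv_le : ∀ h h', ‖fderiv ℝ (fderiv ℝ g) x h h'‖ ≤ C * w h * w h'

namespace Controlled

variable {g g₁ g₂ : E → F} {x : E} {w : E → ℝ} {C C₁ C₂ : ℝ}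

theorem add (h₁ : Controlled g₁ x w C₁) (h₂ : Controlled g₂ x w C₂) :
    Controlled (fun y => g₁ y + g₂ y) x w (C₁ + C₂) := by
  have two : (2 : WithTop ℕ∞) ≤ ∞ := WithTop.coe_le_coe.2 le_top
  have c1 : ContDiffAt ℝ 2 g₁ x := h₁.contDiffAt.of_le two
  have c2 : ContDiffAt ℝ 2 g₂ x := h₂.contDiffAt.of_le two
  have h : fderiv ℝ (fun y => g₁ y + g₂ y) =ᶠ[𝓝 x] fun y => fderiv ℝ g₁ y + fderiv ℝ g₂ y := by
    filter_upwards [c1.eventually (by simp), c2.eventually (by simp)] with y h1 h2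
    exact fderiv_add (h1.differentiableAt (by norm_num)) (h2.differentiableAt (by norm_num))
  have d1 := (c1.fderiv_right (m := 1) (by norm_num)).differentiableAt (by norm_num)
  have d2 := (c2.fderiv_right (m := 1) (by norm_num)).differentiableAt (by norm_num)
  refine ⟨h₁.contDiffAt.add h₂.contDiffAt, add_nonneg h₁.nonneg h₂.nonneg, fun v => ?_, fun v v' => ?_⟩
  · rw [h.self_of_nhds, add_mul]
    exact (norm_add_le _ _).trans (add_le_add (h₁.fderiv_le v) (h₂.fderiv_le v))
  · rw [h.fderiv_eq, fderiv_fun_add d1 d2, add_mul, add_mul]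
    exact (norm_add_le _ _).trans (add_le_add (h₁.fderiv_fderiv_le v v') (h₂.fderiv_fderiv_le v v'))

/-- The second derivative of a composite is T'' applied to two first derivatives of g, giving εC²,
plus T' applied to the second derivative, giving εC. -/
theorem comp {T : F → G} {ε : ℝ} (hg : Controlled g x w C) (hw : ∀ h, 0 ≤ w h)
    (hT : ContDiffAt ℝ ∞ T (g x)) (h1 : ‖fderiv ℝ T (g x)‖ ≤ ε)
    (h2 : ‖fderiv ℝ (fderiv ℝ T) (g x)‖ ≤ ε) :
    Controlled (T ∘ g) x w (ε * (C ^ 2 + C)) := by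
  have two : (2 : WithTop ℕ∞) ≤ ∞ := WithTop.coe_le_coe.2 le_top
  have hε : 0 ≤ ε := (norm_nonneg _).trans h1
  have hC := hg.nonneg
  refine ⟨hT.comp x hg.contDiffAt, by positivity, fun v => ?_, fun v v' => ?_⟩
  · have hv := hw v
    rw [fderiv_comp x (hT.differentiableAt (by simp)) (hg.contDiffAt.differentiableAt (by simp))]
    calc _ ≤ ‖fderiv ℝ T (g x)‖ * ‖fderiv ℝ g x v‖ := ContinuousLinearMap.le_opNorm _ _
      _ ≤ ε * (C * w v) := by gcongr; exact hg.fderiv_le v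
      _ ≤ _ := by rw [mul_assoc]; gcongr; nlinarith [mul_nonneg (sq_nonneg C) hv]
  · have hv := hw v
    have hv' := hw v'
    rw [fderiv_fderiv_comp_apply (hg.contDiffAt.of_le two) (hT.of_le two)]
    refine (norm_add_le _ _).trans ?_
    calc _ ≤ ‖fderiv ℝ (fderiv ℝ T) (g x)‖ * ‖fderiv ℝ g x v‖ * ‖fderiv ℝ g x v'‖ +
          ‖fderiv ℝ T (g x)‖ * ‖fderiv ℝ (fderiv ℝ g) x v v'‖ :=
          add_le_add (ContinuousLinearMap.le_opNorm₂ _ _ _) (ContinuousLinearMap.le_opNorm _ _)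
      _ ≤ ε * (C * w v) * (C * w v') + ε * (C * w v * w v') := by
          gcongr
          · exact hg.fderiv_le v
          · exact hg.fderiv_le v'
          · exact hg.fderiv_fderiv_le v v'
      _ = _ := by ring

theorem clm_comp (A : F →L[ℝ] G) (hg : Controlled g x w C) (hw : ∀ h, 0 ≤ w h) :
    Controlled (fun y => A (g y)) x w (‖A‖ * (C ^ 2 + C)) := by
  refine hg.comp (T := A) hw A.contDiff.contDiffAt (by rw [A.fderiv]) ?_
  have : fderiv ℝ A = fun _ => A := funext fun y => A.fderiv
  rw [this, fderiv_fun_const]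
  change ‖(0 : F →L[ℝ] F →L[ℝ] G)‖ ≤ _
  rw [ContinuousLinearMap.opNorm_zero]
  exact norm_nonneg A

theorem weight_mono {w' : E → ℝ} {M : ℝ} (hg : Controlled g x w C) (hw : ∀ h, 0 ≤ w h)
    (hM : 0 ≤ M) (hww' : ∀ h, w h ≤ M * w' h) (hw' : ∀ h, 0 ≤ w' h) :
    Controlled g x w' (C * (M ^ 2 + M)) := by
  have hC := hg.nonneg
  refine ⟨hg.contDiffAt, by positivity, fun v => (hg.fderiv_le v).trans ?_,
    fun v v' => (hg.fderiv_fderiv_le v v').trans ?_⟩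
  · have := hw' v
    rw [mul_assoc]
    gcongr
    nlinarith [hww' v, mul_nonneg (sq_nonneg M) this]
  · have h1 := hw' v
    have h2 := hw' v'
    have h3 := mul_le_mul (hww' v) (hww' v') (hw v') (by positivity)
    rw [mul_assoc]
    refine (mul_le_mul_of_nonneg_left h3 hC).trans ?_
    nlinarith [mul_nonneg (mul_nonneg hC hM) (mul_nonneg h1 h2)]

theorem mono {C' : ℝ} (hg : Controlled g x w C) (hw : ∀ h, 0 ≤ w h) (hC : C ≤ C') :
    Controlled g x w C' := by
  refine ⟨hg.contDiffAt, hg.nonneg.trans hC, fun v => (hg.fderiv_le v).trans ?_,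
    fun v v' => (hg.fderiv_fderiv_le v v').trans ?_⟩
  · have := hw v
    gcongr
  · have := hw v
    have := hw v'
    gcongr

theorem of_contDiffAt (hg : ContDiffAt ℝ ∞ g x) (hg' : ∀ᶠ y in 𝓝 x, ContDiffAt ℝ ∞ g y) :
    ∃ C, ∀ᶠ y in 𝓝 x, Controlled g y (fun h => ‖h‖) C := by
  have h1 : ContDiffAt ℝ ∞ (fderiv ℝ g) x := hg.fderiv_right (by norm_num)
  have h2 : ContDiffAt ℝ ∞ (fderiv ℝ (fderiv ℝ g)) x := h1.fderiv_right (by norm_num)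
  have h3 : ContinuousAt (fun y => ‖fderiv ℝ (fderiv ℝ g) y‖) x :=
    (continuous_norm (E := E →L[ℝ] E →L[ℝ] F)).continuousAt.comp h2.continuousAt
  refine ⟨max (‖fderiv ℝ g x‖ + 1) (‖fderiv ℝ (fderiv ℝ g) x‖ + 1), ?_⟩
  filter_upwards [hg', h1.continuousAt.norm.eventually_lt continuousAt_const (lt_add_one _),
    h3.eventually_lt continuousAt_const (lt_add_one _)] with y e0 e1 e2
  refine ⟨e0, ((norm_nonneg _).trans e1.le).trans (le_max_left _ _), fun v => ?_, fun v v' => ?_⟩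
  · exact (ContinuousLinearMap.le_opNorm _ _).trans
      (mul_le_mul_of_nonneg_right (e1.le.trans (le_max_left _ _)) (norm_nonneg _))
  · refine (ContinuousLinearMap.le_opNorm₂ _ _ _).trans ?_
    gcongr
    exact e2.le.trans (le_max_right _ _)

end Controlled

theorem hasFDerivAt_log_norm {z : ℂ} (hz : z ≠ 0) :
    HasFDerivAt (fun z : ℂ => Real.log ‖z‖) ((‖z‖ ^ 2)⁻¹ • innerSL ℝ z) z := by
  have hn : 0 < ‖z‖ := norm_pos_iff.2 hz
  have h1 : HasFDerivAt (fun z : ℂ => ‖z‖ ^ 2) (2 • innerSL ℝ z) z :=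
    (hasStrictFDerivAt_norm_sq z).hasFDerivAt
  have h2 := (h1.log (by positivity)).const_smul (1 / 2 : ℝ)
  have e1 : (fun z : ℂ => Real.log ‖z‖) = fun z : ℂ => (1 / 2 : ℝ) • Real.log (‖z‖ ^ 2) := by
    ext z
    rw [Real.log_pow, smul_eq_mul]
    push_cast
    ring
  have e2 : (‖z‖ ^ 2)⁻¹ • innerSL ℝ z = (1 / 2 : ℝ) • ((‖z‖ ^ 2)⁻¹ • (2 • innerSL ℝ z)) := by
    rw [← Nat.cast_smul_eq_nsmul ℝ, smul_smul, smul_smul]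
    congr 1
    push_cast
    ring
  rw [e1, e2]
  exact h2

theorem contDiffAt_log_norm {z : ℂ} (hz : z ≠ 0) : ContDiffAt ℝ ∞ (fun z : ℂ => Real.log ‖z‖) z :=
  (contDiffAt_norm ℝ hz).log (norm_ne_zero_iff.2 hz)

/-- The Hessian is ⟨h, h'⟩/|z|² − 2⟨z, h⟩⟨z, h'⟩/|z|⁴; the constant 3 is 1 + 2. -/
theorem controlled_log_norm {z : ℂ} (hz : z ≠ 0) :
    Controlled (fun z : ℂ => Real.log ‖z‖) z (fun h => ‖h‖ / ‖z‖) 3 := by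
  have hn : 0 < ‖z‖ := norm_pos_iff.2 hz
  refine ⟨contDiffAt_log_norm hz, by norm_num, fun h => ?_, fun h h' => ?_⟩
  · rw [(hasFDerivAt_log_norm hz).fderiv, smul_apply, innerSL_apply_apply, norm_smul,
      norm_inv, norm_pow, norm_norm]
    calc _ ≤ (‖z‖ ^ 2)⁻¹ * (‖z‖ * ‖h‖) := by gcongr; exact norm_inner_le_norm _ _
      _ = 1 * (‖h‖ / ‖z‖) := by field_simp
      _ ≤ _ := by gcongr; norm_num
  · have e : fderiv ℝ (fun z : ℂ => Real.log ‖z‖) =ᶠ[𝓝 z] fun z => (‖z‖ ^ 2)⁻¹ • innerSL ℝ z := by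
      filter_upwards [isOpen_ne.mem_nhds hz] with y hy using (hasFDerivAt_log_norm hy).fderiv
    have h1 : HasFDerivAt (fun z : ℂ => ‖z‖ ^ 2) (2 • innerSL ℝ z) z :=
      (hasStrictFDerivAt_norm_sq z).hasFDerivAt
    have h2 : HasFDerivAt (fun z : ℂ => (‖z‖ ^ 2)⁻¹) (-((‖z‖ ^ 2) ^ 2)⁻¹ • (2 • innerSL ℝ z)) z :=
      (hasDerivAt_inv (by positivity : ‖z‖ ^ 2 ≠ 0)).comp_hasFDerivAt z h1
    have h3 : HasFDerivAt (fun z : ℂ => innerSL ℝ z) (innerSL ℝ : ℂ →L[ℝ] ℂ →L[ℝ] ℝ) z :=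
      (innerSL ℝ : ℂ →L[ℝ] ℂ →L[ℝ] ℝ).hasFDerivAt
    have h4 : HasFDerivAt (fun z : ℂ => (‖z‖ ^ 2)⁻¹ • (innerSL ℝ : ℂ →L[ℝ] ℂ →L[ℝ] ℝ) z) _ z := h2.smul h3
    have e3 : fderiv ℝ (fun z : ℂ => (‖z‖ ^ 2)⁻¹ • innerSL ℝ z) z h h' =
        (‖z‖ ^ 2)⁻¹ * inner ℝ h h' + -((‖z‖ ^ 2) ^ 2)⁻¹ * (2 * inner ℝ z h) * inner ℝ z h' := by
      rw [h4.fderiv]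
      have e0 : innerSL ℝ h h' = h.re * h'.re + h.im * h'.im := by
        rw [innerSL_apply_apply, Complex.inner]
        simp
        ring
      simp
      erw [e0]
      ring
    rw [e.fderiv_eq, e3]
    refine (norm_add_le _ _).trans ?_
    have i1 := norm_inner_le_norm (𝕜 := ℝ) h h'
    have i2 := norm_inner_le_norm (𝕜 := ℝ) z h
    have i3 := norm_inner_le_norm (𝕜 := ℝ) z h'
    simp only [norm_mul, norm_neg, norm_inv, norm_pow, norm_norm, Real.norm_ofNat]
    calc _ ≤ (‖z‖ ^ 2)⁻¹ * (‖h‖ * ‖h'‖) + ((‖z‖ ^ 2) ^ 2)⁻¹ * (2 * (‖z‖ * ‖h‖)) * (‖z‖ * ‖h'‖) := by gcongr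
      _ = _ := by field_simp; ring

end Controlled

end KudlaCusp

/-! ### Control of the dual sum near the cusp. -/

namespace KudlaCusp
open Set Filter

section CuspGrowth

variable {N : ℕ}

theorem Controlled.comp_clm {E F G : Type*} [NormedAddCommGroup E] [NormedSpace ℝ E]
    [NormedAddCommGroup F] [NormedSpace ℝ F] [NormedAddCommGroup G] [NormedSpace ℝ G]
    {g : F → G} (A : E →L[ℝ] F) {x : E} {w : F → ℝ} {C : ℝ} (hg : Controlled g (A x) w C) :
    Controlled (fun y => g (A y)) x (fun h => w (A h)) C := by
  have two : (2 : WithTop ℕ∞) ≤ ∞ := WithTop.coe_le_coe.2 le_top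
  refine ⟨hg.contDiffAt.comp x A.contDiff.contDiffAt, hg.nonneg, fun h => ?_, fun h h' => ?_⟩
  · have := fderiv_comp x (hg.contDiffAt.differentiableAt (by simp)) A.differentiableAt
    rw [A.fderiv] at this
    change ‖fderiv ℝ (g ∘ A) x h‖ ≤ _
    rw [this]
    exact hg.fderiv_le _
  · have := fderiv_fderiv_comp_apply A.contDiff.contDiffAt (hg.contDiffAt.of_le two) h h'
    change ‖fderiv ℝ (fderiv ℝ (g ∘ A)) x h h'‖ ≤ _
    have e : fderiv ℝ A = fun _ => A := funext fun y => A.fderiv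
    rw [this, e, fderiv_fun_const]
    simpa using hg.fderiv_fderiv_le (A h) (A h')

/-- The size of a tangent vector at `x` for a metric with Poincaré growth along `x 0 = 0`. -/
def cuspWeight (x h : Fin (N + 1) → ℂ) : ℝ := ‖h 0‖ / (‖x 0‖ * |Real.log ‖x 0‖|) + ‖h‖

theorem cuspWeight_nonneg (x h : Fin (N + 1) → ℂ) : 0 ≤ cuspWeight x h := by
  unfold cuspWeight; positivity

theorem norm_le_cuspWeight (x h : Fin (N + 1) → ℂ) : ‖h‖ ≤ cuspWeight x h := by
  unfold cuspWeight
  linarith [show 0 ≤ ‖h 0‖ / (‖x 0‖ * |Real.log ‖x 0‖|) by positivity]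

theorem eventually_log_norm_le {p : Fin (N + 1) → ℂ} (hp : p 0 = 0) (M : ℝ) :
    ∀ᶠ x in 𝓝 p, x 0 ≠ 0 → Real.log ‖x 0‖ ≤ -M := by
  have h : ContinuousAt (fun x : Fin (N + 1) → ℂ => ‖x 0‖) p :=
    (continuous_apply 0).norm.continuousAt
  have h0 : ‖p 0‖ < Real.exp (-M) := by rw [hp, norm_zero]; positivity
  filter_upwards [h.eventually_lt continuousAt_const h0] with x hx h0
  rw [Real.log_le_iff_le_exp (norm_pos_iff.2 h0)]
  exact hx.le

theorem controlled_log_coord {x : Fin (N + 1) → ℂ} (hx : x 0 ≠ 0) :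
    Controlled (fun y : Fin (N + 1) → ℂ => Real.log ‖y 0‖) x
      (fun h => ‖h 0‖ / ‖x 0‖) 3 :=
  Controlled.comp_clm (g := fun z : ℂ => Real.log ‖z‖) (w := fun h : ℂ => ‖h‖ / ‖x 0‖)
    (ContinuousLinearMap.proj (R := ℝ) (φ := fun _ : Fin (N + 1) => ℂ) 0) (controlled_log_norm hx)

theorem pow_four_mul_exp_le {c t : ℝ} (hc : 0 < c) (ht : 0 ≤ t) :
    t ^ 4 * Real.exp (-(c * t)) ≤ 24 / c ^ 4 := by
  have h := Real.pow_div_factorial_le_exp (c * t) (by positivity) 4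
  rw [Real.exp_neg, ← div_eq_mul_inv, div_le_div_iff₀ (Real.exp_pos _) (by positivity)]
  have : ((4).factorial : ℝ) = 24 := by norm_num [Nat.factorial]
  rw [this] at h
  calc t ^ 4 * c ^ 4 = 24 * ((c * t) ^ 4 / 24) := by ring
    _ ≤ _ := by gcongr

variable (B : LatticeBasis)

/-- Relative to `cuspWeight`, the inner map loses powers of t = |log|x 0||. Its second component is
at least a constant plus |a|t, so the exponential decay of `dualSum` and its derivatives outweighs
any such power. -/
theorem LatticeBasis.controlled_dualSum {S : (Fin (N + 1) → ℂ) → ℂ × ℝ} (hS : ContDiff ℝ ∞ S)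
    {a : ℝ} (ha : a < 0) {p : Fin (N + 1) → ℂ} (hp : p 0 = 0) :
    ∃ C, ∀ᶠ x in 𝓝 p, x 0 ≠ 0 →
      ‖B.dualSum (S x + (0, a * Real.log ‖x 0‖))‖ ≤ C ∧
      0 < (S x + (0, a * Real.log ‖x 0‖)).2 ∧
      Controlled (fun y => B.dualSum (S y + (0, a * Real.log ‖y 0‖))) x (cuspWeight x) C := by
  obtain ⟨K, b, hb, hdec⟩ := B.exists_dualSum_decay
  obtain ⟨C₁, hC₁⟩ := Controlled.of_contDiffAt (hS.contDiffAt (x := p))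
    (Eventually.of_forall fun y => hS.contDiffAt)
  set A : ℝ →L[ℝ] ℂ × ℝ := (ContinuousLinearMap.id ℝ ℝ).smulRight ((0, a) : ℂ × ℝ) with hA
  set C₂ : ℝ := C₁ * (1 ^ 2 + 1) + ‖A‖ * (3 ^ 2 + 3) * (1 ^ 2 + 1) with hC₂
  set s₀ : ℝ := (S p).2 - 1 with hs₀
  -- Here 4C₂² + 2C₂ comes from bounding the polynomial in t of the composition rule by a multiple
  -- of t⁴, and 24/(b·(−a))⁴, with 24 = 4!, bounds t⁴ e^{-b|a|t}.
  set C₃ : ℝ := |K| * Real.exp (-b * s₀) * ((4 * C₂ ^ 2 + 2 * C₂) * (24 / (b * -a) ^ 4)) with hC₃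
  have hs : ∀ᶠ x in 𝓝 p, s₀ < (S x).2 := by
    have : ContinuousAt (fun x => (S x).2) p := (continuous_snd.comp hS.continuous).continuousAt
    exact continuousAt_const.eventually_lt this (by rw [hs₀]; linarith)
  refine ⟨max C₃ (|K| * Real.exp (-b)), ?_⟩
  filter_upwards [hC₁, hs, eventually_log_norm_le hp 1,
    eventually_log_norm_le hp ((1 - s₀) / (-a))] with x hx1 hxs hl hl2 hx0
  specialize hl hx0
  specialize hl2 hx0
  set t : ℝ := |Real.log ‖x 0‖| with ht
  have htl : t = -Real.log ‖x 0‖ := abs_of_nonpos (by linarith)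
  have ht1 : 1 ≤ t := by linarith
  have hxn : 0 < ‖x 0‖ := norm_pos_iff.2 hx0
  have hτ : s₀ + -a * t ≤ (S x + (0, a * Real.log ‖x 0‖)).2 := by
    rw [Prod.snd_add, htl]
    simp only
    nlinarith
  have hτ1 : 1 ≤ (S x + (0, a * Real.log ‖x 0‖)).2 := by
    refine le_trans ?_ hτ
    have : (1 - s₀) / (-a) ≤ t := by linarith
    rw [div_le_iff₀ (by linarith)] at this
    linarith
  obtain ⟨e0, e1, e2⟩ := hdec _ hτ1
  have c1 : Controlled S x (fun h => ‖h 0‖ / ‖x 0‖ + ‖h‖) (C₁ * (1 ^ 2 + 1)) :=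
    hx1.weight_mono (fun h => norm_nonneg h) zero_le_one
      (fun h => by rw [one_mul]; linarith [show 0 ≤ ‖h 0‖ / ‖x 0‖ by positivity])
      (fun h => by positivity)
  have c2 : Controlled (fun y : Fin (N + 1) → ℂ => ((0, a * Real.log ‖y 0‖) : ℂ × ℝ)) x
      (fun h => ‖h 0‖ / ‖x 0‖ + ‖h‖) (‖A‖ * (3 ^ 2 + 3) * (1 ^ 2 + 1)) := by
    have := ((controlled_log_coord hx0).clm_comp A (fun h => by positivity)).weight_mono
      (w' := fun h => ‖h 0‖ / ‖x 0‖ + ‖h‖) (fun h => by positivity) zero_le_one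
      (fun h => by rw [one_mul]; linarith [norm_nonneg h]) (fun h => by positivity)
    convert this using 2 with y
    ext <;> simp [hA, mul_comm]
  -- The exact ratio of |h 0|/|x 0| to its counterpart in `cuspWeight` is t, and t ≥ 1 takes care of
  -- the remaining summand.
  have c3 := (c1.add c2).weight_mono (w' := cuspWeight x) (M := t) (fun h => by positivity)
    (by positivity) (fun h => by
      unfold cuspWeight
      rw [mul_add, ← ht]
      refine add_le_add (le_of_eq ?_) (le_mul_of_one_le_left (norm_nonneg _) ht1)
      field_simp) (cuspWeight_nonneg x)
  have hdiff : ContDiffAt ℝ ∞ B.dualSum (S x + (0, a * Real.log ‖x 0‖)) :=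
    B.contDiffOn_dualSum.contDiffAt
      ((isOpen_lt continuous_const continuous_snd).mem_nhds (zero_lt_one.trans_le hτ1))
  have c4 := c3.comp (T := B.dualSum) (cuspWeight_nonneg x) hdiff e1 e2
  rw [← hC₂] at c4
  have hC₂0 : 0 ≤ C₂ := (c1.add c2).nonneg
  refine ⟨?_, zero_lt_one.trans_le hτ1, c4.mono (cuspWeight_nonneg x) (le_max_of_le_left ?_)⟩
  · refine le_max_of_le_right (e0.trans ?_)
    gcongr
    · exact le_abs_self K
    · nlinarith
  · have b1 : K * Real.exp (-b * (S x + (0, a * Real.log ‖x 0‖)).2) ≤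
        |K| * (Real.exp (-b * s₀) * Real.exp (-((b * -a) * t))) := by
      rw [← Real.exp_add]
      gcongr
      · exact le_abs_self K
      · nlinarith [mul_le_mul_of_nonneg_left hτ hb.le]
    have b2 : (C₂ * (t ^ 2 + t)) ^ 2 + C₂ * (t ^ 2 + t) ≤ (4 * C₂ ^ 2 + 2 * C₂) * t ^ 4 := by
      have i1 : t ^ 2 + t ≤ 2 * t ^ 2 := by nlinarith
      have i2 : t ^ 2 ≤ t ^ 4 := pow_le_pow_right₀ ht1 (by norm_num)
      have i3 : C₂ * (t ^ 2 + t) ≤ C₂ * (2 * t ^ 2) := by gcongr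
      have i4 : (C₂ * (t ^ 2 + t)) ^ 2 ≤ (C₂ * (2 * t ^ 2)) ^ 2 := by gcongr
      nlinarith [mul_le_mul_of_nonneg_left i2 hC₂0]
    calc _ ≤ |K| * (Real.exp (-b * s₀) * Real.exp (-((b * -a) * t))) *
          ((4 * C₂ ^ 2 + 2 * C₂) * t ^ 4) := by
            refine mul_le_mul b1 b2 (by positivity) (by positivity)
      _ = |K| * Real.exp (-b * s₀) * ((4 * C₂ ^ 2 + 2 * C₂) *
          (t ^ 4 * Real.exp (-((b * -a) * t)))) := by ring
      _ ≤ _ := by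
        rw [hC₃]
        gcongr
        exact pow_four_mul_exp_le (mul_pos hb (neg_pos.2 ha)) (by positivity)

end CuspGrowth

end KudlaCusp

/-! ### From weighted derivative bounds to log-log growth. -/

namespace KudlaCusp
open Set Filter

section LogLogGrowth

variable {N : ℕ}

/-- The factor `s_i` for which `s_i⁻¹ dp_i` is a generator of the log-log forms. -/
def cuspScale (i : Fin (N + 1)) (x : Fin (N + 1) → ℂ) : ℂ :=
  if i = 0 then x 0 * (Real.log ‖x 0‖ : ℂ) else 1

theorem log_norm_neg {z : ℂ} (h : ‖z‖ < 1) (hz : z ≠ 0) : Real.log ‖z‖ < 0 :=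
  Real.log_neg (norm_pos_iff.2 hz) h

theorem cuspScale_ne_zero (i : Fin (N + 1)) {x : Fin (N + 1) → ℂ} (h : ‖x 0‖ < 1) (hx : x 0 ≠ 0) :
    cuspScale i x ≠ 0 := by
  unfold cuspScale
  split_ifs
  · exact mul_ne_zero hx (Complex.ofReal_ne_zero.2 (log_norm_neg h hx).ne)
  · exact one_ne_zero

/-- In direction 0 the singular part of the weight contributes exactly 1, and the other part is |x 0
· log|x 0||, which is less than 1. In the other directions the product is 1. -/
theorem norm_cuspScale_mul_le (i : Fin (N + 1)) {x : Fin (N + 1) → ℂ} (h : ‖x 0‖ < 1)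
    (hx : x 0 ≠ 0) {c : ℂ} (hc : ‖c‖ = 1) :
    ‖cuspScale i x‖ * cuspWeight x (Pi.single i c) ≤ 2 := by
  have hn : 0 < ‖x 0‖ := norm_pos_iff.2 hx
  unfold cuspScale cuspWeight
  rw [Pi.norm_single, hc]
  split_ifs with hi
  · subst hi
    have hl := abs_pos.2 (log_norm_neg h hx).ne
    have := Real.abs_log_mul_self_lt ‖x 0‖ hn h.le
    rw [abs_mul, abs_norm, mul_comm] at this
    rw [Pi.single_eq_same, hc, norm_mul, Complex.norm_real, Real.norm_eq_abs, mul_add,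
      mul_one_div_cancel (by positivity)]
    linarith
  · rw [Pi.single_eq_of_ne' hi]
    simp

theorem contDiffAt_cuspScale (i : Fin (N + 1)) {x : Fin (N + 1) → ℂ} (hx : x 0 ≠ 0) :
    ContDiffAt ℝ ∞ (cuspScale i) x := by
  unfold cuspScale
  split_ifs
  · have h0 : ContDiffAt ℝ ∞ (fun y : Fin (N + 1) → ℂ => y 0) x :=
      (contDiff_apply ℝ ℂ 0).contDiffAt
    have h1 : ContDiffAt ℝ ∞ (fun y : Fin (N + 1) → ℂ => Real.log ‖y 0‖) x :=
      ContDiffAt.comp (g := fun z : ℂ => Real.log ‖z‖) x (contDiffAt_log_norm hx) h0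
    exact h0.mul (Complex.ofRealCLM.contDiff.contDiffAt.comp x h1)
  · exact contDiffAt_const

theorem norm_wirt_combination_le {a b : ℂ} {M : ℝ} (ha : ‖a‖ ≤ M) (hb : ‖b‖ ≤ M) :
    ‖(a - Complex.I * b) / 2‖ ≤ M ∧ ‖(a + Complex.I * b) / 2‖ ≤ M := by
  have h : ‖Complex.I * b‖ ≤ M := by simpa using hb
  constructor
  · rw [norm_div, Complex.norm_ofNat]
    linarith [norm_sub_le a (Complex.I * b)]
  · rw [norm_div, Complex.norm_ofNat]
    linarith [norm_add_le a (Complex.I * b)]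

variable {E : (Fin (N + 1) → ℂ) → ℂ} {x : Fin (N + 1) → ℂ} {C : ℝ}

theorem contDiffAt_fderiv_apply (hE : ContDiffAt ℝ ∞ E x) (h : Fin (N + 1) → ℂ) :
    ContDiffAt ℝ ∞ (fun y => fderiv ℝ E y h) x :=
  (hE.fderiv_right (m := ∞) (by norm_num)).clm_apply contDiffAt_const

theorem contDiffAt_wirt (hE : ContDiffAt ℝ ∞ E x) (i : Fin (N + 1)) :
    ContDiffAt ℝ ∞ (wirt i E) x :=
  ((contDiffAt_fderiv_apply hE _).sub
    (contDiffAt_const.mul (contDiffAt_fderiv_apply hE _))).div_const 2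

theorem contDiffAt_wirtBar (hE : ContDiffAt ℝ ∞ E x) (i : Fin (N + 1)) :
    ContDiffAt ℝ ∞ (wirtBar i E) x :=
  ((contDiffAt_fderiv_apply hE _).add
    (contDiffAt_const.mul (contDiffAt_fderiv_apply hE _))).div_const 2

theorem Controlled.norm_wirt_le (hE : Controlled E x (cuspWeight x) C) (i : Fin (N + 1))
    (h1 : ‖x 0‖ < 1) (hx : x 0 ≠ 0) : ‖wirt i E x * cuspScale i x‖ ≤ 2 * C ∧
      ‖wirtBar i E x * star (cuspScale i x)‖ ≤ 2 * C := by
  have hs : 0 < ‖cuspScale i x‖ := norm_pos_iff.2 (cuspScale_ne_zero i h1 hx)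
  have key : ∀ c : ℂ, ‖c‖ = 1 → ‖fderiv ℝ E x (Pi.single i c)‖ ≤ 2 * C / ‖cuspScale i x‖ := by
    intro c hc
    rw [le_div_iff₀ hs]
    have := norm_cuspScale_mul_le i h1 hx hc
    calc _ ≤ C * cuspWeight x (Pi.single i c) * ‖cuspScale i x‖ := by
          gcongr; exact hE.fderiv_le _
      _ = C * (‖cuspScale i x‖ * cuspWeight x (Pi.single i c)) := by ring
      _ ≤ C * 2 := mul_le_mul_of_nonneg_left this hE.nonneg
      _ = _ := mul_comm _ _
  obtain ⟨a, b⟩ := norm_wirt_combination_le (key 1 (by simp)) (key Complex.I (by simp))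
  rw [norm_mul, norm_mul, norm_star, ← le_div_iff₀ hs]
  exact ⟨a, by rw [← le_div_iff₀ hs]; exact b⟩

theorem fderiv_wirtBar (hE : ContDiffAt ℝ ∞ E x) (j : Fin (N + 1)) (h : Fin (N + 1) → ℂ) :
    fderiv ℝ (wirtBar j E) x h =
      (fderiv ℝ (fderiv ℝ E) x h (Pi.single j 1) +
        Complex.I * fderiv ℝ (fderiv ℝ E) x h (Pi.single j Complex.I)) / 2 := by
  have hd : HasFDerivAt (fderiv ℝ E) (fderiv ℝ (fderiv ℝ E) x) x :=
    ((hE.fderiv_right (m := ∞) (by norm_num)).differentiableAt (by simp)).hasFDerivAt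
  have h1 := fun c : ℂ => hd.clm_apply (hasFDerivAt_const (Pi.single j c : Fin (N + 1) → ℂ) x)
  have h2 := ((h1 1).add ((h1 Complex.I).const_mul Complex.I)).mul_const (2⁻¹ : ℂ)
  have h3 : HasFDerivAt (wirtBar j E) _ x := h2
  rw [h3.fderiv]
  simp
  ring

theorem Controlled.norm_wirt_wirtBar_le (hE : Controlled E x (cuspWeight x) C)
    (i j : Fin (N + 1)) (h1 : ‖x 0‖ < 1) (hx : x 0 ≠ 0) :
    ‖wirt i (wirtBar j E) x * (cuspScale i x * star (cuspScale j x))‖ ≤ 4 * C := by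
  have hs : 0 < ‖cuspScale i x‖ := norm_pos_iff.2 (cuspScale_ne_zero i h1 hx)
  have hs' : 0 < ‖cuspScale j x‖ := norm_pos_iff.2 (cuspScale_ne_zero j h1 hx)
  have key : ∀ c c' : ℂ, ‖c‖ = 1 → ‖c'‖ = 1 →
      ‖fderiv ℝ (fderiv ℝ E) x (Pi.single i c) (Pi.single j c')‖ ≤
        4 * C / (‖cuspScale i x‖ * ‖cuspScale j x‖) := by
    intro c c' hc hc'
    rw [le_div_iff₀ (by positivity)]
    have e1 := norm_cuspScale_mul_le i h1 hx hc
    have e2 := norm_cuspScale_mul_le j h1 hx hc'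
    have hC := hE.nonneg
    have w1 := cuspWeight_nonneg x (Pi.single i c)
    have w2 := cuspWeight_nonneg x (Pi.single j c')
    calc _ ≤ C * cuspWeight x (Pi.single i c) * cuspWeight x (Pi.single j c') *
            (‖cuspScale i x‖ * ‖cuspScale j x‖) := by
          gcongr; exact hE.fderiv_fderiv_le _ _
      _ = C * ((‖cuspScale i x‖ * cuspWeight x (Pi.single i c)) *
            (‖cuspScale j x‖ * cuspWeight x (Pi.single j c'))) := by ring
      _ ≤ C * (2 * 2) := by gcongr
      _ = _ := by ring
  have h2 : ∀ c : ℂ, ‖c‖ = 1 → ‖fderiv ℝ (wirtBar j E) x (Pi.single i c)‖ ≤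
      4 * C / (‖cuspScale i x‖ * ‖cuspScale j x‖) := by
    intro c hc
    rw [fderiv_wirtBar hE.contDiffAt]
    exact (norm_wirt_combination_le (key c 1 hc (by simp)) (key c Complex.I hc (by simp))).2
  have h3 := (norm_wirt_combination_le (h2 1 (by simp)) (h2 Complex.I (by simp))).1
  rw [norm_mul, norm_mul, norm_star, ← le_div_iff₀ (by positivity)]
  exact h3

variable {W : Set (Fin (N + 1) → ℂ)}

theorem scaled_dz_mem (i : Fin (N + 1)) :
    (fun p : W => (cuspScale i p.1)⁻¹ • dz i) ∈ Algebra.adjoin ℂ (logLogGenerators W) := by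
  refine Algebra.subset_adjoin ?_
  refine Fin.cases ?_ (fun j => ?_) i
  · exact Or.inl (Or.inl (Or.inl (Or.inl (by simp [cuspScale]))))
  · refine Or.inl (Or.inl (Or.inr ⟨j, ?_⟩))
    simp [cuspScale]

theorem scaled_dzbar_mem (i : Fin (N + 1)) :
    (fun p : W => (star (cuspScale i p.1))⁻¹ • dzbar i) ∈
      Algebra.adjoin ℂ (logLogGenerators W) := by
  refine Algebra.subset_adjoin ?_
  refine Fin.cases ?_ (fun j => ?_) i
  · refine Or.inl (Or.inl (Or.inl (Or.inr ?_)))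
    simp [cuspScale]
  · refine Or.inl (Or.inr ⟨j, ?_⟩)
    simp [cuspScale]

/-- Where log log |q⁻¹| ≥ 1, a bounded function is O(log log |q⁻¹|); no unbounded coefficients are
needed. -/
theorem bounded_mem {f : (Fin (N + 1) → ℂ) → ℂ} (hf : ContDiffOn ℝ ∞ f W) {C : ℝ}
    (hC : ∀ p ∈ W, ‖f p‖ ≤ C) (hl : ∀ p ∈ W, 1 ≤ Real.log (Real.log ‖p 0‖⁻¹)) :
    (fun p : W => algebraMap ℂ (Ext N) (f p.1)) ∈ Algebra.adjoin ℂ (logLogGenerators W) := by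
  refine Algebra.subset_adjoin (Or.inr ⟨f, hf, ⟨C, fun p hp => ?_⟩, rfl⟩)
  have := hC p hp
  nlinarith [hl p hp, norm_nonneg (f p)]

/-- A function whose first two derivatives are bounded for the Poincaré growth weight has
log-log derivatives. -/
theorem logLogGrowth_of_controlled {U : Set (Fin (N + 1) → ℂ)}
    (hE : ∀ p ∈ U, p 0 = 0 → ∃ C, ∀ᶠ x in 𝓝 p, x 0 ≠ 0 → Controlled E x (cuspWeight x) C) :
    LogLogGrowth U (del E) ∧ LogLogGrowth U (delBar E) ∧ LogLogGrowth U (delDelBar E) := by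
  have key : ∀ p ∈ U, p 0 = 0 → ∃ B : Set (Fin (N + 1) → ℂ), IsOpen B ∧ p ∈ B ∧
      (∀ x ∈ B, ‖x 0‖ < Real.exp (-1)) ∧
      (∀ x ∈ U ∩ B ∩ {x | x 0 ≠ 0}, 1 ≤ Real.log (Real.log ‖x 0‖⁻¹)) ∧
      ∃ C, ∀ x ∈ U ∩ B ∩ {x | x 0 ≠ 0}, Controlled E x (cuspWeight x) C := by
    intro p hp h0
    obtain ⟨C, hC⟩ := hE p hp h0
    have h : ContinuousAt (fun x : Fin (N + 1) → ℂ => ‖x 0‖) p :=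
      (continuous_apply 0).norm.continuousAt
    -- The radius e^{-3} makes log |q⁻¹| exceed 3 > e, hence log log |q⁻¹| ≥ 1.
    have h3 : ‖p 0‖ < Real.exp (-3) := by rw [h0, norm_zero]; positivity
    obtain ⟨B, hB, hBo, hpB⟩ := eventually_nhds_iff.1
      (hC.and (h.eventually_lt continuousAt_const h3))
    refine ⟨B, hBo, hpB, fun x hx => (hB x hx).2.trans (Real.exp_lt_exp.2 (by norm_num)),
      fun x hx => ?_, C, fun x hx => (hB x hx.1.2).1 hx.2⟩
    have hn : 0 < ‖x 0‖ := norm_pos_iff.2 hx.2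
    have h4 : Real.log ‖x 0‖ < -3 := (Real.log_lt_iff_lt_exp hn).2 (hB x hx.1.2).2
    rw [Real.log_inv, Real.le_log_iff_exp_le (by linarith)]
    linarith [Real.exp_one_lt_d9]
  have one : ∀ {z : ℂ}, ‖z‖ < Real.exp (-1) → ‖z‖ < 1 := fun h =>
    h.trans (Real.exp_lt_one_iff.2 (by norm_num))
  refine ⟨fun p hp h0 => ?_, fun p hp h0 => ?_, fun p hp h0 => ?_⟩
  all_goals
    obtain ⟨B, hBo, hpB, hB1, hll, C, hC⟩ := key p hp h0
    refine ⟨B, hBo, hpB, hB1, ?_⟩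
    have hs : ∀ x ∈ U ∩ B ∩ {x | x 0 ≠ 0}, ∀ i, ContDiffAt ℝ ∞ (cuspScale i) x :=
      fun x hx i => contDiffAt_cuspScale i hx.2
    have hs' : ∀ x ∈ U ∩ B ∩ {x | x 0 ≠ 0}, ∀ i, ContDiffAt ℝ ∞ (fun y => star (cuspScale i y)) x :=
      fun x hx i => (Complex.conjCLE.contDiff (n := ∞)).contDiffAt.comp x (hs x hx i)
    have hne : ∀ x ∈ U ∩ B ∩ {x | x 0 ≠ 0}, ∀ i, cuspScale i x ≠ 0 :=
      fun x hx i => cuspScale_ne_zero i (one (hB1 x hx.1.2)) hx.2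
  -- Each coefficient is multiplied by its scale and each differential divided by it: the former
  -- becomes bounded, the latter a generator.
  · have e : (fun x : ↥(U ∩ B ∩ {x | x 0 ≠ 0}) => del E x) =
        ∑ i, (fun p : ↥(U ∩ B ∩ {x | x 0 ≠ 0}) =>
          algebraMap ℂ (Ext N) (wirt i E p.1 * cuspScale i p.1)) *
          fun p => (cuspScale i p.1)⁻¹ • dz i := by
      ext1 x
      rw [Finset.sum_apply]
      refine Finset.sum_congr rfl fun i _ => ?_
      rw [Pi.mul_apply, ← Algebra.smul_def, smul_smul, mul_assoc,
        mul_inv_cancel₀ (hne x x.2 i), mul_one]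
    rw [e]
    refine Subalgebra.sum_mem _ fun i _ => Subalgebra.mul_mem _ ?_ (scaled_dz_mem i)
    exact bounded_mem (f := fun x => wirt i E x * cuspScale i x) (fun x hx =>
      ((contDiffAt_wirt (hC x hx).contDiffAt i).mul (hs x hx i)).contDiffWithinAt)
      (fun x hx => ((hC x hx).norm_wirt_le i (one (hB1 x hx.1.2)) hx.2).1) hll
  · have e : (fun x : ↥(U ∩ B ∩ {x | x 0 ≠ 0}) => delBar E x) =
        ∑ i, (fun p : ↥(U ∩ B ∩ {x | x 0 ≠ 0}) =>
          algebraMap ℂ (Ext N) (wirtBar i E p.1 * star (cuspScale i p.1))) *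
          fun p => (star (cuspScale i p.1))⁻¹ • dzbar i := by
      ext1 x
      rw [Finset.sum_apply]
      refine Finset.sum_congr rfl fun i _ => ?_
      rw [Pi.mul_apply, ← Algebra.smul_def, smul_smul, mul_assoc,
        mul_inv_cancel₀ (star_ne_zero.2 (hne x x.2 i)), mul_one]
    rw [e]
    refine Subalgebra.sum_mem _ fun i _ => Subalgebra.mul_mem _ ?_ (scaled_dzbar_mem i)
    exact bounded_mem (f := fun x => wirtBar i E x * star (cuspScale i x)) (fun x hx =>
      ((contDiffAt_wirtBar (hC x hx).contDiffAt i).mul (hs' x hx i)).contDiffWithinAt)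
      (fun x hx => ((hC x hx).norm_wirt_le i (one (hB1 x hx.1.2)) hx.2).2) hll
  · have e : (fun x : ↥(U ∩ B ∩ {x | x 0 ≠ 0}) => delDelBar E x) =
        ∑ i, ∑ j, (fun p : ↥(U ∩ B ∩ {x | x 0 ≠ 0}) =>
          algebraMap ℂ (Ext N) (wirt i (wirtBar j E) p.1 *
            (cuspScale i p.1 * star (cuspScale j p.1)))) *
          ((fun p => (cuspScale i p.1)⁻¹ • dz i) *
            fun p => (star (cuspScale j p.1))⁻¹ • dzbar j) := by
      ext1 x
      rw [Finset.sum_apply]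
      refine Finset.sum_congr rfl fun i _ => ?_
      rw [Finset.sum_apply]
      refine Finset.sum_congr rfl fun j _ => ?_
      have h1 := hne x x.2 i
      have h2 := star_ne_zero.2 (hne x x.2 j)
      rw [Pi.mul_apply, Pi.mul_apply, ← Algebra.smul_def, smul_mul_smul_comm, smul_smul]
      congr 1
      field_simp
    rw [e]
    refine Subalgebra.sum_mem _ fun i _ => Subalgebra.sum_mem _ fun j _ =>
      Subalgebra.mul_mem _ ?_ (Subalgebra.mul_mem _ (scaled_dz_mem i) (scaled_dzbar_mem j))
    exact bounded_mem (f := fun x => wirt i (wirtBar j E) x *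
        (cuspScale i x * star (cuspScale j x))) (fun x hx =>
      ((contDiffAt_wirt (contDiffAt_wirtBar (hC x hx).contDiffAt j) i).mul
        ((hs x hx i).mul (hs' x hx j))).contDiffWithinAt)
      (fun x hx => (hC x hx).norm_wirt_wirtBar_le i j (one (hB1 x hx.1.2)) hx.2) hll

end LogLogGrowth

end KudlaCusp

/-! ### Fractional ideals of an imaginary quadratic field as lattices in ℂ. -/

namespace KudlaCusp
open Set Filter Module

section ImaginaryQuadratic

variable {k : Type*} [Field k] [NumberField k] (ι : k →+* ℂ)

/-- A quadratic field has two complex embeddings; as ι is not real, they are ι and its conjugate,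
which have the same absolute value. -/
theorem norm_embedding_eq [NumberField.IsTotallyComplex k] (hquad : finrank ℚ k = 2)
    (φ : k →+* ℂ) (x : k) : ‖φ x‖ = ‖ι x‖ := by
  classical
  have hne : NumberField.ComplexEmbedding.conjugate ι ≠ ι := fun h =>
    NumberField.IsTotallyComplex.complexEmbedding_not_isReal ι
      (NumberField.ComplexEmbedding.isReal_iff.2 h)
  have hφ : φ = ι ∨ φ = NumberField.ComplexEmbedding.conjugate ι := by
    by_contra! h
    have h3 : ({φ, ι, NumberField.ComplexEmbedding.conjugate ι} : Finset (k →+* ℂ)).card = 3 :=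
      Finset.card_eq_three.2 ⟨_, _, _, h.1, h.2, hne.symm, rfl⟩
    have h4 := Finset.card_le_univ
      ({φ, ι, NumberField.ComplexEmbedding.conjugate ι} : Finset (k →+* ℂ))
    rw [h3, NumberField.Embeddings.card k ℂ, hquad] at h4
    omega
  rcases hφ with rfl | rfl
  · rfl
  · simp [NumberField.ComplexEmbedding.conjugate_coe_eq]

variable [NumberField.IsTotallyComplex k] (hquad : finrank ℚ k = 2)
include hquad

/-- A common denominator moves the elements into the ring of integers with all conjugates bounded,
and there are finitely many such integers. -/
theorem finite_fractional_norm_le {M : Submodule (𝓞 k) k} (hM : IsFractional (𝓞 k)⁰ M) (C : ℝ) :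
    {x | x ∈ M ∧ ‖ι x‖ ≤ C}.Finite := by
  obtain ⟨a, ha, h⟩ := hM
  have ha0 : (a : k) ≠ 0 := by
    have := nonZeroDivisors.ne_zero ha
    exact_mod_cast this
  have hf := NumberField.Embeddings.finite_of_norm_le k ℂ (‖ι a‖ * C)
  refine (hf.preimage (mul_right_injective₀ ha0).injOn).subset ?_
  rintro x ⟨hx, hxC⟩
  obtain ⟨y, hy⟩ := h x hx
  rw [Algebra.smul_def] at hy
  refine ⟨?_, fun φ => ?_⟩
  · change IsIntegral ℤ ((a : k) * x)
    rw [show (a : k) * x = (y : k) from hy.symm]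
    exact y.2
  · rw [norm_embedding_eq ι hquad φ, map_mul, norm_mul]
    gcongr

theorem exists_le_norm_sq {M : Submodule (𝓞 k) k} (hM : IsFractional (𝓞 k)⁰ M) :
    ∃ η : ℝ, 0 < η ∧ ∀ x ∈ M, x ≠ 0 → η ≤ ‖ι x‖ ^ 2 := by
  have hf := (finite_fractional_norm_le ι hquad hM 1).inter_of_left {x | x ≠ 0}
  by_cases hne : ({x | x ∈ M ∧ ‖ι x‖ ≤ 1} ∩ {x | x ≠ 0}).Nonempty
  · obtain ⟨x₀, hx₀, hmin⟩ := Set.exists_min_image _ (fun x => ‖ι x‖ ^ 2) hf hne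
    refine ⟨‖ι x₀‖ ^ 2, ?_, fun x hx h0 => ?_⟩
    · have : ι x₀ ≠ 0 := (map_ne_zero ι).2 hx₀.2
      positivity
    · by_cases h1 : ‖ι x‖ ≤ 1
      · exact hmin x ⟨⟨hx, h1⟩, h0⟩
      · have := hx₀.1.2
        push Not at h1
        gcongr
        exact this.trans h1.le
  · refine ⟨1, one_pos, fun x hx h0 => ?_⟩
    by_contra! h
    exact hne ⟨x, ⟨hx, by nlinarith [norm_nonneg (ι x)]⟩, h0⟩

omit hquad in
theorem exists_latticeBasis (hquad : finrank ℚ k = 2) {I : FractionalIdeal (𝓞 k)⁰ k} (hI : I ≠ 0)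
    {δ : ℂ} (hδ : δ ≠ 0) :
    ∃ B : LatticeBasis, ∃ α : ℤ × ℤ → k, (∀ j, α j ∈ I) ∧ (∀ a ∈ I, ∃ j, α j = a) ∧
      ∀ j, B.pt j = δ * star (ι (α j)) := by
  set b₀ := NumberField.basisOfFractionalIdeal k (Units.mk0 I hI)
  have hcard : Fintype.card (Free.ChooseBasisIndex ℤ (Units.mk0 I hI).1) = 2 := by
    rw [← finrank_eq_card_basis b₀, hquad]
  set b : Basis (Fin 2) ℚ k := b₀.reindex (Fintype.equivFinOfCardEq hcard) with hb
  have hspan : ∀ x, x ∈ Submodule.span ℤ (Set.range b) ↔ x ∈ I := by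
    intro x
    rw [hb, Basis.range_reindex]
    exact NumberField.mem_span_basisOfFractionalIdeal k
  have hmem : ∀ x, x ∈ I ↔ ∃ m n : ℤ, (m : k) * b 0 + (n : k) * b 1 = x := by
    intro x
    rw [← hspan, show Set.range b = {b 0, b 1} by ext; simp [Fin.exists_fin_two, eq_comm],
      Submodule.mem_span_pair]
    simp
  -- If the two images were dependent over ℝ, then ι(b₁/b₀) would be real; as b is a ℚ-basis of k,
  -- every ι(x) would be real, which is impossible for a totally complex field.
  have hind : (δ * star (ι (b 0))).re * (δ * star (ι (b 1))).im -
      (δ * star (ι (b 0))).im * (δ * star (ι (b 1))).re ≠ 0 := by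
    intro h
    have h0 : b 0 ≠ 0 := b.ne_zero 0
    have hι0 : ι (b 0) ≠ 0 := (map_ne_zero ι).2 h0
    have hδ2 : δ.re ^ 2 + δ.im ^ 2 ≠ 0 := by
      rw [← LatticeBasis.norm_sq_eq]; positivity
    have h1 : (ι (b 0)).im * (ι (b 1)).re - (ι (b 0)).re * (ι (b 1)).im = 0 := by
      have : (δ.re ^ 2 + δ.im ^ 2) *
          ((ι (b 0)).im * (ι (b 1)).re - (ι (b 0)).re * (ι (b 1)).im) = 0 := by
        rw [← h]
        simp
        ring
      exact (mul_eq_zero.1 this).resolve_left hδ2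
    refine NumberField.IsTotallyComplex.complexEmbedding_not_isReal ι
      (NumberField.ComplexEmbedding.isReal_iff.2 (RingHom.ext fun x => ?_))
    rw [NumberField.ComplexEmbedding.conjugate_coe_eq, Complex.conj_eq_iff_im]
    have ht : (ι (b 1 / b 0)).im = 0 := by
      rw [map_div₀, Complex.div_im]
      rw [← sub_div, div_eq_zero_iff]
      left
      linarith
    have hx := b.sum_repr (x * b 0)
    rw [Fin.sum_univ_two] at hx
    generalize b.repr (x * b 0) = c at hx
    have hx2 : x = algebraMap ℚ k (c 0) + algebraMap ℚ k (c 1) * (b 1 / b 0) := by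
      rw [Algebra.smul_def, Algebra.smul_def] at hx
      field_simp
      linear_combination -hx
    have hq : ∀ q : ℚ, ι (algebraMap ℚ k q) = ((q : ℝ) : ℂ) := fun q => by simp
    rw [hx2, map_add, map_mul, hq, hq, Complex.add_im, Complex.im_ofReal_mul, ht]
    simp
  refine ⟨⟨_, _, hind⟩, fun j => (j.1 : k) * b 0 + (j.2 : k) * b 1, fun j => ?_, fun a ha => ?_,
    fun j => ?_⟩
  · exact (hmem _).2 ⟨_, _, rfl⟩
  · obtain ⟨m, n, h⟩ := (hmem a).1 ha
    exact ⟨(m, n), h⟩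
  · simp only [LatticeBasis.pt, map_add, map_mul, map_intCast, star_add, star_mul', star_intCast]
    ring

end ImaginaryQuadratic

/-- The covolume of the lattice of a `LatticeBasis`. -/
theorem LatticeBasis.covolume_eq (B : LatticeBasis) {M : Submodule ℤ ℂ}
    (hM : ∀ x, x ∈ M ↔ ∃ j, B.pt j = x) : ZLattice.covolume M = |B.det| := by
  have hli : LinearIndependent ℝ ![B.ω₁, B.ω₂] := by
    rw [LinearIndependent.pair_iff]
    intro s t h
    have h1 := congrArg Complex.re h
    have h2 := congrArg Complex.im h
    simp at h1 h2
    have h3 : s * B.det = 0 := by unfold LatticeBasis.det; linear_combination B.ω₂.im * h1 - B.ω₂.re * h2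
    have h4 : t * B.det = 0 := by unfold LatticeBasis.det; linear_combination B.ω₁.re * h2 - B.ω₁.im * h1
    exact ⟨(mul_eq_zero.1 h3).resolve_right B.det_ne_zero,
      (mul_eq_zero.1 h4).resolve_right B.det_ne_zero⟩
  set b : Basis (Fin 2) ℝ ℂ := basisOfLinearIndependentOfCardEqFinrank hli (by simp) with hb
  have hb0 : (b : Fin 2 → ℂ) = ![B.ω₁, B.ω₂] := by
    rw [hb, coe_basisOfLinearIndependentOfCardEqFinrank]
  have hMs : M = Submodule.span ℤ (Set.range b) := by
    ext x
    rw [hM, hb0, show Set.range ![B.ω₁, B.ω₂] = {B.ω₁, B.ω₂} by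
      simp [Matrix.range_cons, Set.pair_comm], Submodule.mem_span_pair]
    simp [LatticeBasis.pt, Prod.exists]
  have hcov := ZLattice.covolume_eq_det_mul_measureReal (Submodule.span ℤ (Set.range b))
    MeasureTheory.volume (b.restrictScalars ℤ) Complex.orthonormalBasisOneI.toBasis
  rw [hMs, hcov]
  have hvol : MeasureTheory.volume.real
      (ZSpan.fundamentalDomain Complex.orthonormalBasisOneI.toBasis) = 1 := by
    rw [MeasureTheory.measureReal_def, MeasureTheory.measure_congr
      (ZSpan.fundamentalDomain_ae_parallelepiped _ _), OrthonormalBasis.coe_toBasis,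
      Complex.orthonormalBasisOneI.volume_parallelepiped, ENNReal.toReal_one]
  rw [hvol, mul_one, Basis.det_apply, Matrix.det_fin_two]
  simp [Basis.toMatrix_apply, hb0, LatticeBasis.det]
  ring_nf

end KudlaCusp

/-! ### The cusp datum in coordinates. -/

namespace KudlaCusp
open Set Filter Module

theorem star_delta (d : ℕ) : star (delta d) = -delta d := by
  simp [delta]

theorem norm_delta_sq (d : ℕ) : ‖delta d‖ ^ 2 = d := by
  rw [delta, norm_mul, Complex.norm_I, one_mul, Complex.norm_real, Real.norm_eq_abs, sq_abs,
    Real.sq_sqrt (Nat.cast_nonneg d)]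

theorem delta_ne_zero {d : ℕ} (hd : 0 < d) : delta d ≠ 0 := by
  intro h
  have := norm_delta_sq d
  rw [h] at this
  have hd' : (d : ℝ) ≠ 0 := by positivity
  simp at this
  exact hd' this.symm

namespace CuspDatum

variable {k : Type*} [Field k] [NumberField k] {ι : k →+* ℂ} {d N : ℕ} (D : CuspDatum k ι d N)

theorem mem_L {f : Vec k N} : f ∈ D.L ↔ f.1 ∈ D.𝔞₀ ∧ f.2.1 ∈ D.Λ ∧ f.2.2 ∈ D.𝔠₀ := by
  simp [L, prodLattice, Submodule.mem_prod]

/-- The quadratic form of `A`. -/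
def normA (u : Fin N → ℂ) : ℝ := ∑ i, (D.A i : ℝ) * ‖u i‖ ^ 2

theorem normA_nonneg (u : Fin N → ℂ) : 0 ≤ D.normA u :=
  Finset.sum_nonneg fun i _ => mul_nonneg (by exact_mod_cast (D.A_pos i).le) (sq_nonneg _)

theorem coe_normA (u : Fin N → ℂ) : (D.normA u : ℂ) = ∑ i, u i * (D.A i : ℂ) * star (u i) := by
  rw [normA, Complex.ofReal_sum]
  refine Finset.sum_congr rfl fun i _ => ?_
  rw [Complex.ofReal_mul, Complex.ofReal_pow, ← Complex.mul_conj']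
  simp only [RCLike.star_def, Complex.ofReal_ratCast]
  ring

/-- The vectors of norm `m` in `Λ`. -/
def shell (m : ℤ) : Set (Fin N → k) := {b | b ∈ D.Λ ∧ D.normA (fun i => ι (b i)) = m}

theorem ne_zero_of_mem_shell {m : ℤ} (hm : m ≠ 0) {b : Fin N → k} (hb : b ∈ D.shell m) : b ≠ 0 := by
  rintro rfl
  have := hb.2
  simp [normA] at this
  exact hm (by exact_mod_cast this.symm)

/-- Positivity of A bounds each coordinate, and the coordinates lie in finitely generated, hence
fractional, submodules of k. -/
theorem finite_shell [NumberField.IsTotallyComplex k] (hquad : finrank ℚ k = 2) (m : ℤ) :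
    (D.shell m).Finite := by
  have h : ∀ i, {x : k | x ∈ D.Λ.map (LinearMap.proj i : (Fin N → k) →ₗ[𝓞 k] k) ∧
      ‖ι x‖ ≤ Real.sqrt (m / D.A i)}.Finite := fun i =>
    finite_fractional_norm_le ι hquad (FractionalIdeal.isFractional_of_fg (D.Λ_fg.map _)) _
  refine (Set.Finite.pi' h).subset fun b hb i => ⟨⟨b, hb.1, rfl⟩, Real.le_sqrt_of_sq_le ?_⟩
  have hA : (0 : ℝ) < D.A i := by exact_mod_cast D.A_pos i
  rw [le_div_iff₀' hA, ← hb.2, normA]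
  exact Finset.single_le_sum (f := fun i => (D.A i : ℝ) * ‖ι (b i)‖ ^ 2)
    (fun j _ => mul_nonneg (by exact_mod_cast (D.A_pos j).le) (sq_nonneg _)) (Finset.mem_univ i)

theorem herm_self_of_c_eq_zero (a : k) (b : Fin N → k) :
    D.herm (a, b, 0) (a, b, 0) = D.normA (fun i => ι (b i)) := by
  rw [coe_normA]
  simp [herm, hermC, toC]

/-- Pairing with a nonzero a'e in `𝔞` gives −δ·c·conj(a'), which forces c = 0; the form then reduces
to that of A. -/
theorem mem_Lbnd (hd : 0 < d) {m : ℤ} {f : Vec k N} :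
    f ∈ D.Lbnd m ↔ f.1 ∈ D.𝔞₀ ∧ f.2.1 ∈ D.shell m ∧ f.2.2 = 0 := by
  obtain ⟨a, b, c⟩ := f
  constructor
  · rintro ⟨⟨hL, hm⟩, horth⟩
    rw [mem_L] at hL
    obtain ⟨a', ha', ha0⟩ := Submodule.exists_mem_ne_zero_of_ne_bot
      (FractionalIdeal.coeToSubmodule_ne_bot.2 D.𝔞₀_ne_zero)
    have h3 := horth (a', 0, 0) (by
      simp only [𝔞, prodLattice, Submodule.mem_prod]
      exact ⟨ha', Submodule.zero_mem _, Submodule.zero_mem _⟩)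
    have hc : c = 0 := by
      simpa [herm, hermC, toC, delta_ne_zero hd, ha0] using h3
    subst hc
    rw [herm_self_of_c_eq_zero] at hm
    exact ⟨hL.1, ⟨hL.2.1, by exact_mod_cast hm⟩, rfl⟩
  · rintro ⟨ha, ⟨hb, hm⟩, hc⟩
    simp only at ha hb hm hc
    subst hc
    refine ⟨⟨D.mem_L.2 ⟨ha, hb, D.𝔠₀.zero_mem⟩, ?_⟩, ?_⟩
    · rw [herm_self_of_c_eq_zero, hm]; simp
    · rintro ⟨a', b', c'⟩ hg
      simp only [𝔞, prodLattice, Submodule.mem_prod, Submodule.mem_bot] at hg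
      obtain ⟨-, rfl, hc'⟩ := hg
      have hc'' : c' = 0 := by simpa using hc'
      subst hc''
      simp [herm, hermC, toC]

/-- Each class modulo `𝔞` has exactly one representative with a = 0, so `Ind m` counts the vectors
of norm m in Λ. -/
theorem indexSet_eq (hd : 0 < d) (m : ℤ) :
    D.indexSet m = (fun b : Fin N → k => D.𝔞.mkQ ((0, b, 0) : Vec k N)) '' D.shell m := by
  ext x
  constructor
  · rintro ⟨⟨a, b, c⟩, hf, rfl⟩
    obtain ⟨ha, hb, hc⟩ := (D.mem_Lbnd hd).1 hf
    simp only at ha hb hc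
    subst hc
    refine ⟨b, hb, ?_⟩
    simp only [Submodule.mkQ_apply]
    rw [Submodule.Quotient.eq]
    simp only [𝔞, prodLattice, Submodule.mem_prod]
    refine ⟨?_, by simp, by simp⟩
    simpa using ha
  · rintro ⟨b, hb, rfl⟩
    exact ⟨_, (D.mem_Lbnd hd).2 ⟨D.𝔞₀.zero_mem, hb, rfl⟩, rfl⟩

theorem injOn_mkQ (s : Set (Fin N → k)) :
    Set.InjOn (fun b : Fin N → k => D.𝔞.mkQ ((0, b, 0) : Vec k N)) s := by
  intro b _ b' _ h
  simp only [Submodule.mkQ_apply] at h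
  rw [Submodule.Quotient.eq] at h
  have h2 : b - b' = 0 := by
    have := h.2.1
    simpa using this
  exact sub_eq_zero.1 h2

theorem finite_indexSet [NumberField.IsTotallyComplex k] (hquad : finrank ℚ k = 2) (hd : 0 < d)
    (m : ℤ) : (D.indexSet m).Finite := by
  rw [D.indexSet_eq hd]
  exact (D.finite_shell hquad m).image _

theorem Ind_eq (hd : 0 < d) (m : ℤ) : D.Ind m = (D.shell m).ncard := by
  rw [Ind, D.indexSet_eq hd, (D.injOn_mkQ _).ncard_image]

/-- The part of `Ψ_f` that depends on the point, for `f = (a, b, 0)`. -/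
def slope (b : Fin N → k) : (Fin (N + 1) → ℂ) →L[ℂ] ℂ :=
  ∑ i, ((D.A i : ℂ) * star (ι (b i))) • ContinuousLinearMap.proj i.succ

theorem slope_apply (b : Fin N → k) (w : Fin (N + 1) → ℂ) :
    D.slope b w = ∑ i, w i.succ * (D.A i : ℂ) * star (ι (b i)) := by
  simp only [slope, sum_apply, smul_apply, ContinuousLinearMap.proj_apply,
    smul_eq_mul]
  exact Finset.sum_congr rfl fun i _ => by ring

theorem slope_ne_zero {b : Fin N → k} (hb : b ≠ 0) : D.slope b ≠ 0 := by
  obtain ⟨i, hi⟩ := Function.ne_iff.1 hb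
  intro h
  have h2 := congrArg (fun L => L (Pi.single i.succ 1)) h
  simp only [slope_apply, zero_apply] at h2
  rw [Finset.sum_eq_single i] at h2
  · have hA : (D.A i : ℂ) ≠ 0 := by exact_mod_cast (D.A_pos i).ne'
    simp [hA] at h2
    exact hi (by simpa using h2)
  · intro j _ hj
    simp [hj]
  · simp

theorem slope_congr (b : Fin N → k) {w w' : Fin (N + 1) → ℂ} (h : ∀ i : Fin N, w i.succ = w' i.succ) :
    D.slope b w = D.slope b w' := by
  simp [slope_apply, h]

theorem Psi_eq (a : k) (b : Fin N → k) (c : k) (w : Fin (N + 1) → ℂ) :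
    D.Psi (a, b, c) w = delta d * w 0 * star (ι c) + D.slope b w - delta d * star (ι a) := by
  rw [slope_apply]
  simp [Psi, hermC, lineVec, toC]

theorem hermC_lineVec (w : Fin (N + 1) → ℂ) :
    hermC d D.A (lineVec w) (lineVec w) =
      ((D.normA (fun i => w i.succ) - 2 * Real.sqrt d * (w 0).im : ℝ) : ℂ) := by
  rw [Complex.ofReal_sub, coe_normA]
  simp only [hermC, lineVec, delta, star_one]
  have h : w 0 - star (w 0) = 2 * (w 0).im * Complex.I := Complex.sub_conj (w 0) ▸ by
    push_cast; ring
  push_cast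
  linear_combination Complex.I * (Real.sqrt d : ℂ) * h + 2 * (Real.sqrt d : ℂ) * (w 0).im * Complex.I_mul_I

theorem xi_eq (hd : 0 < d) (w : Fin (N + 1) → ℂ) :
    D.xi w = 2 * Real.sqrt d * (w 0).im - D.normA (fun i => w i.succ) := by
  have h : hermC d D.A (lineVec w) ((1, 0, 0) : Vec ℂ N) = -delta d := by
    simp [hermC, lineVec]
  rw [xi, h, hermC_lineVec, norm_neg, norm_delta_sq, Complex.ofReal_re]
  have : (d : ℝ) ≠ 0 := by positivity
  field_simp
  ring

theorem mem_domain (hd : 0 < d) {w : Fin (N + 1) → ℂ} : w ∈ D.domain ↔ 0 < D.xi w := by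
  rw [D.xi_eq hd, domain, mem_ofPred_eq, hermC_lineVec, Complex.ofReal_re]
  constructor <;> intro h <;> linarith

theorem mem_domainEps (hd : 0 < d) {ε : ℝ} (hε : 0 < ε) {w : Fin (N + 1) → ℂ} :
    w ∈ D.domainEps ε ↔ 1 / ε < D.xi w := by
  rw [domainEps, mem_ofPred_eq, D.mem_domain hd]
  constructor
  · rintro ⟨h1, h2⟩
    exact (one_div_lt h1 hε).1 h2
  · intro h
    have h1 : 0 < D.xi w := (one_div_pos.2 hε).trans h
    exact ⟨h1, (one_div_lt h1 hε).2 h⟩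

/-- A vector orthogonal to a negative line has `m ≥ ξ |c|²`. -/
theorem xi_mul_le (hd : 0 < d) {m : ℤ} {f : Vec k N} (hf : f ∈ D.Lnorm m)
    {w : Fin (N + 1) → ℂ} (h0 : D.Psi f w = 0) : D.xi w * ‖ι f.2.2‖ ^ 2 ≤ m := by
  obtain ⟨a, b, c⟩ := f
  have hm := hf.2
  -- With x = (z, u, 1), the vector f − cx has no e'-component, so its norm is that of b − cu under
  -- A. By orthogonality of f and x it also equals m + |c|²⟨x, x⟩ = m − ξ|c|².
  have h1 : (m : ℝ) = D.xi w * ‖ι c‖ ^ 2 + D.normA fun i => ι (b i) - ι c * w i.succ := by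
    rw [← Complex.ofReal_inj]
    have hb : (D.normA (fun i => ι (b i)) : ℂ) = ∑ i, ι (b i) * (D.A i : ℂ) * star (ι (b i)) :=
      D.coe_normA _
    have hS : star (D.slope b w) = ∑ i, ι (b i) * (D.A i : ℂ) * star (w i.succ) := by
      rw [slope_apply, star_sum]
      exact Finset.sum_congr rfl fun i _ => by simp; ring
    have hexp : (D.normA (fun i => ι (b i) - ι c * w i.succ) : ℂ) =
        D.normA (fun i => ι (b i)) - star (ι c) * star (D.slope b w) - ι c * D.slope b w
          + ι c * star (ι c) * D.normA (fun i => w i.succ) := by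
      rw [hS, slope_apply, coe_normA, coe_normA, coe_normA, Finset.mul_sum, Finset.mul_sum,
        Finset.mul_sum, ← Finset.sum_sub_distrib, ← Finset.sum_sub_distrib,
        ← Finset.sum_add_distrib]
      exact Finset.sum_congr rfl fun i _ => by simp; ring
    have hm2 : (m : ℂ) = delta d * ι a * star (ι c) + D.normA (fun i => ι (b i))
        - delta d * ι c * star (ι a) := by
      rw [← hm, hb]; simp [herm, hermC, toC]
    rw [Psi_eq] at h0
    have h0' := congrArg star h0
    simp only [star_add, star_sub, star_mul', star_star, star_delta, star_zero] at h0'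
    have hxi2 : (D.xi w : ℂ) = -(delta d * w 0 - delta d * star (w 0)
        + D.normA (fun i => w i.succ)) := by
      have h := D.hermC_lineVec w
      have e : D.xi w = -(D.normA (fun i => w i.succ) - 2 * Real.sqrt d * (w 0).im) := by
        rw [D.xi_eq hd]; ring
      rw [e, Complex.ofReal_neg, ← h, coe_normA]
      simp [hermC, lineVec]
      ring
    rw [Complex.ofReal_add, Complex.ofReal_mul, Complex.ofReal_pow, ← Complex.mul_conj', hexp, hxi2]
    rw [Complex.ofReal_intCast, hm2]
    simp only [RCLike.star_def] at *
    linear_combination starRingEnd ℂ (ι c) * h0' + ι c * h0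
  rw [h1]
  linarith [D.normA_nonneg fun i => ι (b i) - ι c * w i.succ]

end CuspDatum
end KudlaCusp

/-! ### Cancellation of the logarithmic singularities. -/

namespace KudlaCusp
open Set Filter Module

theorem LatticeBasis.eventually_eq_of_pt_eq (B : LatticeBasis) (s₀ : ℂ) :
    ∀ᶠ s in 𝓝 s₀, (∃ j, B.pt j = s) → s = s₀ := by
  obtain ⟨c, hc, hle⟩ := B.exists_size_le_sub s₀
  have h : ContinuousAt (fun s : ℂ => ‖s₀ - s‖ ^ 2) s₀ := by fun_prop
  filter_upwards [h.eventually_lt continuousAt_const (by simpa using hc : ‖s₀ - s₀‖ ^ 2 < c)]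
    with s hs
  rintro ⟨j, rfl⟩
  by_contra hne
  have h1 := hle j hne
  have := LatticeBasis.one_le_size j
  nlinarith [one_le_size j]

section Regularization

variable {N : ℕ} {β : Type*} (B : LatticeBasis) (R : Finset β)
  (s : β → (Fin (N + 1) → ℂ) →L[ℂ] ℂ) (ψ : (Fin (N + 1) → ℂ) → ℂ)

open Classical in
/-- The indices of the functions `s b - pt j` that vanish at `p` for some `j`. -/
def vanishing (p : Fin (N + 1) → ℂ) : Finset β := R.filter fun b => ∃ j, B.pt j = s b p

/-- Up to a unit, `ψ` is near `p` the product of the functions `s b - pt j` that vanish at `p`. -/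
def HasFactorization (p : Fin (N + 1) → ℂ) : Prop :=
  ∃ φ : (Fin (N + 1) → ℂ) → ℂ, ContDiffAt ℂ ∞ φ p ∧ φ p ≠ 0 ∧
    ∀ᶠ y in 𝓝 p, ψ y = φ y * ∏ b ∈ vanishing B R s p, (s b y - s b p)

variable {B R s ψ}

theorem mem_vanishing {p : Fin (N + 1) → ℂ} {b : β} :
    b ∈ vanishing B R s p ↔ b ∈ R ∧ ∃ j, B.pt j = s b p := by
  classical
  simp [vanishing]

theorem HasFactorization.pt_ne {p : Fin (N + 1) → ℂ} (h : HasFactorization B R s ψ p)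
    (hp : ψ p ≠ 0) {b : β} (hb : b ∈ R) (j : ℤ × ℤ) : B.pt j ≠ s b p := by
  intro hj
  obtain ⟨φ, -, -, h⟩ := h
  refine hp ?_
  rw [h.self_of_nhds, Finset.prod_eq_zero (mem_vanishing.2 ⟨hb, j, hj⟩) (sub_self _), mul_zero]

theorem isHorizontal_sub {L : (Fin (N + 1) → ℂ) →L[ℂ] ℂ} (h0 : L ≠ 0)
    (h1 : L (Pi.single 0 1) = 0) (c : ℂ) : IsHorizontal fun y => L y - c :=
  ⟨L, h0, h1, fun x y => by rw [map_sub]; ring⟩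

/-- A factorization at the points with `p 0 ≠ 0` extends to the points with `p 0 = 0`. -/
theorem hasFactorization_of_frequently (hs0 : ∀ b ∈ R, s b ≠ 0)
    (hs1 : ∀ b ∈ R, s b (Pi.single 0 1) = 0) {p : Fin (N + 1) → ℂ} (hp : p 0 = 0)
    (hψ : ∀ᶠ x in 𝓝 p, ContDiffAt ℂ ∞ ψ x)
    (hloc : ∀ᶠ x in 𝓝 p, x 0 ≠ 0 → HasFactorization B R s ψ x)
    (hfr : ∃ᶠ x in 𝓝[{x | x 0 = 0}] p, ψ x ≠ 0) : HasFactorization B R s ψ p := by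
  classical
  refine exists_factorization (Ψ := fun b y => s b y - s b p) hp
    (fun b hb => isHorizontal_sub (hs0 b (mem_vanishing.1 hb).1) (hs1 b (mem_vanishing.1 hb).1) _)
    (fun b _ => sub_self _) hψ ?_ hfr
  -- Discreteness of the lattice: near p, a form `s b` can only meet the lattice at its value at p,
  -- so the factors vanishing at x are among those vanishing at p.
  have hev : ∀ᶠ x in 𝓝 p, ∀ b ∈ R, (∃ j, B.pt j = s b x) → s b x = s b p := by
    rw [Filter.eventually_all_finset]
    exact fun b _ => (s b).continuous.continuousAt.eventually (B.eventually_eq_of_pt_eq _)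
  filter_upwards [hloc, hev] with x hx hbx hx0
  obtain ⟨φ, h1, h2, h3⟩ := hx hx0
  refine ⟨φ, h1.continuousAt, h2, h3.mono fun y hy => ?_⟩
  rw [hy]
  congr 1
  have hset : vanishing B R s x = (vanishing B R s p).filter fun b => s b x - s b p = 0 := by
    ext b
    rw [Finset.mem_filter, mem_vanishing, mem_vanishing, sub_eq_zero]
    constructor
    · rintro ⟨hb, hj⟩
      have := hbx b hb hj
      exact ⟨⟨hb, this ▸ hj⟩, this⟩
    · rintro ⟨⟨hb, hj⟩, h⟩
      exact ⟨hb, h ▸ hj⟩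
  rw [hset]
  refine Finset.prod_congr rfl fun b hb => ?_
  rw [sub_eq_zero.1 (Finset.mem_filter.1 hb).2]

theorem contDiff_dualSum_one : ContDiff ℝ ∞ fun z : ℂ => (B.dualSum (z, 1)).re := by
  refine contDiff_iff_contDiffAt.2 fun z => ?_
  have h1 : ContDiffAt ℝ ∞ B.dualSum (z, 1) := B.contDiffOn_dualSum.contDiffAt
    ((isOpen_lt continuous_const continuous_snd).mem_nhds (show (0 : ℝ) < 1 from zero_lt_one))
  have h2 : ContDiffAt ℝ ∞ (fun z : ℂ => (z, (1 : ℝ))) z := contDiffAt_id.prodMk contDiffAt_const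
  exact (Complex.reCLM.contDiff.contDiffAt).comp z (ContDiffAt.comp (g := B.dualSum) z h1 h2)

/-- The logarithm of `|ψ|²` cancels the singularities of the sums of `β₁`. -/
theorem exists_regularization (hs0 : ∀ b ∈ R, s b ≠ 0)
    (hs1 : ∀ b ∈ R, s b (Pi.single 0 1) = 0) {U : Set (Fin (N + 1) → ℂ)} (hU : IsOpen U)
    (hψ : ∀ p ∈ U, HasFactorization B R s ψ p) (κ : ℝ) :
    ∃ G : (Fin (N + 1) → ℂ) → ℝ, (∀ p ∈ U, ContDiffAt ℝ ∞ G p) ∧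
      ∀ p ∈ U, ψ p ≠ 0 → G p = Real.log (‖ψ p‖ ^ 2) +
        ∑ b ∈ R, (B.betaSum (s b p) + κ + (B.dualSum (s b p, 1)).re) := by
  classical
  set f : (Fin (N + 1) → ℂ) → ℝ := fun p => Real.log (‖ψ p‖ ^ 2) +
        ∑ b ∈ R, (B.betaSum (s b p) + κ + (B.dualSum (s b p, 1)).re) with hf
  set A : Set (Fin (N + 1) → ℂ) := {p | ψ p ≠ 0} with hA
  -- The set ψ ≠ 0 is dense near every point of U, so the local smooth extensions are all given by
  -- limits from it. They agree with `extendFrom A f` and need no separate gluing.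
  have key : ∀ p ∈ U, ∃ G : (Fin (N + 1) → ℂ) → ℝ, ContDiffAt ℝ ∞ G p ∧
      extendFrom A f =ᶠ[𝓝 p] G ∧ ∀ᶠ y in 𝓝 p, ψ y ≠ 0 → f y = G y := by
    intro p hp
    obtain ⟨φ, hφ, hφ0, hφψ⟩ := hψ p hp
    choose ρ hρ hρ' using fun b => B.betaSum_regular (s b p)
    have hsb : ∀ b, ContDiff ℝ ∞ (s b) := fun b => (s b).restrictScalars ℝ |>.contDiff
    set G : (Fin (N + 1) → ℂ) → ℝ := fun y => Real.log (‖φ y‖ ^ 2) +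
      ∑ b ∈ R, (ρ b (s b y) + κ + (B.dualSum (s b y, 1)).re) with hG
    have hGs : ContDiffAt ℝ ∞ G p := by
      refine ContDiffAt.add ?_ (ContDiffAt.sum fun b _ => ContDiffAt.add (ContDiffAt.add ?_
        contDiffAt_const) ?_)
      · refine ContDiffAt.log ?_ (by positivity)
        exact (hφ.restrict_scalars ℝ).norm_sq ℝ
      · exact (hρ b).comp p (hsb b).contDiffAt
      · exact ((contDiff_dualSum_one (B := B)).comp (hsb b)).contDiffAt
    have hφ0' : ∀ᶠ y in 𝓝 p, φ y ≠ 0 := hφ.continuousAt.eventually_ne hφ0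
    have hρ'' : ∀ᶠ y in 𝓝 p, ∀ b ∈ R, (∀ j, B.pt j ≠ s b y) →
        B.betaSum (s b y) + (if ∃ j, B.pt j = s b p then Real.log (‖s b y - s b p‖ ^ 2) else 0) =
          ρ b (s b y) := by
      rw [Filter.eventually_all_finset]
      exact fun b _ => (s b).continuous.continuousAt.eventually (hρ' b)
    have hfG : ∀ᶠ y in 𝓝 p, ψ y ≠ 0 → f y = G y := by
      filter_upwards [hφ0', hρ'', hφψ, hU.mem_nhds hp] with y h1 h2 h3 hyU hy
      have h4 : Real.log (‖ψ y‖ ^ 2) = Real.log (‖φ y‖ ^ 2) +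
          ∑ b ∈ R, if ∃ j, B.pt j = s b p then Real.log (‖s b y - s b p‖ ^ 2) else 0 := by
        have h5 : ∏ b ∈ vanishing B R s p, (s b y - s b p) ≠ 0 := by
          rw [h3] at hy; exact right_ne_zero_of_mul hy
        rw [h3, norm_mul, mul_pow, norm_prod, ← Finset.prod_pow, Real.log_mul (by positivity)
          (by
            rw [Finset.prod_ne_zero_iff] at h5 ⊢
            exact fun b hb => pow_ne_zero _ (norm_ne_zero_iff.2 (h5 b hb))),
          Real.log_prod (fun b hb => pow_ne_zero _
            (norm_ne_zero_iff.2 (Finset.prod_ne_zero_iff.1 h5 b hb))), ← Finset.sum_filter]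
        rfl
      simp only [hf, hG]
      rw [h4, add_assoc, ← Finset.sum_add_distrib]
      congr 1
      refine Finset.sum_congr rfl fun b hb => ?_
      rw [← h2 b hb fun j => (hψ y hyU).pt_ne hy hb j]
      ring
    refine ⟨G, hGs, ?_, hfG⟩
    have hGc : ∀ᶠ y in 𝓝 p, ContinuousAt G y :=
      ((hGs.of_le (m := 1) (by exact_mod_cast le_top)).eventually (by simp)).mono
        fun y hy => hy.continuousAt
    filter_upwards [hGc, hfG.eventually_nhds, hφψ.eventually_nhds, hφ0'.eventually_nhds]
      with y h1 h2 h3 h4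
    refine extendFrom_eq ?_ ?_
    · rw [mem_closure_iff_frequently]
      have h5 := mem_closure_iff_frequently.1 (dense_prod_ne_zero (vanishing B R s p)
        (Ψ := fun b y => s b y - s b p) (fun b hb => isHorizontal_sub
          (hs0 b (mem_vanishing.1 hb).1) (hs1 b (mem_vanishing.1 hb).1) _) y)
      refine (h5.and_eventually (h3.and h4)).mono ?_
      rintro z ⟨hz, hz1, hz2⟩
      change ψ z ≠ 0
      rw [hz1]
      exact mul_ne_zero hz2 hz
    · refine (h1.tendsto.mono_left nhdsWithin_le_nhds).congr' ?_
      filter_upwards [mem_nhdsWithin_of_mem_nhds h2, self_mem_nhdsWithin] with z hz hzA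
      exact (hz hzA).symm
  refine ⟨extendFrom A f, fun p hp => ?_, fun p hp h0 => ?_⟩
  · obtain ⟨G, h1, h2, -⟩ := key p hp
    exact h1.congr_of_eventuallyEq h2
  · obtain ⟨G, -, h2, h3⟩ := key p hp
    rw [h2.self_of_nhds, ← h3.self_of_nhds h0]

end Regularization
end KudlaCusp

/-! ### Poisson summation for the Green function, and the chart at the cusp. -/

namespace KudlaCusp
open Set Filter Module
namespace CuspDatum

variable {k : Type*} [Field k] [NumberField k] {ι : k →+* ℂ} {d N : ℕ} (D : CuspDatum k ι d N)

/-- `B` is a basis of the lattice `δ · conj(𝔞₀)`, with `α` the corresponding elements of `𝔞₀`. -/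
structure IsCuspBasis (B : LatticeBasis) (α : ℤ × ℤ → k) : Prop where
  mem : ∀ j, α j ∈ D.𝔞₀
  surj : ∀ a ∈ D.𝔞₀, ∃ j, α j = a
  pt_eq : ∀ j, B.pt j = delta d * star (ι (α j))

theorem exists_isCuspBasis [NumberField.IsTotallyComplex k] (hquad : finrank ℚ k = 2)
    (hd : 0 < d) : ∃ B α, D.IsCuspBasis B α := by
  obtain ⟨B, α, h1, h2, h3⟩ := exists_latticeBasis ι hquad D.𝔞₀_ne_zero (delta_ne_zero hd)
  exact ⟨B, α, h1, h2, h3⟩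

variable {D} {B : LatticeBasis} {α : ℤ × ℤ → k}

theorem IsCuspBasis.injective (h : D.IsCuspBasis B α) : Function.Injective α := fun i j hij =>
  B.pt_injective (by rw [h.pt_eq, h.pt_eq, hij])

theorem IsCuspBasis.vol_eq (h : D.IsCuspBasis B α) : D.vol = |B.det| := by
  refine B.covolume_eq fun x => ?_
  constructor
  · rintro ⟨_, ⟨a, ha, rfl⟩, rfl⟩
    obtain ⟨j, rfl⟩ := h.surj a ha
    exact ⟨j, h.pt_eq j⟩
  · rintro ⟨j, rfl⟩
    exact ⟨ι (α j), ⟨α j, h.mem j, rfl⟩, (h.pt_eq j).symm⟩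

theorem IsCuspBasis.Psi_eq (h : D.IsCuspBasis B α) (j : ℤ × ℤ) (b : Fin N → k)
    (w : Fin (N + 1) → ℂ) : D.Psi (α j, b, 0) w = D.slope b w - B.pt j := by
  rw [CuspDatum.Psi_eq, h.pt_eq]
  simp

/-- The parametrization of `L^bnd(m)`. -/
def IsCuspBasis.equivLbnd (h : D.IsCuspBasis B α) (hd : 0 < d) (m : ℤ) :
    D.shell m × (ℤ × ℤ) ≃ D.Lbnd m :=
  Equiv.ofBijective (fun x => ⟨(α x.2, x.1, 0), (D.mem_Lbnd hd).2 ⟨h.mem _, x.1.2, rfl⟩⟩) (by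
    constructor
    · rintro ⟨⟨b, hb⟩, j⟩ ⟨⟨b', hb'⟩, j'⟩ heq
      simp only [Subtype.mk.injEq, Prod.mk.injEq] at heq
      obtain ⟨h1, rfl, -⟩ := heq
      rw [h.injective h1]
    · rintro ⟨⟨a, b, c⟩, hf⟩
      obtain ⟨h1, h2, h3⟩ := (D.mem_Lbnd hd).1 hf
      simp only at h1 h2 h3
      subst h3
      obtain ⟨j, rfl⟩ := h.surj a h1
      exact ⟨(⟨b, h2⟩, j), rfl⟩)

/-- Poisson summation for the Green function. -/
theorem IsCuspBasis.hasSum_grTerm (h : D.IsCuspBasis B α) (hd : 0 < d) {m : ℤ} {R : Finset (Fin N → k)}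
    (hR : ∀ b, b ∈ R ↔ b ∈ D.shell m) {v : ℝ} (hv : 0 < v) {w : Fin (N + 1) → ℂ}
    (hw : 0 < D.xi w) (hne : ∀ b ∈ R, ∀ j, B.pt j ≠ D.slope b w) :
    HasSum (fun f : D.Lbnd m => D.grTerm v w f)
      (∑ b ∈ R, (Real.pi * (D.xi w / (4 * Real.pi * v) - 1) / |B.det| + B.betaSum (D.slope b w) +
        ((B.dualSum (D.slope b w, 1)).re -
          (B.dualSum (D.slope b w, D.xi w / (4 * Real.pi * v))).re))) := by
  have hτ : 0 < D.xi w / (4 * Real.pi * v) := by positivity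
  rw [← (h.equivLbnd hd m).hasSum_iff]
  -- This is where τ = ξ/(4πv) enters.
  have hterm : ∀ x : D.shell m × (ℤ × ℤ), ((fun f : D.Lbnd m => D.grTerm v w f) ∘
      h.equivLbnd hd m) x = beta1 (‖D.slope x.1.1 w - B.pt x.2‖ ^ 2 /
        (D.xi w / (4 * Real.pi * v))) := by
    rintro ⟨b, j⟩
    change beta1 (4 * Real.pi * v * ‖D.Psi (α j, b.1, 0) w‖ ^ 2 / D.xi w) = _
    rw [h.Psi_eq]
    congr 1
    field_simp
  have hfib : ∀ b : D.shell m, HasSum (fun j => beta1 (‖D.slope b.1 w - B.pt j‖ ^ 2 /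
        (D.xi w / (4 * Real.pi * v)))) _ := fun b =>
    B.hasSum_beta1_div (hne b ((hR b).2 b.2)) hτ
  have : Finite (D.shell m) := by
    have : D.shell m = R := by ext b; exact (hR b).symm
    rw [this]
    exact R.finite_toSet
  have := Fintype.ofFinite (D.shell m)
  -- The terms are nonnegative and the first index runs through a finite set, so summability in each
  -- fiber is enough.
  have hsum : Summable ((fun f : D.Lbnd m => D.grTerm v w f) ∘ h.equivLbnd hd m) := by
    rw [summable_prod_of_nonneg (fun x => by rw [hterm]; exact beta1_nonneg _)]
    refine ⟨fun b => ?_, Summable.of_finite⟩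
    simp only [hterm]
    exact (hfib b).summable
  convert hsum.hasSum using 1
  rw [hsum.tsum_prod]
  simp only [hterm]
  rw [tsum_fintype]
  simp only [(hfib _).tsum_eq]
  exact Finset.sum_subtype R hR fun b => Real.pi * (D.xi w / (4 * Real.pi * v) - 1) / |B.det| +
    B.betaSum (D.slope b w) + ((B.dualSum (D.slope b w, 1)).re -
      (B.dualSum (D.slope b w, D.xi w / (4 * Real.pi * v))).re)

/-! ### The chart -/

theorem toChart_zero (r : ℚ) (w : Fin (N + 1) → ℂ) :
    toChart r w 0 = Complex.exp (2 * Real.pi * Complex.I * w 0 / (r : ℂ)) := rfl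

theorem toChart_succ (r : ℚ) (w : Fin (N + 1) → ℂ) (i : Fin N) :
    toChart r w i.succ = w i.succ := rfl

theorem log_norm_toChart {r : ℚ} (w : Fin (N + 1) → ℂ) :
    Real.log ‖toChart r w 0‖ = -(2 * Real.pi * (w 0).im / r) := by
  rw [toChart_zero, Complex.norm_exp, Real.log_exp]
  have : 2 * (Real.pi : ℂ) * Complex.I * w 0 / (r : ℂ) =
      ((2 * Real.pi / r : ℝ) : ℂ) * (Complex.I * w 0) := by push_cast; ring
  rw [this, Complex.re_ofReal_mul]
  simp
  ring

/-- `ξ`, in the coordinates of the chart. -/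
def xiChart (D : CuspDatum k ι d N) (r : ℚ) (p : Fin (N + 1) → ℂ) : ℝ :=
  -(r * Real.sqrt d / Real.pi) * Real.log ‖p 0‖ - D.normA (fun i => p i.succ)

theorem xiChart_toChart (hd : 0 < d) {r : ℚ} (hr : 0 < r) (w : Fin (N + 1) → ℂ) :
    D.xiChart r (toChart r w) = D.xi w := by
  rw [xiChart, log_norm_toChart, D.xi_eq hd]
  have : (r : ℝ) ≠ 0 := by exact_mod_cast hr.ne'
  simp only [toChart_succ]
  field_simp

theorem mem_chart (hd : 0 < d) {r : ℚ} (hr : 0 < r) {ε : ℝ} {p : Fin (N + 1) → ℂ} (hp : p 0 ≠ 0) :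
    p ∈ D.chart r ε ↔ 1 / ε < D.xiChart r p := by
  have hr' : (0 : ℝ) < r := by exact_mod_cast hr
  have hd' : 0 < Real.sqrt d := Real.sqrt_pos.2 (by exact_mod_cast hd)
  rw [chart, mem_ofPred_eq, ← Real.log_lt_iff_lt_exp (norm_pos_iff.2 hp), xiChart]
  change _ < -(Real.pi / (r * Real.sqrt d) * (1 / ε + D.normA fun i => p i.succ)) ↔ _
  have hc : 0 < Real.pi / (r * Real.sqrt d) := by positivity
  have e : Real.log ‖p 0‖ = -(Real.pi / (r * Real.sqrt d)) *
      (-(r * Real.sqrt d / Real.pi) * Real.log ‖p 0‖) := by field_simp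
  constructor
  · intro h
    by_contra! h2
    rw [e] at h
    nlinarith
  · intro h
    rw [e]
    nlinarith

theorem exists_toChart_eq {r : ℚ} (hr : 0 < r) {p : Fin (N + 1) → ℂ} (hp : p 0 ≠ 0) :
    ∃ w, toChart r w = p := by
  have hr' : (r : ℂ) ≠ 0 := by exact_mod_cast hr.ne'
  refine ⟨Fin.cons (r / (2 * Real.pi * Complex.I) * Complex.log (p 0)) fun i => p i.succ, ?_⟩
  ext i
  refine Fin.cases ?_ (fun i => ?_) i
  · rw [toChart_zero, Fin.cons_zero, mul_div_assoc]
    have : 2 * (Real.pi : ℂ) * Complex.I *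
        (r / (2 * Real.pi * Complex.I) * Complex.log (p 0) / (r : ℂ)) = Complex.log (p 0) := by
      have := Real.pi_ne_zero
      field_simp
    rw [this, Complex.exp_log hp]
  · rfl

/-- A local section of `toChart`. -/
theorem exists_section {r : ℚ} (hr : 0 < r) (w : Fin (N + 1) → ℂ) :
    ∃ σ : (Fin (N + 1) → ℂ) → Fin (N + 1) → ℂ, ContDiffAt ℂ ∞ σ (toChart r w) ∧
      σ (toChart r w) = w ∧ (∀ p i, σ p (Fin.succ i) = p i.succ) ∧
      ∀ p, p 0 ≠ 0 → toChart r (σ p) = p := by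
  have hr' : (r : ℂ) ≠ 0 := by exact_mod_cast hr.ne'
  have hpi := Real.pi_ne_zero
  have hw : toChart r w 0 ≠ 0 := Complex.exp_ne_zero _
  -- Dividing by the value at the base point puts the argument of the logarithm at 1, away from the
  -- branch cut.
  refine ⟨fun p => Fin.cons (w 0 + r / (2 * Real.pi * Complex.I) *
    Complex.log (p 0 / toChart r w 0)) fun i => p i.succ, ?_, ?_, fun p i => rfl, fun p hp => ?_⟩
  · rw [contDiffAt_pi]
    refine Fin.cases ?_ fun i => ?_
    · simp only [Fin.cons_zero]
      refine contDiffAt_const.add (contDiffAt_const.mul (ContDiffAt.comp (g := Complex.log) _ (Complex.contDiffAt_log ?_)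
        ((contDiff_apply ℂ ℂ 0).contDiffAt.div_const _)))
      rw [div_self hw]
      exact Complex.one_mem_slitPlane
    · simp only [Fin.cons_succ]
      exact (contDiff_apply ℂ ℂ i.succ).contDiffAt
  · ext i
    refine Fin.cases ?_ (fun i => rfl) i
    simp only [Fin.cons_zero]
    rw [div_self hw, Complex.log_one, mul_zero, add_zero]
  · ext i
    refine Fin.cases ?_ (fun i => rfl) i
    rw [toChart_zero]
    simp only [Fin.cons_zero]
    have : 2 * (Real.pi : ℂ) * Complex.I * (w 0 + r / (2 * Real.pi * Complex.I) *
        Complex.log (p 0 / toChart r w 0)) / (r : ℂ) =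
        2 * Real.pi * Complex.I * w 0 / r + Complex.log (p 0 / toChart r w 0) := by
      field_simp
    rw [this, Complex.exp_add, Complex.exp_log (div_ne_zero hp hw), ← toChart_zero,
      mul_div_cancel₀ _ hw]

/-- When only vectors with c = 0 can vanish at w, the finite product in `IsEquationKR` runs over
vectors of `Lbnd m`, whose Ψ_f are the forms `slope b` − λ. A local section of `toChart` carries the
identity to the chart. -/
theorem IsCuspBasis.hasFactorization_of_ne_zero (h : D.IsCuspBasis B α) (hd : 0 < d) {m : ℤ}
    {R : Finset (Fin N → k)} (hR : ∀ b, b ∈ R ↔ b ∈ D.shell m) {r : ℚ} (hr : 0 < r)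
    {U : Set (Fin (N + 1) → ℂ)} {ψ : (Fin (N + 1) → ℂ) → ℂ} (hψ : D.IsEquationKR r m U ψ)
    {w : Fin (N + 1) → ℂ} (hw : 0 < D.xi w)
    (hc : ∀ f ∈ D.Lnorm m, D.Psi f w = 0 → f.2.2 = 0) (hU : toChart r w ∈ U) :
    HasFactorization B R D.slope ψ (toChart r w) := by
  obtain ⟨F, hF, g, hg, hg0, hgψ⟩ := hψ.2.1 w ((D.mem_domain hd).2 hw) hU
  obtain ⟨σ, hσ, hσw, hσs, hσt⟩ := exists_section hr w
  have hw0 : toChart r w 0 ≠ 0 := Complex.exp_ne_zero _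
  have hmemF : ∀ f ∈ F, f ∈ D.Lbnd m := fun f hf =>
    ⟨((hF f).1 hf).1, by
      have h1 := ((hF f).1 hf).1
      have hL := D.mem_L.1 h1.1
      have hc0 := hc f h1 ((hF f).1 hf).2
      obtain ⟨a, b, c⟩ := f
      simp only at hc0 hL
      subst hc0
      refine ((D.mem_Lbnd hd).2 ⟨hL.1, ⟨hL.2.1, ?_⟩, rfl⟩ : (a, b, 0) ∈ D.Lbnd m).2
      have := h1.2
      rw [D.herm_self_of_c_eq_zero] at this
      exact_mod_cast this⟩
  have hform : ∀ f ∈ F, ∃ j, f = (α j, f.2.1, 0) ∧ B.pt j = D.slope f.2.1 w := by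
    intro f hf
    obtain ⟨h1, h2, h3⟩ := (D.mem_Lbnd hd).1 (hmemF f hf)
    obtain ⟨j, hj⟩ := h.surj _ h1
    have e : f = (α j, f.2.1, 0) := by rw [hj, ← h3]
    refine ⟨j, e, ?_⟩
    have h0 := ((hF f).1 hf).2
    rw [e, h.Psi_eq] at h0
    exact (sub_eq_zero.1 h0).symm
  refine ⟨g ∘ σ, ?_, ?_, ?_⟩
  · refine ContDiffAt.comp _ ?_ hσ
    rw [hσw]
    exact hg.contDiffAt
  · rw [Function.comp_apply, hσw]; exact hg0
  · have hev : ∀ᶠ y in 𝓝 (toChart r w), ψ (toChart r (σ y)) = g (σ y) * ∏ f ∈ F, D.Psi f (σ y) := by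
      have hcont := hσ.continuousAt
      rw [ContinuousAt, hσw] at hcont
      exact hcont.eventually hgψ
    have hne : ∀ᶠ y in 𝓝 (toChart r w), y 0 ≠ 0 :=
      (continuous_apply 0).continuousAt.eventually_ne hw0
    filter_upwards [hev, hne] with y hy hy0
    rw [hσt y hy0] at hy
    rw [hy, Function.comp_apply]
    congr 1
    have hsl : (fun b => D.slope b (toChart r w)) = fun b => D.slope b w := by
      ext b
      exact D.slope_congr b fun i => rfl
    -- A vector in F is determined by its component b: vanishing at w prescribes the lattice point,
    -- and `pt` is injective.
    refine Finset.prod_bij (fun f _ => f.2.1) (fun f hf => ?_) (fun f hf f' hf' he => ?_)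
      (fun b hb => ?_) (fun f hf => ?_)
    · obtain ⟨j, -, hj⟩ := hform f hf
      refine mem_vanishing.2 ⟨(hR _).2 ((D.mem_Lbnd hd).1 (hmemF f hf)).2.1, j, ?_⟩
      rw [hj]
      exact (congrFun hsl _).symm
    · obtain ⟨j, e1, hj⟩ := hform f hf
      obtain ⟨j', e2, hj'⟩ := hform f' hf'
      rw [e1, e2, he]
      have : j = j' := B.pt_injective (by rw [hj, hj', he])
      rw [this]
    · obtain ⟨hb, j, hj⟩ := mem_vanishing.1 hb
      refine ⟨(α j, b, 0), (hF _).2 ⟨((D.mem_Lbnd hd).2 ⟨h.mem j, (hR b).1 hb, rfl⟩).1, ?_⟩, rfl⟩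
      rw [h.Psi_eq, hj, sub_eq_zero]
      exact (congrFun hsl b).symm
    · obtain ⟨j, e, hj⟩ := hform f hf
      rw [e, h.Psi_eq, hj]
      congr 1
      · exact D.slope_congr _ fun i => hσs y i
      · exact (congrFun hsl _).symm

end CuspDatum
end KudlaCusp

/-! ### Growth of the decaying part of the Green function. -/

namespace KudlaCusp
open Set Filter Module

section

variable {N : ℕ} {β : Type*}

theorem exists_controlled_sum (R : Finset β) {g : β → (Fin (N + 1) → ℂ) → ℂ}
    {p : Fin (N + 1) → ℂ} (h : ∀ b ∈ R, ∃ C, ∀ᶠ x in 𝓝 p, x 0 ≠ 0 →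
      Controlled (g b) x (cuspWeight x) C) :
    ∃ C, ∀ᶠ x in 𝓝 p, x 0 ≠ 0 → Controlled (fun y => ∑ b ∈ R, g b y) x (cuspWeight x) C := by
  classical
  induction R using Finset.induction_on with
  | empty =>
    refine ⟨0, Eventually.of_forall fun x _ => ⟨contDiffAt_const, le_rfl, fun h => ?_,
      fun h h' => ?_⟩⟩
    · simp
    · simp only [Finset.sum_empty, fderiv_fun_const, Pi.zero_def]
      simp
  | insert b R hb ih =>
    obtain ⟨C, hC⟩ := ih fun b' hb' => h b' (Finset.mem_insert_of_mem hb')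
    obtain ⟨C', hC'⟩ := h b (Finset.mem_insert_self b R)
    refine ⟨C' + C, ?_⟩
    filter_upwards [hC, hC'] with x h1 h2 hx
    simp only [Finset.sum_insert hb]
    exact (h2 hx).add (h1 hx)

theorem eventually_abs_le_of_continuousAt {X : Type*} [TopologicalSpace X] {f : X → ℝ} {p : X}
    (hf : ContinuousAt f p) : ∃ C, ∀ᶠ x in 𝓝 p, |f x| ≤ C :=
  ⟨|f p| + 1, (hf.abs.eventually_lt continuousAt_const (lt_add_one _)).mono fun _ h => h.le⟩

end

namespace CuspDatum

variable {k : Type*} [Field k] [NumberField k] {ι : k →+* ℂ} {d N : ℕ} (D : CuspDatum k ι d N)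

theorem contDiff_normA : ContDiff ℝ ∞ fun p : Fin (N + 1) → ℂ => D.normA fun i => p i.succ :=
  ContDiff.sum fun i _ => contDiff_const.mul ((contDiff_apply ℝ ℂ i.succ).norm_sq ℝ)

theorem contDiffAt_xiChart (r : ℚ) {p : Fin (N + 1) → ℂ} (hp : p 0 ≠ 0) :
    ContDiffAt ℝ ∞ (D.xiChart r) p :=
  (contDiffAt_const.mul (ContDiffAt.comp (g := fun z : ℂ => Real.log ‖z‖) p
    (contDiffAt_log_norm hp) (contDiff_apply ℝ ℂ 0).contDiffAt)).sub D.contDiff_normA.contDiffAt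

/-- The decaying part of the Green function attached to `b`. -/
def greenTail (B : LatticeBasis) (r : ℚ) (v : ℝ) (b : Fin N → k) (p : Fin (N + 1) → ℂ) : ℂ :=
  B.dualSum (D.slope b p, D.xiChart r p / (4 * Real.pi * v))

theorem contDiffAt_greenTail (B : LatticeBasis) (r : ℚ) {v : ℝ} (hv : 0 < v) (b : Fin N → k)
    {p : Fin (N + 1) → ℂ} (hp : p 0 ≠ 0) (hxi : 0 < D.xiChart r p) :
    ContDiffAt ℝ ∞ (D.greenTail B r v b) p := by
  have hτ : 0 < D.xiChart r p / (4 * Real.pi * v) := by positivity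
  have h1 : ContDiffAt ℝ ∞ B.dualSum (D.slope b p, D.xiChart r p / (4 * Real.pi * v)) :=
    B.contDiffOn_dualSum.contDiffAt ((isOpen_lt continuous_const continuous_snd).mem_nhds hτ)
  have h2 : ContDiffAt ℝ ∞ (D.slope (ι := ι) b) p :=
    ((D.slope b).restrictScalars ℝ).contDiff.contDiffAt
  exact ContDiffAt.comp (g := B.dualSum) p h1
    (h2.prodMk ((D.contDiffAt_xiChart r hp).div_const _))

/-- In the chart τ is a negative multiple of log|q| plus −ᵗuAū/(4πv), which is smooth across q = 0.
This is the shape treated by `LatticeBasis.controlled_dualSum`. -/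
theorem controlled_greenTail (B : LatticeBasis) (hd : 0 < d) {r : ℚ} (hr : 0 < r) {v : ℝ}
    (hv : 0 < v) (b : Fin N → k) {p : Fin (N + 1) → ℂ} (hp : p 0 = 0) :
    ∃ C, ∀ᶠ x in 𝓝 p, x 0 ≠ 0 → ‖D.greenTail B r v b x‖ ≤ C ∧
      Controlled (D.greenTail B r v b) x (cuspWeight x) C := by
  have hr' : (0 : ℝ) < r := by exact_mod_cast hr
  have hd' : 0 < Real.sqrt d := Real.sqrt_pos.2 (by exact_mod_cast hd)
  have hS : ContDiff ℝ ∞ fun x : Fin (N + 1) → ℂ =>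
      (D.slope (ι := ι) b x, -(D.normA fun i => x i.succ) / (4 * Real.pi * v)) :=
    ((D.slope b).restrictScalars ℝ).contDiff.prodMk (D.contDiff_normA.neg.div_const _)
  have ha : -(r * Real.sqrt d / Real.pi) / (4 * Real.pi * v) < 0 :=
    div_neg_of_neg_of_pos (neg_neg_of_pos (by positivity)) (by positivity)
  obtain ⟨C, hC⟩ := B.controlled_dualSum hS ha hp
  refine ⟨C, hC.mono fun x hx h0 => ?_⟩
  obtain ⟨h1, -, h2⟩ := hx h0
  have e : ∀ y, D.greenTail B r v b y = B.dualSum ((D.slope b y,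
      -(D.normA fun i => y i.succ) / (4 * Real.pi * v)) +
      (0, -(r * Real.sqrt d / Real.pi) / (4 * Real.pi * v) * Real.log ‖y 0‖)) := by
    intro y
    rw [greenTail, Prod.mk_add_mk, add_zero, xiChart]
    congr 2
    ring
  rw [show D.greenTail B r v b = _ from funext e]
  exact ⟨h1, h2⟩

end CuspDatum
end KudlaCusp

end

/-! ### The proposition. -/

open KudlaCusp KudlaCusp.CuspDatum in
theorem proposition3p6p1 {k : Type*} [Field k] [NumberField k] [NumberField.IsTotallyComplex k]
    (hquad : Module.finrank ℚ k = 2) (d : ℕ) (hd : NumberField.discr k = -(d : ℤ)) (hodd : Odd d)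
    (ι : k →+* ℂ) {N : ℕ} (D : CuspDatum k ι d N) (r : ℚ) (hr : D.IsWidth r)
    (m : ℤ) (hm : m ≠ 0) :
    (D.indexSet m).Finite ∧
    ∃ ε₀ : ℝ, 0 < ε₀ ∧ ∀ ε : ℝ, 0 < ε → ε ≤ ε₀ → ∀ v : ℝ, 0 < v →
      ∀ U : Set (Fin (N + 1) → ℂ), IsOpen U → U ⊆ D.chart r ε →
      ∀ ψ : (Fin (N + 1) → ℂ) → ℂ, D.IsEquationKR r m U ψ →
      ∃ E : (Fin (N + 1) → ℂ) → ℝ,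
        ContDiffOn ℝ ∞ E (U ∩ {p | p 0 ≠ 0}) ∧
        (∀ w ∈ D.domainEps ε, toChart r w ∈ U → ψ (toChart r w) ≠ 0 →
          Summable (fun f : D.Lbnd m => D.grTerm v w f) ∧
          E (toChart r w) = Real.log (‖ψ (toChart r w)‖ ^ 2)
            - (D.Ind m : ℝ) * D.xi w / (4 * v * D.vol) + D.GrBnd m v w) ∧
        (∀ p ∈ U, ∃ B : Set (Fin (N + 1) → ℂ), IsOpen B ∧ p ∈ B ∧
          ∃ C : ℝ, ∀ x ∈ U ∩ B ∩ {x | x 0 ≠ 0}, |E x| ≤ C) ∧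
        LogLogGrowth U (del fun p => (E p : ℂ)) ∧
        LogLogGrowth U (delBar fun p => (E p : ℂ)) ∧
        LogLogGrowth U (delDelBar fun p => (E p : ℂ)) := by
  have hd0 : 0 < d := by
    have := NumberField.discr_ne_zero k
    rw [hd] at this
    exact Nat.pos_of_ne_zero (by simpa using this)
  have hr0 := hr.1
  refine ⟨D.finite_indexSet hquad hd0 m, ?_⟩
  obtain ⟨η, hη, hηc⟩ := exists_le_norm_sq ι hquad (M := (D.𝔠₀ : Submodule (𝓞 k) k)) D.𝔠₀.2
  obtain ⟨Λ, α, hΛ⟩ := D.exists_isCuspBasis hquad hd0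
  set R : Finset (Fin N → k) := (D.finite_shell hquad m).toFinset with hRdef
  have hR : ∀ b, b ∈ R ↔ b ∈ D.shell m := fun b => by simp [R]
  have hs0 : ∀ b ∈ R, D.slope (ι := ι) b ≠ 0 := fun b hb =>
    D.slope_ne_zero (D.ne_zero_of_mem_shell hm ((hR b).1 hb))
  have hs1 : ∀ b ∈ R, D.slope (ι := ι) b (Pi.single 0 1) = 0 := fun b _ => by
    rw [slope_apply]; simp
  have hmpos : (0 : ℝ) < |(m : ℝ)| := by positivity
  -- Here η bounds |c|² from below for nonzero c in 𝔠₀. If ξ > 1/ε ≥ |m|/η, then ξ|c|² ≤ m is only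
  -- possible for c = 0. Nothing in this choice involves v.
  refine ⟨η / |(m : ℝ)|, by positivity, fun ε hε hεle v hv U hU hUchart ψ hψ => ?_⟩
  have hxi : ∀ p ∈ U, p 0 ≠ 0 → 1 / ε < D.xiChart r p := fun p hp h0 =>
    (mem_chart hd0 hr0 h0).1 (hUchart hp)
  have hfac0 : ∀ p ∈ U, p 0 ≠ 0 → HasFactorization Λ R D.slope ψ p := by
    intro p hp h0
    have hlt := hxi p hp h0
    obtain ⟨w, rfl⟩ := exists_toChart_eq hr0 h0
    rw [xiChart_toChart hd0 hr0] at hlt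
    refine hΛ.hasFactorization_of_ne_zero hd0 hR hr0 hψ ((one_div_pos.2 hε).trans hlt)
      (fun f hf hf0 => ?_) hp
    by_contra hc
    have h1 := D.xi_mul_le hd0 hf hf0
    have h2 := hηc _ (D.mem_L.1 hf.1).2.2 hc
    have h3 : |(m : ℝ)| / η ≤ 1 / ε := by
      rw [div_le_div_iff₀ hη hε]
      rw [le_div_iff₀ hmpos] at hεle
      linarith
    have h4 : |(m : ℝ)| < D.xi w * η := (div_lt_iff₀ hη).1 (h3.trans_lt hlt)
    have h5 : D.xi w * η ≤ D.xi w * ‖ι f.2.2‖ ^ 2 :=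
      mul_le_mul_of_nonneg_left h2 ((one_div_pos.2 hε).trans hlt).le
    linarith [le_abs_self (m : ℝ)]
  have hfac : ∀ p ∈ U, HasFactorization Λ R D.slope ψ p := by
    intro p hp
    by_cases h0 : p 0 = 0
    · refine hasFactorization_of_frequently hs0 hs1 h0 ?_ ?_ (hψ.2.2 p hp h0)
      · filter_upwards [hU.mem_nhds hp] with x hx using (hψ.1 x hx).contDiffAt
      · filter_upwards [hU.mem_nhds hp] with x hx using hfac0 x hx
    · exact hfac0 p hp h0
  -- The constant −π/|det| is the part of π(τ − 1)/|det| that does not grow with τ; the rest cancels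
  -- against the multiple of ξ.
  obtain ⟨G, hG, hGeq⟩ := exists_regularization hs0 hs1 hU hfac (-(Real.pi / |Λ.det|))
  have hE0 : ∀ p ∈ U, p 0 ≠ 0 →
      ContDiffAt ℝ ∞ (fun p => G p - ∑ b ∈ R, (D.greenTail Λ r v b p).re) p := fun p hp h0 =>
    (hG p hp).sub (ContDiffAt.sum fun b _ => Complex.reCLM.contDiff.contDiffAt.comp p
      (D.contDiffAt_greenTail Λ r hv b h0 ((one_div_pos.2 hε).trans (hxi p hp h0))))
  refine ⟨fun p => G p - ∑ b ∈ R, (D.greenTail Λ r v b p).re,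
    fun p hp => (hE0 p hp.1 hp.2).contDiffWithinAt, fun w hw hwU hw0 => ?_, fun p hp => ?_, ?_⟩
  · have hxi0 : 0 < D.xi w := (one_div_pos.2 hε).trans ((D.mem_domainEps hd0 hε).1 hw)
    have hslope : ∀ b, D.slope (ι := ι) b (toChart r w) = D.slope b w := fun b =>
      D.slope_congr b fun i => rfl
    have hsum := hΛ.hasSum_grTerm hd0 hR hv hxi0 fun b hb j => by
      rw [← hslope b]
      exact (hfac _ hwU).pt_ne hw0 hb j
    refine ⟨hsum.summable, ?_⟩
    beta_reduce
    rw [GrBnd, hsum.tsum_eq, hGeq _ hwU hw0, hΛ.vol_eq, D.Ind_eq hd0,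
      show D.shell m = (R : Set (Fin N → k)) from Set.ext fun b => (hR b).symm, Set.ncard_coe_finset]
    have hcard : (R.card : ℝ) * D.xi w / (4 * v * |Λ.det|) =
        ∑ b ∈ R, D.xi w / (4 * v * |Λ.det|) := by
      rw [Finset.sum_const, nsmul_eq_mul, mul_div_assoc]
    rw [hcard, sub_add_eq_add_sub, add_sub_assoc, add_sub_assoc, ← Finset.sum_sub_distrib,
      ← Finset.sum_sub_distrib]
    congr 1
    refine Finset.sum_congr rfl fun b _ => ?_
    rw [greenTail, xiChart_toChart hd0 hr0, hslope]
    have := abs_ne_zero.2 Λ.det_ne_zero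
    have := Real.pi_ne_zero
    field_simp
    ring
  · have hbd : ∃ C, ∀ᶠ x in 𝓝 p, x 0 ≠ 0 → |G x - ∑ b ∈ R, (D.greenTail Λ r v b x).re| ≤ C := by
      by_cases h0 : p 0 = 0
      · obtain ⟨C, hC⟩ := eventually_abs_le_of_continuousAt (hG p hp).continuousAt
        choose K hK using fun b => D.controlled_greenTail Λ hd0 hr0 hv b h0
        refine ⟨C + ∑ b ∈ R, K b, ?_⟩
        filter_upwards [hC, (Filter.eventually_all_finset R).2 fun b _ => hK b] with x h1 h2 hx
        refine (abs_sub _ _).trans (add_le_add h1 ((Finset.abs_sum_le_sum_abs _ _).trans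
          (Finset.sum_le_sum fun b hb => (Complex.abs_re_le_norm _).trans (h2 b hb hx).1)))
      · obtain ⟨C, hC⟩ := eventually_abs_le_of_continuousAt (hE0 p hp h0).continuousAt
        exact ⟨C, hC.mono fun x hx _ => hx⟩
    obtain ⟨C, hC⟩ := hbd
    obtain ⟨V, hV, hVo, hpV⟩ := eventually_nhds_iff.1 hC
    exact ⟨V, hVo, hpV, C, fun x hx => hV x hx.1.2 hx.2⟩
  · refine logLogGrowth_of_controlled fun p hp h0 => ?_
    have hGc : ∀ q ∈ U, ContDiffAt ℝ ∞ (fun p => (G p : ℂ)) q := fun q hq =>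
      Complex.ofRealCLM.contDiff.contDiffAt.comp q (hG q hq)
    obtain ⟨C, hC⟩ := Controlled.of_contDiffAt (hGc p hp)
      (Filter.mem_of_superset (hU.mem_nhds hp) hGc)
    -- The real-linear map is minus the real part, viewed in ℂ. It turns the bounds for the complex
    -- tails into bounds for the terms subtracted from G.
    obtain ⟨K, hK⟩ := exists_controlled_sum R
      (g := fun b y => (-(Complex.ofRealCLM.comp Complex.reCLM)) (D.greenTail Λ r v b y))
      fun b _ => by
        obtain ⟨C, hC⟩ := D.controlled_greenTail Λ hd0 hr0 hv b h0
        exact ⟨_, hC.mono fun x hx h0 => (hx h0).2.clm_comp _ (cuspWeight_nonneg x)⟩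
    refine ⟨C * (1 ^ 2 + 1) + K, ?_⟩
    filter_upwards [hC, hK] with x h1 h2 hx
    have h3 := (h1.weight_mono (w' := cuspWeight x) (fun h => norm_nonneg h) zero_le_one
      (fun h => by rw [one_mul]; exact norm_le_cuspWeight x h) (cuspWeight_nonneg x)).add (h2 hx)
    convert h3 using 2 with y
    simp [sub_eq_add_neg]
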